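/- Let $\Sigma$ be a smooth manifold of dimension $n$, let $T^*\Sigma$ carry its canonical symplectic form $\omega=\sum dy_i\wedge dx^i$, with projection $\pi:T^*\Sigma\to\Sigma$, and let $H:T^*\Sigma\to\mathbb R$ be a smooth convex hamiltonian, that is, the Hessian of the restriction of $H$ to each fibre $T_x^*\Sigma$ is everywhere positive definite. Suppose that the hamiltonian flow $\varphi$ of $H$ ($\dot x^i=\partial H/\partial y_i$, $\dot y_i=-\partial H/\partial x^i$) is complete. Let $F\subset H^{-1}(c)$ be a compact lagrangian submanifold of $T^*\Sigma$ without boundary (such an $F$ is $\varphi$-invariant) such that 1. the Maslov cocycle of $F$ vanishes in $H^1(F;\mathbb Z)$. Here the Maslov cocycle is the primary difference between the sections $r=TF$ and $s=\ker d\pi$ of the bundle of lagrangian planes of $T(T^*\Sigma)|_F$: on a loop $\gamma:\mathbb R/\mathbb Z\to F$ its value is $\deg(\det^2\circ r)-\deg(\det^2\circ s)$, computed in a symplectic trivialization of $\gamma^*T(T^*\Sigma)$, where $\det^2:U_n/O_n\to U_1$ is defined on the lagrangian planes of $\mathbb C^n$; 2. every point of $F$ is non-wandering for $\varphi|F$,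 i.e. for each $x\in F$ and each neighbourhood $U$ of $x$ in $F$ there is $t>1$ with $\varphi_t(U)\cap U\neq\emptyset$. Then $\rho=\pi|_F:F\to\Sigma$ is a smooth covering map (a local diffeomorphism that is a covering map, where fibres over some components of $\Sigma$ may be empty); it is surjective if $\Sigma$ is connected and $F$ is non-empty. In particular, if $F$ is diffeomorphic to the torus $\mathbb T^n=(S^1)^n$, then there is a smooth covering map $\mathbb T^n\to\Sigma$ with finite fibres, which is surjective if $\Sigma$ is connected. -/

import Mathlib

open Bundle Manifold Topology
open scoped ContDiff

noncomputable section

/-- The model space `ℝⁿ` of an `n`-dimensional manifold. -/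
abbrev Vec (n : ℕ) : Type := EuclideanSpace ℝ (Fin n)

/-- The dual space `(ℝⁿ)*`, the model of the fibres of a cotangent bundle. -/
abbrev Covec (n : ℕ) : Type := Vec n →L[ℝ] ℝ

/-- The cotangent space of `S` at `x`. -/
abbrev CotangentSpace (n : ℕ) {S : Type*} [TopologicalSpace S] [ChartedSpace (Vec n) S]
    (x : S) : Type :=
  TangentSpace (𝓡 n) x →L[ℝ] Trivial S ℝ x

/-- The cotangent bundle `T^*S`, with the manifold structure of the vector bundle `Hom(TS, ℝ)`:
a chart `x` of `S` induces the canonical chart `(x, y)` of `T^*S`, in which `y` is the covector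
written in the frame dual to the coordinate frame of `x`. -/
abbrev Cotangent (n : ℕ) (S : Type*) [TopologicalSpace S] [ChartedSpace (Vec n) S]
    [IsManifold (𝓡 n) ∞ S] : Type _ :=
  TotalSpace (Covec n) (fun x : S => CotangentSpace n x)

/-- The model (without boundary) `ℝⁿ × (ℝⁿ)*` of `T^*S`. -/
abbrev cotModel (n : ℕ) : ModelWithCorners ℝ (Vec n × Covec n) (ModelProd (Vec n) (Covec n)) :=
  (𝓡 n).prod 𝓘(ℝ, Covec n)

section cotangent

variable {n : ℕ} {S : Type*} [TopologicalSpace S] [ChartedSpace (Vec n) S]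
  [IsManifold (𝓡 n) ∞ S]

/-- The coordinates `(dx, dy)` of a tangent vector of `T^*S` at `θ`, in the canonical chart
of `T^*S` at `θ`. -/
def canonicalCoord (θ : Cotangent n S) (v : TangentSpace (cotModel n) θ) : Vec n × Covec n := v

/-- The tangent vector of `T^*S` at `θ` that has the given coordinates `(dx, dy)` in the
canonical chart of `T^*S` at `θ`. -/
def ofCanonicalCoord (θ : Cotangent n S) (z : Vec n × Covec n) : TangentSpace (cotModel n) θ := z

/-- `canonicalCoord θ` is the derivative at `θ` of the canonical chart at `θ`. -/
theorem canonicalCoord_eq_mfderiv (θ : Cotangent n S) (v : TangentSpace (cotModel n) θ) :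
    canonicalCoord θ v =
      mfderiv (cotModel n) 𝓘(ℝ, Vec n × Covec n) (extChartAt (cotModel n) θ) θ v := by
  have hd : MDifferentiableAt (cotModel n) 𝓘(ℝ, Vec n × Covec n)
      (extChartAt (cotModel n) θ) θ :=
    mdifferentiableAt_extChartAt (mem_chart_source _ θ)
  have h : mfderiv (cotModel n) 𝓘(ℝ, Vec n × Covec n) (extChartAt (cotModel n) θ) θ =
      tangentCoordChange (cotModel n) θ θ θ := if_pos hd
  refine Eq.trans ?_ (DFunLike.congr_fun h v).symm
  exact (tangentCoordChange_self (I := cotModel n) (v := canonicalCoord θ v)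
    (mem_extChartAt_source (I := cotModel n) θ)).symm

/-- The canonical chart of `T^*S` at `θ₀` sends `(q, p)` to the chart of `S` at `q₀`, evaluated
at `q`, and the covector `p` composed with the inverse of the derivative of that chart. -/
theorem canonicalChart_apply (θ₀ θ : Cotangent n S) :
    extChartAt (cotModel n) θ₀ θ =
      (extChartAt (𝓡 n) θ₀.proj θ.proj,
        (θ.2 : TangentSpace (𝓡 n) θ.proj →L[ℝ] ℝ).comp
          ((trivializationAt (Vec n) (TangentSpace (𝓡 n)) θ₀.proj).symmL ℝ θ.proj)) := by
  have h : chartAt (ModelProd (Vec n) (Covec n)) θ₀ θ =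
      (chartAt (Vec n) θ₀.proj θ.proj, ContinuousLinearMap.inCoordinates (Vec n)
        (TangentSpace (𝓡 n)) ℝ (Trivial S ℝ) θ₀.proj θ.proj θ₀.proj θ.proj θ.2) :=
    hom_chart θ₀ θ
  simp only [extChartAt, OpenPartialHomeomorph.extend_coe, Function.comp_apply]
  rw [h]
  ext v
  · rfl
  · simp [ContinuousLinearMap.inCoordinates]

/-- The canonical symplectic form `ω = ∑ dyᵢ ∧ dxⁱ` of `T^*S`. -/
def canonicalForm (θ : Cotangent n S) (v w : TangentSpace (cotModel n) θ) : ℝ :=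
  (canonicalCoord θ v).2 (canonicalCoord θ w).1 - (canonicalCoord θ w).2 (canonicalCoord θ v).1

/-- The hamiltonian vector field `X_H`: in canonical coordinates, `ẋⁱ = ∂H/∂yᵢ` and
`ẏᵢ = -∂H/∂xⁱ`. -/
def hamVectorField (H : Cotangent n S → ℝ) (θ : Cotangent n S) : TangentSpace (cotModel n) θ :=
  let dH : Vec n × Covec n → ℝ := fun z =>
    mfderiv (cotModel n) 𝓘(ℝ, ℝ) H θ (ofCanonicalCoord θ z)
  ofCanonicalCoord θ
    (∑ i : Fin n, dH (0, EuclideanSpace.proj i) • EuclideanSpace.single i (1 : ℝ),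
      -∑ i : Fin n, dH (EuclideanSpace.single i (1 : ℝ), 0) •
        (EuclideanSpace.proj i : Vec n →L[ℝ] ℝ))

/-- `X_H` is the symplectic gradient: `ω(X_H, v) = -dH(v)`. -/
theorem canonicalForm_hamVectorField (H : Cotangent n S → ℝ) (θ : Cotangent n S)
    (v : TangentSpace (cotModel n) θ) :
    canonicalForm θ (hamVectorField H θ) v = -(mfderiv (cotModel n) 𝓘(ℝ, ℝ) H θ v : ℝ) := by
  have key : ∀ (L : Vec n × Covec n →L[ℝ] ℝ) (a : Vec n) (b : Covec n),
      (-∑ i : Fin n, L (EuclideanSpace.single i (1 : ℝ), 0) •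
        (EuclideanSpace.proj i : Vec n →L[ℝ] ℝ)) a -
      b (∑ i : Fin n, L (0, EuclideanSpace.proj i) • EuclideanSpace.single i (1 : ℝ)) =
      -L (a, b) := by
    intro L a b
    have ha : a = ∑ i : Fin n, a i • EuclideanSpace.single i (1 : ℝ) := by
      ext j; simp [Finset.sum_apply, Pi.single_apply]
    have hb : b = ∑ i : Fin n, b (EuclideanSpace.single i (1 : ℝ)) •
        (EuclideanSpace.proj i : Vec n →L[ℝ] ℝ) := by
      ext x
      have hx : x = ∑ i : Fin n, x i • EuclideanSpace.single i (1 : ℝ) := by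
        ext j; simp [Finset.sum_apply, Pi.single_apply]
      conv_lhs => rw [hx]
      simp [mul_comm]
    have h1 : L (a, b) = L (a, 0) + L (0, b) := by rw [← map_add]; simp
    have h2 : L (a, 0) = ∑ i : Fin n, a i * L (EuclideanSpace.single i (1 : ℝ), 0) := by
      have := map_sum (L.comp (ContinuousLinearMap.inl ℝ (Vec n) (Covec n)))
        (fun i : Fin n => a i • EuclideanSpace.single i (1 : ℝ)) Finset.univ
      rw [← ha] at this
      simpa using this
    have h3 : L (0, b) = ∑ i : Fin n, b (EuclideanSpace.single i (1 : ℝ)) *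
        L (0, EuclideanSpace.proj i) := by
      have := map_sum (L.comp (ContinuousLinearMap.inr ℝ (Vec n) (Covec n)))
        (fun i : Fin n => b (EuclideanSpace.single i (1 : ℝ)) •
          (EuclideanSpace.proj i : Vec n →L[ℝ] ℝ)) Finset.univ
      rw [← hb] at this
      simpa using this
    rw [h1, h2, h3]
    simp [mul_comm]
    ring
  exact key (mfderiv (cotModel n) 𝓘(ℝ, ℝ) H θ) (canonicalCoord θ v).1 (canonicalCoord θ v).2

/-- `φ` is the (complete) flow of the hamiltonian vector field `X_H`. -/
def IsHamiltonianFlow (H : Cotangent n S → ℝ) (φ : Flow ℝ (Cotangent n S)) : Prop :=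
  ∀ θ, IsMIntegralCurve (I := cotModel n) (fun t : ℝ => φ t θ) (hamVectorField H)

/-- A smooth function on `T^*S` is a convex hamiltonian if its restriction to each fibre
`T^*_xS` has everywhere a positive definite Hessian. -/
structure IsConvexHamiltonian (H : Cotangent n S → ℝ) : Prop where
  contMDiff : ContMDiff (cotModel n) 𝓘(ℝ, ℝ) ∞ H
  hessian_pos : ∀ (x : S) (p η : CotangentSpace n x), η ≠ 0 →
    0 < iteratedDeriv 2 (fun t : ℝ => H ⟨x, p + t • η⟩) 0

/-- The vertical subspace `V_θ = ker d_θπ` of `T_θ(T^*S)`. -/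
def verticalSpace (θ : Cotangent n S) : Submodule ℝ (TangentSpace (cotModel n) θ) :=
  LinearMap.ker (mfderiv (cotModel n) (𝓡 n)
    (TotalSpace.proj : Cotangent n S → S) θ).toLinearMap

/-- `ι : F → T^*S` is the inclusion of a lagrangian submanifold: a smooth embedding of a manifold
of dimension `n = dim S` on which the canonical symplectic form vanishes. -/
structure IsLagrangianEmbedding {F : Type*} [TopologicalSpace F] [ChartedSpace (Vec n) F]
    (ι : F → Cotangent n S) : Prop where
  isSmoothEmbedding : IsSmoothEmbedding (𝓡 n) (cotModel n) ∞ ι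
  isotropic : ∀ (p : F) (v w : TangentSpace (𝓡 n) p),
    canonicalForm (ι p) (mfderiv (𝓡 n) (cotModel n) ι p v)
      (mfderiv (𝓡 n) (cotModel n) ι p w) = 0

/-- The plane `r(p) = T_pF`, seen in `T_{ι(p)}(T^*S)`. -/
def tangentPlane {F : Type*} [TopologicalSpace F] [ChartedSpace (Vec n) F]
    (ι : F → Cotangent n S) (p : F) : Submodule ℝ (TangentSpace (cotModel n) (ι p)) :=
  LinearMap.range (mfderiv (𝓡 n) (cotModel n) ι p).toLinearMap

end cotangent

section maslov

/-- The standard symplectic form of `ℂⁿ`: the imaginary part of the standard hermitian product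
`∑ zᵢ w̄ᵢ`, that is, `∑ dyᵢ ∧ dxⁱ` for `z = x + iy`. -/
def stdForm {n : ℕ} (z w : Fin n → ℂ) : ℝ :=
  (∑ i, z i * starRingEnd ℂ (w i)).im

/-- The real subspace of `ℂⁿ` that is spanned by the columns of a matrix. For unitary matrices `u`
these are exactly the lagrangian planes, and the map `u ↦ colSpan u` identifies
`Uₙ / Oₙ` with the lagrangian grassmannian `Λₙ`. -/
def colSpan {n : ℕ} (u : Matrix (Fin n) (Fin n) ℂ) : Submodule ℝ (Fin n → ℂ) :=
  Submodule.span ℝ (Set.range u.col)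

/-- `IsDetSq L z`: the plane `L` is lagrangian and the map `det² : Λₙ → U₁` has the value
`z` at `L`. -/
def IsDetSq {n : ℕ} (L : Submodule ℝ (Fin n → ℂ)) (z : ℂ) : Prop :=
  ∃ u ∈ Matrix.unitaryGroup (Fin n) ℂ, colSpan u = L ∧ z = u.det ^ 2

/-- The map `f : U₁ = ℝ/ℤ → U₁ ⊂ ℂ` is continuous of degree `k`: it has a continuous lift `g`,
`f = exp(2πi g)`, with `g(t + 1) = g(t) + k`. -/
def HasCircleDegree (f : UnitAddCircle → ℂ) (k : ℤ) : Prop :=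
  ∃ g : ℝ → ℝ, Continuous g ∧
    (∀ t : ℝ, f (t : UnitAddCircle) = Complex.exp (2 * Real.pi * Complex.I * g t)) ∧
    ∀ t : ℝ, g (t + 1) = g t + k

variable {n : ℕ} {S : Type*} [TopologicalSpace S] [ChartedSpace (Vec n) S]
  [IsManifold (𝓡 n) ∞ S]

/-- A symplectic trivialization `U₁ × ℂⁿ → c^*E` of the pull-back of the symplectic vector bundle
`E = T(T^*S)` by a loop `c` in `T^*S`: a continuous family of linear maps
`Φ t : ℂⁿ → E_{c(t)}` that carry the standard symplectic form to `ω`. (As the dimensions agree,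
each `Φ t` is an isomorphism.) -/
structure SymplecticTrivialization (c : UnitAddCircle → Cotangent n S) where
  toLin : ∀ t, (Fin n → ℂ) →ₗ[ℝ] TangentSpace (cotModel n) (c t)
  continuous_toLin : ∀ z : Fin n → ℂ,
    Continuous fun t => (⟨c t, toLin t z⟩ : TangentBundle (cotModel n) (Cotangent n S))
  symplectic : ∀ t z w, canonicalForm (c t) (toLin t z) (toLin t w) = stdForm z w

/-- The family of planes `L t ⊂ E_{c(t)}` is lagrangian, and `deg (det² ∘ L) = k` in the
trivialization `Φ` of `c^*E`. -/
def SymplecticTrivialization.HasDegree {c : UnitAddCircle → Cotangent n S}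
    (Φ : SymplecticTrivialization c)
    (L : ∀ t, Submodule ℝ (TangentSpace (cotModel n) (c t))) (k : ℤ) : Prop :=
  ∃ f : UnitAddCircle → ℂ,
    (∀ t, IsDetSq ((L t).comap (Φ.toLin t)) (f t)) ∧ HasCircleDegree f k

variable {F : Type*} [TopologicalSpace F] [ChartedSpace (Vec n) F]

/-- The Maslov cocycle of `ι : F → T^*S`, the primary difference between the section `r = TF`
and the vertical section `s = V` of the bundle of lagrangian planes, takes the value `k` on the
loop `γ` in `F`: in a symplectic trivialization of `E` over the loop, this value
is `deg (det² ∘ r) - deg (det² ∘ s)`. -/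
def HasMaslovIndex (ι : F → Cotangent n S) (γ : C(UnitAddCircle, F)) (k : ℤ) : Prop :=
  ∃ (Φ : SymplecticTrivialization fun t => ι (γ t)) (a b : ℤ),
    Φ.HasDegree (fun t => tangentPlane ι (γ t)) a ∧
    Φ.HasDegree (fun t => verticalSpace (ι (γ t))) b ∧
    k = a - b

/-- The Maslov cocycle of `F` vanishes in `H¹(F; ℤ) = Hom(H₁(F), ℤ)`, that is, on all loops. -/
def MaslovCocycleVanishes (ι : F → Cotangent n S) : Prop :=
  ∀ γ : C(UnitAddCircle, F), HasMaslovIndex ι γ 0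

end maslov

/-- The non-wandering set of the restriction `φ|A` of a flow to an invariant set `A`: the points
`x ∈ A` such that for each neighbourhood `U ∩ A` of `x` in `A` some `φ_t(U ∩ A)` with `t > 1`
meets `U ∩ A`. -/
def nonwanderingSet {X : Type*} [TopologicalSpace X] (φ : Flow ℝ X) (A : Set X) : Set X :=
  {x | x ∈ A ∧ ∀ U ∈ 𝓝 x, ∃ t : ℝ, 1 < t ∧ ((φ t '' (U ∩ A)) ∩ (U ∩ A)).Nonempty}

/-- The standard torus `𝕋ⁿ`, a product of circles. -/
abbrev StdTorus (n : ℕ) : Type := Fin n → Circle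

/-- The model with corners (without boundary) of the product manifold `𝕋ⁿ`. -/
abbrev torusModel (n : ℕ) :
    ModelWithCorners ℝ (Fin n → Vec 1) (ModelPi fun _ : Fin n => Vec 1) :=
  ModelWithCorners.pi fun _ : Fin n => 𝓡 1

/-- `𝕋ⁿ` is a smooth manifold. -/
instance StdTorus.isManifold (n : ℕ) : IsManifold (torusModel n) ∞ (StdTorus n) := by
  apply isManifold_of_contDiffOn
  rintro _ _ ⟨e, he, rfl⟩ ⟨e', he', rfl⟩
  rw [contDiffOn_pi]
  intro i
  have h := (contDiffGroupoid ∞ (𝓡 1)).compatible (he i (Set.mem_univ i)) (he' i (Set.mem_univ i))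
  have h1 := (mem_groupoid_of_pregroupoid.1 h).1
  exact h1.comp (contDiff_apply ℝ (Vec 1) i).contDiffOn
    fun x hx => ⟨⟨hx.1.1 i (Set.mem_univ i), hx.1.2 i (Set.mem_univ i)⟩, by simp⟩

/-- A smooth covering map: a local diffeomorphism that is a covering map. (Mathlib's covering maps
may have empty fibres.) -/
structure IsSmoothCoveringMap {E E' H H' : Type*} [NormedAddCommGroup E] [NormedSpace ℝ E]
    [NormedAddCommGroup E'] [NormedSpace ℝ E'] [TopologicalSpace H] [TopologicalSpace H']
    (I : ModelWithCorners ℝ E H) (I' : ModelWithCorners ℝ E' H')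
    {M N : Type*} [TopologicalSpace M] [ChartedSpace H M] [TopologicalSpace N] [ChartedSpace H' N]
    (f : M → N) : Prop where
  isCoveringMap : IsCoveringMap f
  isLocalDiffeomorph : IsLocalDiffeomorph I I' ∞ f
end

/-!
Let `ι : F → T^*S` be the embedding of a compact lagrangian submanifold of the energy level `c` of
a convex hamiltonian. All the work goes into one assertion: the tangent planes of `F` are everywhere
transverse to the vertical planes (`isTransverseAt_of_nonwandering`). Then the projection `F → S` is
a local diffeomorphism by the inverse function theorem (`isLocalDiffeomorph_proj_comp`), and, `F`
being compact, it is a covering map with finite fibres whose image is open and closed.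

The hamiltonian vector field is tangent to `F`, since `F` lies in an energy level and is its own
symplectic complement (`exists_mfderiv_eq_hamVectorField`); so the flow restricts to `F`
(`exists_flow_restrict`). Differentiating `H ∘ ι = c` twice and the isotropy of `F` once, one finds
that along an orbit the tangent plane turns at a rate given by the Hessian of `H`
(`secondDeriv_pairing`). Convexity makes this rate positive on the vertical tangent vectors
(`exists_hasDerivAt_tangentFrame`): whenever the tangent plane meets the vertical plane along an
orbit, it passes through it in the same direction. The form in which this is used involves
rotations: near a tangency at time `t₀`, the two planes remain transverse after a rotation by the
angle `α` as long as `t ≤ t₀, 0 ≤ α` or `t₀ ≤ t, α ≤ 0` and `(t, α) ≠ (t₀, 0)`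
(`eventually_transverse_of_velocity_pos`, a compactness argument which needs no normal form for the
intersection). In particular the tangencies on an orbit are isolated
(`eventually_isTransverseAt_flow`).

To compare this with the Maslov cocycle, a lagrangian plane of `ℂⁿ` spanned by the columns of a
unitary matrix `u` is encoded by `u uᵀ`, which depends only on the plane and continuously so
(`continuousAt_mul_transpose`). For planes given by `u` and `v`, the unitary matrix
`v vᵀ (u uᵀ)⁻¹` has the eigenvalue `exp (2 i α)` exactly when the planes meet after a rotation by
`α` (`exists_mem_colSpan_of_det_eq_zero`, `det_relUnitary_sub_one_eq_zero`), and on a loop the degree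
of its determinant is the negative of the Maslov index. The sum of the angles of its eigenvalues is
a continuous function of the matrix as long as no eigenvalue equals `exp (2 i α)`
(`continuousOn_angleSum`); comparing it with a logarithm of the determinant yields an integer,
`crossingIndex`, which jumps exactly where an eigenvalue passes through `exp (2 i α)`. If all
passages through `1` have the same direction, this integer is monotone along the loop; if the
degree is `0`, it is also periodic, so that there are no passages (`regularAngle_zero_of_loop`).
Hence a loop in `F` which follows the flow near all its tangencies has none
(`isTransverseAt_of_loop`).

It remains to put a given point `p` of `F` on such a loop. Suppose that `p` were a tangency. The
points of its orbit shortly before and after it are transverse, and so are all points near those. As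
`F` is non-wandering, some orbit segment that starts near the earlier point passes near the later
one and comes back; joining its pieces to the orbit of `p` by short paths of transverse points gives
the loop.
-/

noncomputable section

/-! ### The canonical symplectic form in canonical charts -/

/-- The standard symplectic form of `ℝⁿ × (ℝⁿ)*`, as a functional of its second argument. -/
def coordForm {n : ℕ} (z : Vec n × Covec n) : (Vec n × Covec n) →L[ℝ] ℝ :=
  z.2.comp (ContinuousLinearMap.fst ℝ (Vec n) (Covec n)) -
    (ContinuousLinearMap.apply ℝ ℝ z.1).comp (ContinuousLinearMap.snd ℝ (Vec n) (Covec n))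

theorem coordForm_apply {n : ℕ} (z w : Vec n × Covec n) :
    coordForm z w = z.2 w.1 - w.2 z.1 := by
  simp [coordForm]

theorem coordForm_swap {n : ℕ} (z w : Vec n × Covec n) :
    coordForm z w = -coordForm w z := by
  simp [coordForm_apply]

/-- The derivative of a cotangent lift is symplectic: the second derivative of the base map enters
through a symmetric bilinear form, which cancels. -/
theorem coordForm_of_hasFDerivAt_cotangentLift {n : ℕ} {ψ χ : Vec n → Vec n} {z : Vec n × Covec n}
    {T : Vec n × Covec n → Vec n × Covec n}
    {T' : (Vec n × Covec n) →L[ℝ] (Vec n × Covec n)} (hψ : DifferentiableAt ℝ ψ z.1)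
    (hχ : ContDiffAt ℝ 2 χ (ψ z.1)) (hχψ : ∀ᶠ x in 𝓝 z.1, χ (ψ x) = x)
    (hT : T =ᶠ[𝓝 z] fun w => (ψ w.1, w.2.comp (fderiv ℝ χ (ψ w.1))))
    (hT' : HasFDerivAt T T' z) (v w : Vec n × Covec n) :
    coordForm (T' v) (T' w) = coordForm v w := by
  obtain ⟨x, y⟩ := z
  have hdχ : HasFDerivAt (fderiv ℝ χ) (fderiv ℝ (fderiv ℝ χ) (ψ x)) (ψ x) :=
    ((hχ.fderiv_right (m := 1) (by norm_num)).differentiableAt (by norm_num)).hasFDerivAt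
  have hsymm : ∀ a b, fderiv ℝ (fderiv ℝ χ) (ψ x) a b = fderiv ℝ (fderiv ℝ χ) (ψ x) b a :=
    fun a b => (hχ.isSymmSndFDerivAt (by simp)).eq a b
  have hψ1 : HasFDerivAt (fun w : Vec n × Covec n => ψ w.1)
      ((fderiv ℝ ψ x).comp (ContinuousLinearMap.fst ℝ (Vec n) (Covec n))) (x, y) :=
    HasFDerivAt.comp (x, y) (f := Prod.fst) hψ.hasFDerivAt hasFDerivAt_fst
  have h2 := (hasFDerivAt_snd (𝕜 := ℝ) (p := (x, y))).clm_comp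
    (HasFDerivAt.comp (x, y) (f := fun w : Vec n × Covec n => ψ w.1) hdχ hψ1)
  have h3 := (hψ1.prodMk h2).congr_of_eventuallyEq hT
  have hinv : ∀ a, fderiv ℝ χ (ψ x) (fderiv ℝ ψ x a) = a := by
    intro a
    have h4 : HasFDerivAt (χ ∘ ψ) _ x := (hχ.differentiableAt (by norm_num)).hasFDerivAt.comp x
      hψ.hasFDerivAt
    have h5 : HasFDerivAt (χ ∘ ψ) (ContinuousLinearMap.id ℝ _) x :=
      (hasFDerivAt_id x).congr_of_eventuallyEq hχψ
    exact DFunLike.congr_fun (h4.unique h5) a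
  rw [hT'.unique h3]
  simp [coordForm_apply, hinv]
  rw [hsymm]
  ring

section
variable {n : ℕ} {S : Type*} [TopologicalSpace S] [ChartedSpace (Vec n) S]
  [IsManifold (𝓡 n) ∞ S]

theorem mem_cotangent_chart_source {θ₀ θ : Cotangent n S} :
    θ ∈ (chartAt (ModelProd (Vec n) (Covec n)) θ₀).source ↔
      θ.proj ∈ (chartAt (Vec n) θ₀.proj).source := by
  simp only [FiberBundle.chartedSpace_chartAt, mfld_simps]
  constructor
  · exact fun h => h.1.1
  · refine fun h => ⟨⟨h, Set.mem_univ _⟩, ?_⟩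
    rw [Trivialization.coe_fst' _ (by simpa using h)]
    exact h

/-- A change of coordinates of the tangent bundle does not change the vector that is represented. -/
theorem symmL_comp_tangentCoordChange {q₀ q₁ q : S} (h₀ : q ∈ (chartAt (Vec n) q₀).source)
    (h₁ : q ∈ (chartAt (Vec n) q₁).source) (v : Vec n) :
    (trivializationAt (Vec n) (TangentSpace (𝓡 n)) q₁).symmL ℝ q
        (tangentCoordChange (𝓡 n) q₀ q₁ q v) =
      (trivializationAt (Vec n) (TangentSpace (𝓡 n)) q₀).symmL ℝ q v := by
  rw [TangentBundle.symmL_trivializationAt_eq_core h₁,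
    TangentBundle.symmL_trivializationAt_eq_core h₀]
  exact tangentCoordChange_comp (I := 𝓡 n) (by simp [h₀, h₁])

/-- The change of canonical charts is the cotangent lift of the change of charts of the base. -/
theorem cotangent_chart_change {θ₀ θ₁ : Cotangent n S} {w : Vec n × Covec n}
    (hw : w ∈ (extChartAt (cotModel n) θ₁).target)
    (hw' : (extChartAt (cotModel n) θ₁).symm w ∈ (extChartAt (cotModel n) θ₀).source) :
    extChartAt (cotModel n) θ₀ ((extChartAt (cotModel n) θ₁).symm w) =
      ((extChartAt (𝓡 n) θ₀.proj ∘ (extChartAt (𝓡 n) θ₁.proj).symm) w.1,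
        w.2.comp (fderiv ℝ (extChartAt (𝓡 n) θ₁.proj ∘ (extChartAt (𝓡 n) θ₀.proj).symm)
          ((extChartAt (𝓡 n) θ₀.proj ∘ (extChartAt (𝓡 n) θ₁.proj).symm) w.1))) := by
  set θ := (extChartAt (cotModel n) θ₁).symm w with hθ
  have hs1 : θ ∈ (extChartAt (cotModel n) θ₁).source := (extChartAt (cotModel n) θ₁).map_target hw
  have e1 : extChartAt (cotModel n) θ₁ θ = w := (extChartAt (cotModel n) θ₁).right_inv hw
  rw [extChartAt_source] at hs1 hw'
  rw [mem_cotangent_chart_source] at hs1 hw'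
  rw [canonicalChart_apply] at e1
  have ew1 : w.1 = extChartAt (𝓡 n) θ₁.proj θ.proj := by rw [← e1]
  have eq : (extChartAt (𝓡 n) θ₁.proj).symm w.1 = θ.proj := by
    rw [ew1]; exact (extChartAt (𝓡 n) θ₁.proj).left_inv (by rwa [extChartAt_source])
  rw [canonicalChart_apply]
  simp only [Function.comp_apply, eq]
  refine Prod.ext rfl ?_
  ext v
  have : fderiv ℝ (extChartAt (𝓡 n) θ₁.proj ∘ (extChartAt (𝓡 n) θ₀.proj).symm)
      (extChartAt (𝓡 n) θ₀.proj θ.proj) = tangentCoordChange (𝓡 n) θ₀.proj θ₁.proj θ.proj := by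
    rw [tangentCoordChange_def]
    simp
  rw [this]
  have e2 : w.2 = (θ.2 : TangentSpace (𝓡 n) θ.proj →L[ℝ] ℝ).comp
      ((trivializationAt (Vec n) (TangentSpace (𝓡 n)) θ₁.proj).symmL ℝ θ.proj) := by rw [← e1]
  rw [e2]
  have := symmL_comp_tangentCoordChange hw' hs1 v
  exact congrArg (θ.2 : TangentSpace (𝓡 n) θ.proj →L[ℝ] ℝ) this.symm

/-- The derivative at `θ` of the canonical chart at `θ₀`. -/
def chartDeriv (θ₀ θ : Cotangent n S) : TangentSpace (cotModel n) θ →L[ℝ] Vec n × Covec n :=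
  mfderiv (cotModel n) 𝓘(ℝ, Vec n × Covec n) (extChartAt (cotModel n) θ₀) θ

theorem chartDeriv_eq_tangentCoordChange {θ₀ θ : Cotangent n S}
    (h : θ ∈ (chartAt (ModelProd (Vec n) (Covec n)) θ₀).source) :
    chartDeriv θ₀ θ = tangentCoordChange (cotModel n) θ θ₀ θ :=
  if_pos (mdifferentiableAt_extChartAt h)

/-- The canonical form is the standard form in every canonical chart. -/
theorem coordForm_chartDeriv {θ₀ θ : Cotangent n S}
    (h : θ ∈ (chartAt (ModelProd (Vec n) (Covec n)) θ₀).source)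
    (v w : TangentSpace (cotModel n) θ) :
    coordForm (chartDeriv θ₀ θ v) (chartDeriv θ₀ θ w) = canonicalForm θ v w := by
  rw [chartDeriv_eq_tangentCoordChange h]
  have h0 : θ ∈ (extChartAt (cotModel n) θ₀).source := by rwa [extChartAt_source]
  have h1 : θ ∈ (extChartAt (cotModel n) θ).source := mem_extChartAt_source θ
  have hd := hasFDerivWithinAt_tangentCoordChange (I := cotModel n) ⟨h1, h0⟩
  have hr : Set.range (cotModel n) = Set.univ := (cotModel n).range_eq_univ
  rw [hr, hasFDerivWithinAt_univ] at hd
  rw [mem_cotangent_chart_source] at h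
  have hz : (extChartAt (cotModel n) θ θ).1 = extChartAt (𝓡 n) θ.proj θ.proj := by
    rw [canonicalChart_apply]
  have hb0 : θ.proj ∈ (extChartAt (𝓡 n) θ₀.proj).source := by rwa [extChartAt_source]
  have hb1 : θ.proj ∈ (extChartAt (𝓡 n) θ.proj).source := mem_extChartAt_source _
  have hl : (extChartAt (𝓡 n) θ.proj).symm (extChartAt (𝓡 n) θ.proj θ.proj) = θ.proj :=
    (extChartAt (𝓡 n) θ.proj).left_inv hb1
  have key := coordForm_of_hasFDerivAt_cotangentLift
    (ψ := extChartAt (𝓡 n) θ₀.proj ∘ (extChartAt (𝓡 n) θ.proj).symm)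
    (χ := extChartAt (𝓡 n) θ.proj ∘ (extChartAt (𝓡 n) θ₀.proj).symm) ?_ ?_ ?_ ?_ hd v w
  · exact key.trans (coordForm_apply _ _)
  · rw [hz]
    have := hasFDerivWithinAt_tangentCoordChange (I := 𝓡 n) ⟨hb1, hb0⟩
    simp only [ModelWithCorners.range_eq_univ, hasFDerivWithinAt_univ] at this
    exact this.differentiableAt
  · rw [hz, Function.comp_apply, hl]
    have := contDiffWithinAt_ext_coord_change (I := 𝓡 n) (n := ∞) θ.proj θ₀.proj
      (y := extChartAt (𝓡 n) θ₀.proj θ.proj) (by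
        rw [PartialEquiv.trans_source'', PartialEquiv.symm_symm, PartialEquiv.symm_target]
        exact Set.mem_image_of_mem _ ⟨hb0, hb1⟩)
    simp only [ModelWithCorners.range_eq_univ, contDiffWithinAt_univ] at this
    exact this.of_le (by norm_cast)
  · rw [hz]
    have hc : ContinuousAt (extChartAt (𝓡 n) θ.proj).symm (extChartAt (𝓡 n) θ.proj θ.proj) :=
      continuousAt_extChartAt_symm θ.proj
    have hev : ∀ᶠ x in 𝓝 (extChartAt (𝓡 n) θ.proj θ.proj),
        (extChartAt (𝓡 n) θ.proj).symm x ∈ (extChartAt (𝓡 n) θ₀.proj).source :=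
      hc.preimage_mem_nhds (by rw [hl]; exact extChartAt_source_mem_nhds' hb0)
    filter_upwards [hev, extChartAt_target_mem_nhds (I := 𝓡 n) θ.proj] with x hx hx'
    simp only [Function.comp_apply]
    rw [(extChartAt (𝓡 n) θ₀.proj).left_inv hx, (extChartAt (𝓡 n) θ.proj).right_inv hx']
  · have hc : ContinuousAt (extChartAt (cotModel n) θ).symm (extChartAt (cotModel n) θ θ) :=
      continuousAt_extChartAt_symm θ
    have hev : ∀ᶠ x in 𝓝 (extChartAt (cotModel n) θ θ),
        (extChartAt (cotModel n) θ).symm x ∈ (extChartAt (cotModel n) θ₀).source :=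
      hc.preimage_mem_nhds (by
        rw [(extChartAt (cotModel n) θ).left_inv h1]; exact extChartAt_source_mem_nhds' h0)
    filter_upwards [hev, extChartAt_target_mem_nhds (I := cotModel n) θ] with x hx hx'
    exact cotangent_chart_change hx' hx

end

/-! ### Tangent vectors of the cotangent bundle in canonical charts -/

section
variable {n : ℕ} {S : Type*} [TopologicalSpace S] [ChartedSpace (Vec n) S]
  [IsManifold (𝓡 n) ∞ S]
  {F : Type*} [TopologicalSpace F] [ChartedSpace (Vec n) F]

theorem chartDeriv_bijective {θ₀ θ : Cotangent n S}
    (h : θ ∈ (chartAt (ModelProd (Vec n) (Covec n)) θ₀).source) :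
    Function.Bijective (chartDeriv θ₀ θ) :=
  (isInvertible_mfderiv_extChartAt (I := cotModel n) (by rwa [extChartAt_source])).bijective

/-- In every canonical chart, the vertical vectors are those whose base component vanishes. -/
theorem mem_verticalSpace_iff {θ₀ θ : Cotangent n S}
    (h : θ ∈ (chartAt (ModelProd (Vec n) (Covec n)) θ₀).source)
    (v : TangentSpace (cotModel n) θ) :
    v ∈ verticalSpace θ ↔ (chartDeriv θ₀ θ v).1 = 0 := by
  have hb : θ.proj ∈ (chartAt (Vec n) θ₀.proj).source := mem_cotangent_chart_source.1 h
  have e : (fun z : Vec n × Covec n => z.1) ∘ extChartAt (cotModel n) θ₀ =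
      extChartAt (𝓡 n) θ₀.proj ∘ (TotalSpace.proj : Cotangent n S → S) := by
    funext w
    simp only [Function.comp_apply, canonicalChart_apply]
  have hp : MDifferentiableAt (cotModel n) (𝓡 n) (TotalSpace.proj : Cotangent n S → S) θ :=
    (contMDiff_proj (fun x : S => CotangentSpace n x) (n := ∞) (IB := 𝓡 n)).mdifferentiableAt
      (by norm_num)
  have h1 : HasMFDerivAt (cotModel n) (𝓡 n)
      ((fun z : Vec n × Covec n => z.1) ∘ extChartAt (cotModel n) θ₀) θ
      ((ContinuousLinearMap.fst ℝ (Vec n) (Covec n)).comp (chartDeriv θ₀ θ)) :=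
    HasMFDerivAt.comp (I' := 𝓘(ℝ, Vec n × Covec n)) θ
      (hasFDerivAt_fst (𝕜 := ℝ)).hasMFDerivAt
      (mdifferentiableAt_extChartAt h).hasMFDerivAt
  have h2 : HasMFDerivAt (cotModel n) (𝓡 n)
      (extChartAt (𝓡 n) θ₀.proj ∘ (TotalSpace.proj : Cotangent n S → S)) θ
      ((mfderiv (𝓡 n) 𝓘(ℝ, Vec n) (extChartAt (𝓡 n) θ₀.proj) θ.proj).comp
        (mfderiv (cotModel n) (𝓡 n) (TotalSpace.proj : Cotangent n S → S) θ)) :=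
    HasMFDerivAt.comp θ (mdifferentiableAt_extChartAt hb).hasMFDerivAt hp.hasMFDerivAt
  rw [e] at h1
  -- `h1` and `h2` compute the derivative of the base coordinates of the canonical chart in two ways
  have h3 := DFunLike.congr_fun (hasMFDerivAt_unique h1 h2) v
  have hinj := (isInvertible_mfderiv_extChartAt (I := 𝓡 n) (x := θ₀.proj) (y := θ.proj)
    (by rwa [extChartAt_source])).injective
  have h4 : (chartDeriv θ₀ θ v).1 = mfderiv (𝓡 n) 𝓘(ℝ, Vec n) (extChartAt (𝓡 n) θ₀.proj) θ.proj
      (mfderiv (cotModel n) (𝓡 n) (TotalSpace.proj : Cotangent n S → S) θ v) := h3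
  rw [h4]
  constructor
  · intro hv
    have hv' : mfderiv (cotModel n) (𝓡 n) (TotalSpace.proj : Cotangent n S → S) θ v = 0 := hv
    rw [hv']
    exact map_zero _
  · intro hv
    have : mfderiv (cotModel n) (𝓡 n) (TotalSpace.proj : Cotangent n S → S) θ v = 0 :=
      hinj (hv.trans (map_zero _).symm)
    exact this

/-- A continuous vector field along a map is continuous in the canonical charts. -/
theorem continuousAt_chartDeriv {X : Type*} [TopologicalSpace X] {c : X → Cotangent n S}
    {v : ∀ x, TangentSpace (cotModel n) (c x)} {x : X} {θ₀ : Cotangent n S}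
    (hv : ContinuousAt (fun x => (⟨c x, v x⟩ : TangentBundle (cotModel n) (Cotangent n S))) x)
    (h : c x ∈ (chartAt (ModelProd (Vec n) (Covec n)) θ₀).source) :
    ContinuousAt (fun x => chartDeriv θ₀ (c x) (v x)) x := by
  let e := trivializationAt (Vec n × Covec n)
    (TangentSpace (cotModel n) : Cotangent n S → Type _) θ₀
  have hbase : ∀ θ : Cotangent n S, θ ∈ (chartAt (ModelProd (Vec n) (Covec n)) θ₀).source →
      θ ∈ e.baseSet := fun θ hθ => hθ
  have h1 : ContinuousAt (fun x => e ⟨c x, v x⟩) x := by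
    refine ContinuousAt.comp (f := fun x =>
      (⟨c x, v x⟩ : TangentBundle (cotModel n) (Cotangent n S))) ?_ hv
    exact e.toOpenPartialHomeomorph.continuousAt (e.mem_source.2 (hbase _ h))
  have hc : ContinuousAt c x :=
    ContinuousAt.comp (f := fun x =>
      (⟨c x, v x⟩ : TangentBundle (cotModel n) (Cotangent n S)))
      (FiberBundle.continuous_proj (Vec n × Covec n) (TangentSpace (cotModel n))).continuousAt hv
  refine (continuous_snd.continuousAt.comp h1).congr ?_
  have hev : ∀ᶠ y in 𝓝 x, c y ∈ (chartAt (ModelProd (Vec n) (Covec n)) θ₀).source :=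
    hc.preimage_mem_nhds ((chartAt _ θ₀).open_source.mem_nhds h)
  filter_upwards [hev] with y hy
  have := TangentBundle.continuousLinearMapAt_trivializationAt (𝕜 := ℝ) (I := cotModel n) hy
  have h5 := DFunLike.congr_fun this (v y)
  refine Eq.trans ?_ h5
  rw [Trivialization.continuousLinearMapAt_apply, Trivialization.linearMapAt_apply]
  simp only [Function.comp_apply]
  rw [if_pos (hbase _ hy)]

/-- An immersion has a smooth local left inverse. -/
theorem exists_local_left_inverse {ι : F → Cotangent n S} {p : F}
    (h : IsImmersionAt (𝓡 n) (cotModel n) ∞ ι p) :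
    ∃ r : Cotangent n S → F, ContMDiffAt (cotModel n) (𝓡 n) ∞ r (ι p) ∧
      ∀ᶠ q in 𝓝 p, r (ι q) = q := by
  let dc := h.domChart
  let cc := h.codChart
  refine ⟨fun θ => (dc.extend (𝓡 n)).symm (h.equiv.symm (cc.extend (cotModel n) θ)).1, ?_, ?_⟩
  · have h1 : ContMDiffAt (cotModel n) 𝓘(ℝ, Vec n × Covec n) ∞ (cc.extend (cotModel n)) (ι p) :=
      (cotModel n).contMDiff.contMDiffAt.comp (ι p)
        (contMDiffAt_of_mem_maximalAtlas h.codChart_mem_maximalAtlas h.mem_codChart_source)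
    have h2 : ContMDiffAt (𝓘(ℝ, Vec n × Covec n)) 𝓘(ℝ, Vec n) ∞
        (fun z => (h.equiv.symm z).1) (cc.extend (cotModel n) (ι p)) := by
      apply ContDiffAt.contMDiffAt
      exact (ContinuousLinearMap.fst ℝ (Vec n) h.complement).contDiff.contDiffAt.comp _
        h.equiv.symm.contDiff.contDiffAt
    have hps : p ∈ (dc.extend (𝓡 n)).source := by
      rw [OpenPartialHomeomorph.extend_source]; exact h.mem_domChart_source
    have hpt : dc.extend (𝓡 n) p ∈ (dc.extend (𝓡 n)).target :=
      (dc.extend (𝓡 n)).map_source hps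
    have hval : (h.equiv.symm (cc.extend (cotModel n) (ι p))).1 = dc.extend (𝓡 n) p := by
      have := h.writtenInCharts hpt
      simp only [Function.comp_apply] at this
      rw [(dc.extend (𝓡 n)).left_inv hps] at this
      rw [this]; simp [dc]
    have h3 : ContMDiffAt 𝓘(ℝ, Vec n) (𝓡 n) ∞ (dc.extend (𝓡 n)).symm
        ((h.equiv.symm (cc.extend (cotModel n) (ι p))).1) := by
      rw [hval]
      refine (contMDiffOn_extend_symm h.domChart_mem_maximalAtlas).contMDiffAt ?_
      rw [← OpenPartialHomeomorph.extend_target']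
      exact dc.isOpen_extend_target.mem_nhds hpt
    exact h3.comp (ι p) (h2.comp (ι p) h1)
  · filter_upwards [dc.open_source.mem_nhds h.mem_domChart_source] with q hq
    have hps : q ∈ (dc.extend (𝓡 n)).source := by
      rw [OpenPartialHomeomorph.extend_source]; exact hq
    have := h.writtenInCharts ((dc.extend (𝓡 n)).map_source hps)
    simp only [Function.comp_apply] at this
    rw [(dc.extend (𝓡 n)).left_inv hps] at this
    change (dc.extend (𝓡 n)).symm (h.equiv.symm (h.codChart.extend (cotModel n) (ι q))).1 = q
    rw [this]
    simp only [ContinuousLinearEquiv.symm_apply_apply]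
    exact (dc.extend (𝓡 n)).left_inv hps

end

/-! ### The second derivative of a lagrangian immersion into a level set -/

section
variable {n : ℕ} {S : Type*} [TopologicalSpace S] [ChartedSpace (Vec n) S]
  [IsManifold (𝓡 n) ∞ S]
  {F : Type*} [TopologicalSpace F] [ChartedSpace (Vec n) F]

theorem isBoundedBilinearMap_coordForm :
    IsBoundedBilinearMap ℝ fun p : (Vec n × Covec n) × (Vec n × Covec n) => coordForm p.1 p.2 where
  add_left x y z := by simp only [coordForm_apply]; simp; ring
  smul_left c x y := by simp only [coordForm_apply]; simp; ring
  add_right x y z := map_add _ _ _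
  smul_right c x y := map_smul _ _ _
  bound := by
    refine ⟨2, by norm_num, fun z w => ?_⟩
    rw [coordForm_apply]
    have h1 := z.2.le_opNorm w.1
    have h2 := w.2.le_opNorm z.1
    have h3 : ‖z.2‖ * ‖w.1‖ ≤ ‖z‖ * ‖w‖ :=
      mul_le_mul (norm_snd_le z) (norm_fst_le w) (norm_nonneg _) (norm_nonneg _)
    have h4 : ‖w.2‖ * ‖z.1‖ ≤ ‖w‖ * ‖z‖ :=
      mul_le_mul (norm_snd_le w) (norm_fst_le z) (norm_nonneg _) (norm_nonneg _)
    calc _ ≤ ‖z.2 w.1‖ + ‖w.2 z.1‖ := norm_sub_le _ _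
      _ ≤ 2 * ‖z‖ * ‖w‖ := by linarith

/-- Along a lagrangian immersion `f` on which `h` is constant, differentiating `h ∘ f` twice and
the isotropy condition once expresses the rate `D²f(Y, ·)` at which the tangent plane turns in the
direction `Y` of the hamiltonian field through the Hessian of `h`. -/
theorem secondDeriv_pairing {A E : Type*} [NormedAddCommGroup A] [NormedSpace ℝ A]
    [NormedAddCommGroup E] [NormedSpace ℝ E] {B : E → E → ℝ}
    (hB : IsBoundedBilinearMap ℝ fun p : E × E => B p.1 p.2) (hB' : ∀ z w, B z w = -B w z)
    {f : A → E} {h : E → ℝ} {u : A} {c : ℝ} (hf : ContDiffAt ℝ 2 f u)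
    (hh : ContDiffAt ℝ 2 h (f u)) (hc : ∀ᶠ x in 𝓝 u, h (f x) = c)
    (hiso : ∀ᶠ x in 𝓝 u, ∀ a b, B (fderiv ℝ f x a) (fderiv ℝ f x b) = 0)
    {Y : A} (hY : ∀ w, B (fderiv ℝ f u Y) w = -fderiv ℝ h (f u) w) (e : A) :
    B (fderiv ℝ f u e) (fderiv ℝ (fderiv ℝ f) u Y e) =
      fderiv ℝ (fderiv ℝ h) (f u) (fderiv ℝ f u e) (fderiv ℝ f u e) := by
  have hdf : HasFDerivAt (fderiv ℝ f) (fderiv ℝ (fderiv ℝ f) u) u :=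
    ((hf.fderiv_right (m := 1) (by norm_num)).differentiableAt (by norm_num)).hasFDerivAt
  have hdh : HasFDerivAt (fderiv ℝ h) (fderiv ℝ (fderiv ℝ h) (f u)) (f u) :=
    ((hh.fderiv_right (m := 1) (by norm_num)).differentiableAt (by norm_num)).hasFDerivAt
  have hf1 : HasFDerivAt f (fderiv ℝ f u) u := (hf.differentiableAt (by norm_num)).hasFDerivAt
  have hsymm : fderiv ℝ (fderiv ℝ f) u Y e = fderiv ℝ (fderiv ℝ f) u e Y :=
    (hf.isSymmSndFDerivAt (by simp)).eq Y e
  have happ : ∀ a : A, HasFDerivAt (fun x => fderiv ℝ f x a)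
      ((fderiv ℝ (fderiv ℝ f) u).flip a) u := fun a => by
    simpa using hdf.clm_apply (hasFDerivAt_const a u)
  -- the derivative of the isotropy condition
  have h1 : B (fderiv ℝ (fderiv ℝ f) u e Y) (fderiv ℝ f u e) +
      B (fderiv ℝ f u Y) (fderiv ℝ (fderiv ℝ f) u e e) = 0 := by
    have h := (hB.hasFDerivAt (fderiv ℝ f u Y, fderiv ℝ f u e)).comp u ((happ Y).prodMk (happ e))
    have h' := h.unique ((hasFDerivAt_const (0 : ℝ) u).congr_of_eventuallyEq
      (hiso.mono fun x hx => hx Y e))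
    have h5 := DFunLike.congr_fun h' e
    simp [IsBoundedBilinearMap.deriv] at h5
    linarith
  -- the second derivative of the energy condition
  have h2 : fderiv ℝ (fderiv ℝ h) (f u) (fderiv ℝ f u e) (fderiv ℝ f u e) +
      fderiv ℝ h (f u) (fderiv ℝ (fderiv ℝ f) u e e) = 0 := by
    have hz : ∀ᶠ x in 𝓝 u, fderiv ℝ h (f x) (fderiv ℝ f x e) = 0 := by
      have hfe : ∀ᶠ x in 𝓝 u, DifferentiableAt ℝ f x :=
        (hf.eventually (by simp)).mono fun x hx => hx.differentiableAt (by norm_num)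
      have hhe : ∀ᶠ x in 𝓝 u, DifferentiableAt ℝ h (f x) :=
        hf.continuousAt.eventually ((hh.eventually (by simp)).mono
          fun x hx => hx.differentiableAt (by norm_num))
      filter_upwards [hfe, hhe, hc.eventually_nhds] with x h1 h2 h3
      have h4 : HasFDerivAt (h ∘ f) ((fderiv ℝ h (f x)).comp (fderiv ℝ f x)) x :=
        h2.hasFDerivAt.comp x h1.hasFDerivAt
      have h5 : HasFDerivAt (h ∘ f) (0 : A →L[ℝ] ℝ) x :=
        (hasFDerivAt_const c x).congr_of_eventuallyEq h3
      exact DFunLike.congr_fun (h4.unique h5) e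
    have h3 : HasFDerivAt (fun x => fderiv ℝ h (f x) (fderiv ℝ f x e)) _ u :=
      (hdh.comp u hf1).clm_apply (happ e)
    have h4 := h3.unique ((hasFDerivAt_const (0 : ℝ) u).congr_of_eventuallyEq hz)
    have h5 := DFunLike.congr_fun h4 e
    simp at h5
    linarith
  rw [hsymm, hB']
  have := hY (fderiv ℝ (fderiv ℝ f) u e e)
  linarith

/-- The symplectic gradient, with respect to `coordForm`, that belongs to a differential. -/
def coordGrad (l : Vec n × Covec n →L[ℝ] ℝ) : Vec n × Covec n :=
  (∑ i : Fin n, l (0, EuclideanSpace.proj i) • EuclideanSpace.single i (1 : ℝ),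
    -∑ i : Fin n, l (EuclideanSpace.single i (1 : ℝ), 0) •
      (EuclideanSpace.proj i : Vec n →L[ℝ] ℝ))

theorem coordForm_coordGrad (l : Vec n × Covec n →L[ℝ] ℝ) (w : Vec n × Covec n) :
    coordForm (coordGrad l) w = -l w := by
  obtain ⟨a, b⟩ := w
  have ha : a = ∑ i : Fin n, a i • EuclideanSpace.single i (1 : ℝ) := by
    ext j; simp [Finset.sum_apply, Pi.single_apply]
  have hb : b = ∑ i : Fin n, b (EuclideanSpace.single i (1 : ℝ)) •
      (EuclideanSpace.proj i : Vec n →L[ℝ] ℝ) := by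
    ext x
    have hx : x = ∑ i : Fin n, x i • EuclideanSpace.single i (1 : ℝ) := by
      ext j; simp [Finset.sum_apply, Pi.single_apply]
    conv_lhs => rw [hx]
    simp [mul_comm]
  have h1 : l (a, b) = l (a, 0) + l (0, b) := by rw [← map_add]; simp
  have h2 : l (a, 0) = ∑ i : Fin n, a i * l (EuclideanSpace.single i (1 : ℝ), 0) := by
    have := map_sum (l.comp (ContinuousLinearMap.inl ℝ (Vec n) (Covec n)))
      (fun i : Fin n => a i • EuclideanSpace.single i (1 : ℝ)) Finset.univ
    rw [← ha] at this
    simpa using this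
  have h3 : l (0, b) = ∑ i : Fin n, b (EuclideanSpace.single i (1 : ℝ)) *
      l (0, EuclideanSpace.proj i) := by
    have := map_sum (l.comp (ContinuousLinearMap.inr ℝ (Vec n) (Covec n)))
      (fun i : Fin n => b (EuclideanSpace.single i (1 : ℝ)) •
        (EuclideanSpace.proj i : Vec n →L[ℝ] ℝ)) Finset.univ
    rw [← hb] at this
    simpa using this
  rw [h1, h2, h3, coordForm_apply]
  simp [coordGrad, mul_comm]
  ring

theorem eq_of_coordForm_eq {z w : Vec n × Covec n} (h : ∀ v, coordForm z v = coordForm w v) :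
    z = w := by
  have h2 : z.2 = w.2 := by
    ext v
    simpa [coordForm_apply] using h (v, 0)
  have h1 : z.1 = w.1 := by
    ext i
    simpa [coordForm_apply] using h (0, EuclideanSpace.proj i)
  exact Prod.ext h1 h2

theorem finrank_covec (n : ℕ) : Module.finrank ℝ (Covec n) = n := by
  rw [← (InnerProductSpace.toDual ℝ (Vec n)).toLinearEquiv.finrank_eq]
  simp

/-- A half-dimensional isotropic subspace is its own symplectic complement. -/
theorem mem_range_of_coordForm_eq_zero {D : Vec n →L[ℝ] Vec n × Covec n}
    (hD : Function.Injective D) (hiso : ∀ a b, coordForm (D a) (D b) = 0) {z : Vec n × Covec n}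
    (hz : ∀ a, coordForm z (D a) = 0) : ∃ a, D a = z := by
  let B : LinearMap.BilinForm ℝ (Vec n × Covec n) :=
    LinearMap.mk₂ ℝ (fun z w => coordForm z w)
      (fun a b c => by simp [coordForm_apply]; ring) (fun a b c => by simp [coordForm_apply]; ring)
      (fun a b c => by simp) (fun a b c => by simp)
  have hrefl : B.IsRefl := fun a b hab => by
    change coordForm b a = 0
    have : coordForm a b = 0 := hab
    rw [coordForm_swap, this, neg_zero]
  have hB : B.Nondegenerate := by
    refine (LinearMap.IsRefl.nondegenerate_iff_separatingLeft hrefl).2 fun x hx => ?_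
    refine eq_of_coordForm_eq fun v => ?_
    have : coordForm x v = 0 := hx v
    rw [this]; simp [coordForm_apply]
  let W := LinearMap.range D.toLinearMap
  have hfin : Module.finrank ℝ W = n := by
    rw [LinearMap.finrank_range_of_inj hD]; simp
  have hdim : Module.finrank ℝ (Vec n × Covec n) = n + n := by
    rw [Module.finrank_prod, finrank_covec]; simp
  have ho := LinearMap.BilinForm.finrank_orthogonal hB W
  rw [hfin, hdim] at ho
  have hle : W ≤ B.orthogonal W := by
    rintro _ ⟨a, rfl⟩ _ ⟨b, rfl⟩
    exact hiso b a
  have heq := Submodule.eq_of_le_of_finrank_eq hle (by omega)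
  have hzm : z ∈ B.orthogonal W := by
    rintro _ ⟨a, rfl⟩
    exact hrefl _ _ (hz a)
  rw [← heq] at hzm
  exact hzm

end

/-! ### The hamiltonian in canonical charts -/

section
variable {n : ℕ} {S : Type*} [TopologicalSpace S] [ChartedSpace (Vec n) S]
  [IsManifold (𝓡 n) ∞ S]
  {F : Type*} [TopologicalSpace F] [ChartedSpace (Vec n) F]

/-- The map `ι`, written in the chart of `F` at `p` and the canonical chart of `T^*S` at `ι p`. -/
def chartMap (ι : F → Cotangent n S) (p : F) : Vec n → Vec n × Covec n :=
  extChartAt (cotModel n) (ι p) ∘ ι ∘ (extChartAt (𝓡 n) p).symm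

/-- The function `H`, written in the canonical chart of `T^*S` at `θ₀`. -/
def chartFun (H : Cotangent n S → ℝ) (θ₀ : Cotangent n S) : Vec n × Covec n → ℝ :=
  H ∘ (extChartAt (cotModel n) θ₀).symm

theorem iteratedDeriv_two_line {E : Type*} [NormedAddCommGroup E] [NormedSpace ℝ E] {h : E → ℝ}
    {z : E} (hh : ContDiffAt ℝ 2 h z) (k : E) :
    iteratedDeriv 2 (fun t : ℝ => h (z + t • k)) 0 = fderiv ℝ (fderiv ℝ h) z k k := by
  rw [iteratedDeriv_succ, iteratedDeriv_one]
  have hl : ∀ t : ℝ, HasDerivAt (fun t : ℝ => z + t • k) k t := fun t => by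
    simpa using ((hasDerivAt_id t).smul_const k).const_add z
  have hz0 : z + (0 : ℝ) • k = z := by simp
  have hlt : Filter.Tendsto (fun t : ℝ => z + t • k) (𝓝 0) (𝓝 z) := by
    have := (hl 0).continuousAt.tendsto
    rwa [hz0] at this
  have h1 : deriv (fun t : ℝ => h (z + t • k)) =ᶠ[𝓝 0] fun t => fderiv ℝ h (z + t • k) k := by
    filter_upwards [hlt.eventually (hh.eventually (by simp))] with t ht
    exact ((ht.differentiableAt (by norm_num)).hasFDerivAt.comp_hasDerivAt t (hl t)).deriv
  rw [h1.deriv_eq]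
  have hd : HasFDerivAt (fderiv ℝ h) (fderiv ℝ (fderiv ℝ h) z) z :=
    ((hh.fderiv_right (m := 1) (by norm_num)).differentiableAt (by norm_num)).hasFDerivAt
  have hk : HasFDerivAt (fun w => fderiv ℝ h w k) ((fderiv ℝ (fderiv ℝ h) z).flip k) z := by
    simpa using hd.clm_apply (hasFDerivAt_const k z)
  have hk' : HasFDerivAt (fun w => fderiv ℝ h w k) ((fderiv ℝ (fderiv ℝ h) z).flip k)
      (z + (0 : ℝ) • k) := by rwa [hz0]
  have h3 := (HasFDerivAt.comp_hasDerivAt (0 : ℝ) hk' (hl 0)).deriv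
  exact h3

theorem contDiffAt_chartFun {H : Cotangent n S → ℝ}
    (hH : ContMDiff (cotModel n) 𝓘(ℝ, ℝ) ∞ H) {θ₀ θ : Cotangent n S}
    (h : θ ∈ (chartAt (ModelProd (Vec n) (Covec n)) θ₀).source) :
    ContDiffAt ℝ ∞ (chartFun H θ₀) (extChartAt (cotModel n) θ₀ θ) := by
  rw [← contMDiffAt_iff_contDiffAt]
  refine hH.contMDiffAt.comp _ ?_
  have hs : θ ∈ (extChartAt (cotModel n) θ₀).source := by rwa [extChartAt_source]
  exact (contMDiffOn_extChartAt_symm θ₀).contMDiffAt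
    ((isOpen_extChartAt_target θ₀).mem_nhds ((extChartAt (cotModel n) θ₀).map_source hs))

theorem fderiv_chartFun {H : Cotangent n S → ℝ}
    (hH : ContMDiff (cotModel n) 𝓘(ℝ, ℝ) ∞ H) {θ₀ θ : Cotangent n S}
    (h : θ ∈ (chartAt (ModelProd (Vec n) (Covec n)) θ₀).source)
    (v : TangentSpace (cotModel n) θ) :
    fderiv ℝ (chartFun H θ₀) (extChartAt (cotModel n) θ₀ θ) (chartDeriv θ₀ θ v) =
      mfderiv (cotModel n) 𝓘(ℝ, ℝ) H θ v := by
  have hs : θ ∈ (extChartAt (cotModel n) θ₀).source := by rwa [extChartAt_source]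
  have h1 : HasMFDerivAt (cotModel n) 𝓘(ℝ, ℝ) (chartFun H θ₀ ∘ extChartAt (cotModel n) θ₀) θ
      ((fderiv ℝ (chartFun H θ₀) (extChartAt (cotModel n) θ₀ θ)).comp (chartDeriv θ₀ θ)) :=
    HasMFDerivAt.comp (I' := 𝓘(ℝ, Vec n × Covec n)) θ
      ((contDiffAt_chartFun hH h).differentiableAt (by norm_num)).hasFDerivAt.hasMFDerivAt
      (mdifferentiableAt_extChartAt h).hasMFDerivAt
  have h2 : HasMFDerivAt (cotModel n) 𝓘(ℝ, ℝ) (chartFun H θ₀ ∘ extChartAt (cotModel n) θ₀) θ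
      (mfderiv (cotModel n) 𝓘(ℝ, ℝ) H θ) := by
    refine (hH.mdifferentiableAt (by norm_num)).hasMFDerivAt.congr_of_eventuallyEq ?_
    filter_upwards [extChartAt_source_mem_nhds' (I := cotModel n) hs] with w hw
    simp only [chartFun, Function.comp_apply]
    rw [(extChartAt (cotModel n) θ₀).left_inv hw]
  exact DFunLike.congr_fun (hasMFDerivAt_unique h1 h2) v

/-- In every canonical chart the hamiltonian vector field is the symplectic gradient. -/
theorem chartDeriv_hamVectorField {H : Cotangent n S → ℝ}
    (hH : ContMDiff (cotModel n) 𝓘(ℝ, ℝ) ∞ H) {θ₀ θ : Cotangent n S}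
    (h : θ ∈ (chartAt (ModelProd (Vec n) (Covec n)) θ₀).source) :
    chartDeriv θ₀ θ (hamVectorField H θ) =
      coordGrad (fderiv ℝ (chartFun H θ₀) (extChartAt (cotModel n) θ₀ θ)) := by
  refine eq_of_coordForm_eq fun w => ?_
  obtain ⟨v, rfl⟩ := (chartDeriv_bijective h).2 w
  rw [coordForm_chartDeriv h, canonicalForm_hamVectorField, coordForm_coordGrad,
    fderiv_chartFun hH h]
  rfl

/-- The hamiltonian vector field has coefficients of class `C¹`, which is what uniqueness of its
integral curves asks for. -/
theorem contDiffAt_coordGrad_chartFun {H : Cotangent n S → ℝ}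
    (hH : ContMDiff (cotModel n) 𝓘(ℝ, ℝ) ∞ H) {θ₀ θ : Cotangent n S}
    (h : θ ∈ (chartAt (ModelProd (Vec n) (Covec n)) θ₀).source) :
    ContDiffAt ℝ 1 (fun z => coordGrad (fderiv ℝ (chartFun H θ₀) z))
      (extChartAt (cotModel n) θ₀ θ) := by
  have hd : ContDiffAt ℝ 1 (fderiv ℝ (chartFun H θ₀)) (extChartAt (cotModel n) θ₀ θ) :=
    (contDiffAt_chartFun hH h).fderiv_right (by norm_cast)
  have hl : ∀ v, ContDiffAt ℝ 1 (fun z => fderiv ℝ (chartFun H θ₀) z v)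
    (extChartAt (cotModel n) θ₀ θ) := fun v => hd.clm_apply contDiffAt_const
  unfold coordGrad
  refine ContDiffAt.prodMk ?_ ?_
  · exact ContDiffAt.sum fun i _ => (hl _).smul contDiffAt_const
  · exact (ContDiffAt.sum fun i _ => (hl _).smul contDiffAt_const).neg

theorem contMDiff_hamVectorField {H : Cotangent n S → ℝ}
    (hH : ContMDiff (cotModel n) 𝓘(ℝ, ℝ) ∞ H) :
    ContMDiff (cotModel n) (cotModel n).tangent 1 (fun θ : Cotangent n S =>
      (⟨θ, hamVectorField H θ⟩ : TangentBundle (cotModel n) (Cotangent n S))) := by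
  intro θ₀
  rw [contMDiffAt_section]
  have h0 : θ₀ ∈ (chartAt (ModelProd (Vec n) (Covec n)) θ₀).source := mem_chart_source _ _
  have hsm : ContMDiffAt (cotModel n) 𝓘(ℝ, Vec n × Covec n) 1
      (fun θ => coordGrad (fderiv ℝ (chartFun H θ₀) (extChartAt (cotModel n) θ₀ θ))) θ₀ := by
    have h1 := contDiffAt_coordGrad_chartFun hH h0
    exact h1.contMDiffAt.comp θ₀ contMDiffAt_extChartAt
  refine hsm.congr_of_eventuallyEq ?_
  filter_upwards [(chartAt _ θ₀).open_source.mem_nhds h0] with θ hθ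
  rw [← chartDeriv_hamVectorField hH hθ]
  have h5 := DFunLike.congr_fun
    (TangentBundle.continuousLinearMapAt_trivializationAt (𝕜 := ℝ) (I := cotModel n) hθ)
    (hamVectorField H θ)
  refine Eq.trans ?_ h5
  have hb : θ ∈ (trivializationAt (Vec n × Covec n)
    (TangentSpace (cotModel n) : Cotangent n S → Type _) θ₀).baseSet := hθ
  rw [Trivialization.continuousLinearMapAt_apply, Trivialization.linearMapAt_apply, if_pos hb]

/-- In the canonical chart at `θ`, the second derivative of a convex hamiltonian is positive on
vertical vectors. -/
theorem IsConvexHamiltonian.fderiv_fderiv_pos {H : Cotangent n S → ℝ}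
    (hH : IsConvexHamiltonian H) (θ : Cotangent n S) {k : Vec n × Covec n} (hk : k ≠ 0)
    (hk1 : k.1 = 0) :
    0 < fderiv ℝ (fderiv ℝ (chartFun H θ)) (extChartAt (cotModel n) θ θ) k k := by
  obtain ⟨k1, η⟩ := k
  obtain rfl : k1 = 0 := hk1
  have hη : η ≠ 0 := fun h => hk (by rw [h]; rfl)
  let η' : CotangentSpace n θ.proj := η
  have hpos := hH.hessian_pos θ.proj θ.2 η' hη
  have h0 : θ ∈ (chartAt (ModelProd (Vec n) (Covec n)) θ).source := mem_chart_source _ _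
  -- in the canonical chart, the fibre over `θ.proj` is an affine subspace
  have hpath : ∀ t : ℝ, H ⟨θ.proj, θ.2 + t • η'⟩ =
      chartFun H θ (extChartAt (cotModel n) θ θ + t • ((0 : Vec n), η)) := by
    intro t
    have hs : (⟨θ.proj, θ.2 + t • η'⟩ : Cotangent n S) ∈ (extChartAt (cotModel n) θ).source := by
      rw [extChartAt_source, mem_cotangent_chart_source]
      exact mem_chart_source _ θ.proj
    have hval : extChartAt (cotModel n) θ (⟨θ.proj, θ.2 + t • η'⟩ : Cotangent n S) =
        extChartAt (cotModel n) θ θ + t • ((0 : Vec n), η) := by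
      have hsymm : ∀ v : Vec n, (trivializationAt (Vec n) (TangentSpace (𝓡 n)) θ.proj).symmL ℝ
          θ.proj v = v := by
        intro v
        rw [TangentBundle.symmL_trivializationAt_eq_core (mem_chart_source _ _)]
        exact tangentCoordChange_self (I := 𝓡 n) (mem_extChartAt_source _)
      rw [canonicalChart_apply, canonicalChart_apply]
      refine Prod.ext ?_ ?_
      · simp
      · ext v
        simp
        exact Or.inl (congrArg η (hsymm v))
    rw [← hval]
    simp only [chartFun, Function.comp_apply]
    rw [(extChartAt (cotModel n) θ).left_inv hs]
  have hfun : (fun t : ℝ => H ⟨θ.proj, θ.2 + t • η'⟩) = fun t : ℝ =>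
      chartFun H θ (extChartAt (cotModel n) θ θ + t • ((0 : Vec n), η)) := funext hpath
  rw [hfun] at hpos
  have hh : ContDiffAt ℝ 2 (chartFun H θ) (extChartAt (cotModel n) θ θ) :=
    (contDiffAt_chartFun hH.contMDiff h0).of_le (by norm_cast)
  rwa [iteratedDeriv_two_line hh] at hpos

end

/-! ### The lagrangian submanifold in charts -/

section
variable {n : ℕ} {S : Type*} [TopologicalSpace S] [ChartedSpace (Vec n) S]
  [IsManifold (𝓡 n) ∞ S]
  {F : Type*} [TopologicalSpace F] [ChartedSpace (Vec n) F]

theorem chartMap_self (ι : F → Cotangent n S) (p : F) :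
    chartMap ι p (extChartAt (𝓡 n) p p) = extChartAt (cotModel n) (ι p) (ι p) := by
  simp [chartMap]

theorem chartMap_extChartAt (ι : F → Cotangent n S) {p q : F}
    (hq : q ∈ (chartAt (Vec n) p).source) :
    chartMap ι p (extChartAt (𝓡 n) p q) = extChartAt (cotModel n) (ι p) (ι q) := by
  have hs : q ∈ (extChartAt (𝓡 n) p).source := by rwa [extChartAt_source]
  simp only [chartMap, Function.comp_apply]
  rw [(extChartAt (𝓡 n) p).left_inv hs]

theorem eventually_mem_charts {ι : F → Cotangent n S} (hι : Continuous ι) (p : F) :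
    ∀ᶠ q in 𝓝 p, q ∈ (chartAt (Vec n) p).source ∧
      ι q ∈ (chartAt (ModelProd (Vec n) (Covec n)) (ι p)).source :=
  Filter.Eventually.and ((chartAt (Vec n) p).open_source.mem_nhds (mem_chart_source _ p))
    (hι.continuousAt.preimage_mem_nhds
      ((chartAt _ (ι p)).open_source.mem_nhds (mem_chart_source _ _)))

/-- What holds for all points near `p` holds for all coordinates near those of `p`. -/
theorem eventually_chart_of_eventually {p : F} {P : Vec n → Prop}
    (h : ∀ᶠ q in 𝓝 p, P (extChartAt (𝓡 n) p q)) :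
    ∀ᶠ u in 𝓝 (extChartAt (𝓡 n) p p), P u := by
  have hc : Filter.Tendsto (extChartAt (𝓡 n) p).symm (𝓝 (extChartAt (𝓡 n) p p)) (𝓝 p) := by
    have := (continuousAt_extChartAt_symm (I := 𝓡 n) p).tendsto
    rwa [extChartAt_to_inv] at this
  filter_upwards [hc.eventually h, extChartAt_target_mem_nhds (I := 𝓡 n) p] with u hu hu'
  rwa [(extChartAt (𝓡 n) p).right_inv hu'] at hu

/-- In charts, an embedding has a smooth local left inverse. -/
theorem exists_chartMap_left_inverse {ι : F → Cotangent n S}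
    (hι : IsSmoothEmbedding (𝓡 n) (cotModel n) ∞ ι) (p : F) :
    ∃ ρ : Vec n × Covec n → Vec n,
      ContDiffAt ℝ ∞ ρ (chartMap ι p (extChartAt (𝓡 n) p p)) ∧
      ∀ᶠ u in 𝓝 (extChartAt (𝓡 n) p p), ρ (chartMap ι p u) = u := by
  obtain ⟨r, hr, hrι⟩ := exists_local_left_inverse (hι.isImmersion.isImmersionAt p)
  have hrp : r (ι p) = p := hrι.self_of_nhds
  refine ⟨extChartAt (𝓡 n) p ∘ r ∘ (extChartAt (cotModel n) (ι p)).symm, ?_, ?_⟩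
  · rw [← contMDiffAt_iff_contDiffAt, chartMap_self]
    have h1 : ContMDiffAt 𝓘(ℝ, Vec n × Covec n) (cotModel n) ∞
        (extChartAt (cotModel n) (ι p)).symm (extChartAt (cotModel n) (ι p) (ι p)) :=
      (contMDiffOn_extChartAt_symm (ι p)).contMDiffAt (extChartAt_target_mem_nhds (ι p))
    have hl : (extChartAt (cotModel n) (ι p)).symm (extChartAt (cotModel n) (ι p) (ι p)) = ι p :=
      extChartAt_to_inv (ι p)
    have h2 : ContMDiffAt 𝓘(ℝ, Vec n × Covec n) (𝓡 n) ∞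
        (r ∘ (extChartAt (cotModel n) (ι p)).symm) (extChartAt (cotModel n) (ι p) (ι p)) :=
      ContMDiffAt.comp _ (by rwa [hl]) h1
    refine ContMDiffAt.comp _ ?_ h2
    simp only [Function.comp_apply, hl, hrp]
    exact contMDiffAt_extChartAt
  · refine eventually_chart_of_eventually ?_
    filter_upwards [eventually_mem_charts hι.contMDiff.continuous p, hrι] with q hq hrq
    rw [chartMap_extChartAt ι hq.1]
    have hs : ι q ∈ (extChartAt (cotModel n) (ι p)).source := by
      rw [extChartAt_source]; exact hq.2
    simp only [Function.comp_apply]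
    rw [(extChartAt (cotModel n) (ι p)).left_inv hs, hrq]

variable [IsManifold (𝓡 n) ∞ F]

theorem contDiffAt_chartMap {ι : F → Cotangent n S} (hι : ContMDiff (𝓡 n) (cotModel n) ∞ ι)
    {p q : F} (hq : q ∈ (chartAt (Vec n) p).source)
    (hq' : ι q ∈ (chartAt (ModelProd (Vec n) (Covec n)) (ι p)).source) :
    ContDiffAt ℝ ∞ (chartMap ι p) (extChartAt (𝓡 n) p q) := by
  rw [← contMDiffAt_iff_contDiffAt]
  have hs : q ∈ (extChartAt (𝓡 n) p).source := by rwa [extChartAt_source]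
  have hl : (extChartAt (𝓡 n) p).symm (extChartAt (𝓡 n) p q) = q :=
    (extChartAt (𝓡 n) p).left_inv hs
  have h1 : ContMDiffAt 𝓘(ℝ, Vec n) (𝓡 n) ∞ (extChartAt (𝓡 n) p).symm (extChartAt (𝓡 n) p q) :=
    (contMDiffOn_extChartAt_symm p).contMDiffAt
      ((isOpen_extChartAt_target p).mem_nhds ((extChartAt (𝓡 n) p).map_source hs))
  have h2 : ContMDiffAt 𝓘(ℝ, Vec n) (cotModel n) ∞ (ι ∘ (extChartAt (𝓡 n) p).symm)
      (extChartAt (𝓡 n) p q) := hι.contMDiffAt.comp _ h1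
  refine ContMDiffAt.comp _ ?_ h2
  simp only [Function.comp_apply, hl]
  exact contMDiffAt_extChartAt' hq'

theorem chartDeriv_mfderiv {ι : F → Cotangent n S} (hι : ContMDiff (𝓡 n) (cotModel n) ∞ ι)
    {p q : F} (hq : q ∈ (chartAt (Vec n) p).source)
    (hq' : ι q ∈ (chartAt (ModelProd (Vec n) (Covec n)) (ι p)).source)
    (v : TangentSpace (𝓡 n) q) :
    chartDeriv (ι p) (ι q) (mfderiv (𝓡 n) (cotModel n) ι q v) =
      fderiv ℝ (chartMap ι p) (extChartAt (𝓡 n) p q)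
        (mfderiv (𝓡 n) 𝓘(ℝ, Vec n) (extChartAt (𝓡 n) p) q v) := by
  have h1 : HasMFDerivAt (𝓡 n) 𝓘(ℝ, Vec n × Covec n) (chartMap ι p ∘ extChartAt (𝓡 n) p) q
      ((fderiv ℝ (chartMap ι p) (extChartAt (𝓡 n) p q)).comp
        (mfderiv (𝓡 n) 𝓘(ℝ, Vec n) (extChartAt (𝓡 n) p) q)) :=
    HasMFDerivAt.comp (I' := 𝓘(ℝ, Vec n)) q
      ((contDiffAt_chartMap hι hq hq').differentiableAt (by norm_num)).hasFDerivAt.hasMFDerivAt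
      (mdifferentiableAt_extChartAt hq).hasMFDerivAt
  have h2 : HasMFDerivAt (𝓡 n) 𝓘(ℝ, Vec n × Covec n) (chartMap ι p ∘ extChartAt (𝓡 n) p) q
      ((chartDeriv (ι p) (ι q)).comp (mfderiv (𝓡 n) (cotModel n) ι q)) := by
    refine (HasMFDerivAt.comp q (mdifferentiableAt_extChartAt hq').hasMFDerivAt
      (hι.mdifferentiableAt (by norm_num)).hasMFDerivAt).congr_of_eventuallyEq ?_
    filter_upwards [(chartAt (Vec n) p).open_source.mem_nhds hq] with w hw
    exact chartMap_extChartAt ι hw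
  exact (DFunLike.congr_fun (hasMFDerivAt_unique h1 h2) v).symm

theorem mfderiv_extChartAt_bijective {p q : F} (hq : q ∈ (chartAt (Vec n) p).source) :
    Function.Bijective (mfderiv (𝓡 n) 𝓘(ℝ, Vec n) (extChartAt (𝓡 n) p) q) :=
  (isInvertible_mfderiv_extChartAt (I := 𝓡 n) (by rwa [extChartAt_source])).bijective

/-- In charts, the tangent plane is the range of the derivative of the embedding. -/
theorem mem_tangentPlane_iff {ι : F → Cotangent n S} (hι : ContMDiff (𝓡 n) (cotModel n) ∞ ι)
    {p q : F} (hq : q ∈ (chartAt (Vec n) p).source)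
    (hq' : ι q ∈ (chartAt (ModelProd (Vec n) (Covec n)) (ι p)).source)
    (v : TangentSpace (cotModel n) (ι q)) :
    v ∈ tangentPlane ι q ↔ ∃ a, fderiv ℝ (chartMap ι p) (extChartAt (𝓡 n) p q) a =
      chartDeriv (ι p) (ι q) v := by
  constructor
  · rintro ⟨w, rfl⟩
    exact ⟨_, (chartDeriv_mfderiv hι hq hq' w).symm⟩
  · rintro ⟨a, ha⟩
    obtain ⟨w, rfl⟩ := (mfderiv_extChartAt_bijective hq).2 a
    exact ⟨w, (chartDeriv_bijective hq').1 ((chartDeriv_mfderiv hι hq hq' w).trans ha)⟩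

theorem fderiv_comp_of_left_inverse {A E : Type*} [NormedAddCommGroup A] [NormedSpace ℝ A]
    [NormedAddCommGroup E] [NormedSpace ℝ E] {f : A → E} {ρ : E → A} {u : A}
    (hf : DifferentiableAt ℝ f u) (hρ : DifferentiableAt ℝ ρ (f u))
    (h : ∀ᶠ x in 𝓝 u, ρ (f x) = x) (v : A) : fderiv ℝ ρ (f u) (fderiv ℝ f u v) = v := by
  have h1 : HasFDerivAt (ρ ∘ f) _ u := hρ.hasFDerivAt.comp u hf.hasFDerivAt
  have h2 : HasFDerivAt (ρ ∘ f) (ContinuousLinearMap.id ℝ A) u :=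
    (hasFDerivAt_id u).congr_of_eventuallyEq h
  exact DFunLike.congr_fun (h1.unique h2) v

theorem fderiv_chartMap_injective {ι : F → Cotangent n S}
    (hι : IsSmoothEmbedding (𝓡 n) (cotModel n) ∞ ι) (p : F) :
    Function.Injective (fderiv ℝ (chartMap ι p) (extChartAt (𝓡 n) p p)) := by
  obtain ⟨ρ, hρ, hρι⟩ := exists_chartMap_left_inverse hι p
  exact Function.LeftInverse.injective (fderiv_comp_of_left_inverse
    ((contDiffAt_chartMap hι.contMDiff (mem_chart_source _ p)
      (mem_chart_source _ _)).differentiableAt (by norm_num))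
    (hρ.differentiableAt (by norm_num)) hρι)

theorem mfderiv_injective {ι : F → Cotangent n S}
    (hι : IsSmoothEmbedding (𝓡 n) (cotModel n) ∞ ι) (p : F) :
    Function.Injective (mfderiv (𝓡 n) (cotModel n) ι p) := by
  intro v w hvw
  have h := congrArg (chartDeriv (ι p) (ι p)) hvw
  rw [chartDeriv_mfderiv hι.contMDiff (mem_chart_source _ p) (mem_chart_source _ _),
    chartDeriv_mfderiv hι.contMDiff (mem_chart_source _ p) (mem_chart_source _ _)] at h
  exact (mfderiv_extChartAt_bijective (mem_chart_source _ p)).1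
    (fderiv_chartMap_injective hι p h)

theorem coordForm_fderiv_chartMap {ι : F → Cotangent n S} (hι : IsLagrangianEmbedding ι)
    {p q : F} (hq : q ∈ (chartAt (Vec n) p).source)
    (hq' : ι q ∈ (chartAt (ModelProd (Vec n) (Covec n)) (ι p)).source) (a b : Vec n) :
    coordForm (fderiv ℝ (chartMap ι p) (extChartAt (𝓡 n) p q) a)
      (fderiv ℝ (chartMap ι p) (extChartAt (𝓡 n) p q) b) = 0 := by
  obtain ⟨v, rfl⟩ := (mfderiv_extChartAt_bijective hq).2 a
  obtain ⟨w, rfl⟩ := (mfderiv_extChartAt_bijective hq).2 b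
  rw [← chartDeriv_mfderiv hι.isSmoothEmbedding.contMDiff hq hq',
    ← chartDeriv_mfderiv hι.isSmoothEmbedding.contMDiff hq hq', coordForm_chartDeriv hq']
  exact hι.isotropic q v w

/-- The hamiltonian vector field is tangent to a lagrangian submanifold of an energy level. -/
theorem exists_mfderiv_eq_hamVectorField {H : Cotangent n S → ℝ}
    (hH : ContMDiff (cotModel n) 𝓘(ℝ, ℝ) ∞ H) {ι : F → Cotangent n S}
    (hι : IsLagrangianEmbedding ι) {c : ℝ} (hc : ∀ p, H (ι p) = c) (p : F) :
    ∃ w : TangentSpace (𝓡 n) p,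
      mfderiv (𝓡 n) (cotModel n) ι p w = hamVectorField H (ι p) := by
  have hp := mem_chart_source (Vec n) p
  have hp' := mem_chart_source (ModelProd (Vec n) (Covec n)) (ι p)
  have hsm := hι.isSmoothEmbedding.contMDiff
  have hzero : ∀ w : TangentSpace (𝓡 n) p,
      mfderiv (cotModel n) 𝓘(ℝ, ℝ) H (ι p) (mfderiv (𝓡 n) (cotModel n) ι p w) = 0 := by
    intro w
    have h1 : HasMFDerivAt (𝓡 n) 𝓘(ℝ, ℝ) (H ∘ ι) p _ :=
      (hH.mdifferentiableAt (by norm_num)).hasMFDerivAt.comp p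
        (hsm.mdifferentiableAt (by norm_num)).hasMFDerivAt
    have h2 : H ∘ ι = fun _ => c := funext hc
    rw [h2] at h1
    exact DFunLike.congr_fun (hasMFDerivAt_unique h1 (hasMFDerivAt_const c p)) w
  -- `H` is constant on `F`, so its hamiltonian field is symplectically orthogonal to `F`
  obtain ⟨a, ha⟩ := mem_range_of_coordForm_eq_zero
    (fderiv_chartMap_injective hι.isSmoothEmbedding p)
    (coordForm_fderiv_chartMap hι hp hp')
    (z := chartDeriv (ι p) (ι p) (hamVectorField H (ι p))) (by
      intro a
      obtain ⟨w, rfl⟩ := (mfderiv_extChartAt_bijective hp).2 a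
      rw [← chartDeriv_mfderiv hsm hp hp', coordForm_chartDeriv hp',
        canonicalForm_hamVectorField]
      exact neg_eq_zero.2 (hzero w))
  obtain ⟨w, rfl⟩ := (mfderiv_extChartAt_bijective hp).2 a
  exact ⟨w, (chartDeriv_bijective hp').1 ((chartDeriv_mfderiv hsm hp hp' w).trans ha)⟩

end

/-! ### The hamiltonian flow on the lagrangian submanifold -/

section
variable {n : ℕ} {S : Type*} [TopologicalSpace S] [ChartedSpace (Vec n) S]
  [IsManifold (𝓡 n) ∞ S]
  {F : Type*} [TopologicalSpace F] [ChartedSpace (Vec n) F]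

/-- Needed for the uniqueness of integral curves and for compact sets to be closed. -/
instance t2Space_cotangent [T2Space S] : T2Space (Cotangent n S) := by
  refine ⟨fun θ θ' hne => ?_⟩
  have hc : Continuous (TotalSpace.proj : Cotangent n S → S) :=
    FiberBundle.continuous_proj (Covec n) (fun x : S => CotangentSpace n x)
  by_cases hb : θ.proj = θ'.proj
  · let e := chartAt (ModelProd (Vec n) (Covec n)) θ
    have h1 : θ ∈ e.source := mem_chart_source _ θ
    have h2 : θ' ∈ e.source := by
      rw [mem_cotangent_chart_source, ← hb]; exact mem_chart_source _ _
    have hne' : e θ ≠ e θ' := fun h => hne (e.injOn h1 h2 h)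
    have : T2Space (ModelProd (Vec n) (Covec n)) :=
      inferInstanceAs (T2Space (Vec n × Covec n))
    obtain ⟨U, V, hU, hV, hxU, hyV, hUV⟩ := t2_separation hne'
    refine ⟨e.source ∩ e ⁻¹' U, e.source ∩ e ⁻¹' V, e.isOpen_inter_preimage hU,
      e.isOpen_inter_preimage hV, ⟨h1, hxU⟩, ⟨h2, hyV⟩, ?_⟩
    exact (hUV.preimage e).mono Set.inter_subset_right Set.inter_subset_right
  · obtain ⟨U, V, hU, hV, hxU, hyV, hUV⟩ := t2_separation hb
    exact ⟨_, _, hU.preimage hc, hV.preimage hc, hxU, hyV, hUV.preimage _⟩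

variable [IsManifold (𝓡 n) ∞ F]

/-- A vector field on `F` that `ι` carries to the hamiltonian vector field is `C¹`. -/
theorem contMDiff_of_mfderiv_eq_hamVectorField {H : Cotangent n S → ℝ}
    (hH : ContMDiff (cotModel n) 𝓘(ℝ, ℝ) ∞ H) {ι : F → Cotangent n S}
    (hι : IsSmoothEmbedding (𝓡 n) (cotModel n) ∞ ι) {v : ∀ p : F, TangentSpace (𝓡 n) p}
    (hv : ∀ p, mfderiv (𝓡 n) (cotModel n) ι p (v p) = hamVectorField H (ι p)) :
    ContMDiff (𝓡 n) (𝓡 n).tangent 1 (fun p : F => (⟨p, v p⟩ : TangentBundle (𝓡 n) F)) := by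
  intro p
  rw [contMDiffAt_section]
  obtain ⟨ρ, hρ, hρι⟩ := exists_chartMap_left_inverse hι p
  have hp := mem_chart_source (Vec n) p
  have hp' := mem_chart_source (ModelProd (Vec n) (Covec n)) (ι p)
  rw [chartMap_self] at hρ
  have h1 : ContDiffAt ℝ 1 (fun z => fderiv ℝ ρ z
      (coordGrad (fderiv ℝ (chartFun H (ι p)) z))) (extChartAt (cotModel n) (ι p) (ι p)) :=
    ContDiffAt.clm_apply (hρ.fderiv_right (by norm_cast)) (contDiffAt_coordGrad_chartFun hH hp')
  have h2 : ContMDiffAt (𝓡 n) 𝓘(ℝ, Vec n × Covec n) 1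
      (fun q => extChartAt (cotModel n) (ι p) (ι q)) p :=
    ContMDiffAt.comp p contMDiffAt_extChartAt (hι.contMDiff.contMDiffAt.of_le (by norm_cast))
  refine (h1.contMDiffAt.comp p h2).congr_of_eventuallyEq ?_
  have hc : ContinuousAt (extChartAt (𝓡 n) p) p := continuousAt_extChartAt p
  have hρd : ∀ᶠ q in 𝓝 p, DifferentiableAt ℝ ρ (extChartAt (cotModel n) (ι p) (ι q)) :=
    h2.continuousAt.eventually (((hρ.of_le (m := 1) (by norm_cast)).eventually (by simp)).mono
      fun x hx => hx.differentiableAt (by norm_num))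
  filter_upwards [eventually_mem_charts hι.contMDiff.continuous p,
    hc.eventually hρι.eventually_nhds, hρd] with q hq hρq hρd
  have hX := chartDeriv_hamVectorField hH hq.2
  rw [← hv q, chartDeriv_mfderiv hι.contMDiff hq.1 hq.2] at hX
  rw [← chartMap_extChartAt ι hq.1] at hρd
  have h3 := fderiv_comp_of_left_inverse
    ((contDiffAt_chartMap hι.contMDiff hq.1 hq.2).differentiableAt (by norm_num)) hρd hρq
    (mfderiv (𝓡 n) 𝓘(ℝ, Vec n) (extChartAt (𝓡 n) p) q (v q))
  rw [hX, chartMap_extChartAt ι hq.1] at h3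
  refine Eq.trans ?_ h3.symm
  have h5 := DFunLike.congr_fun
    (TangentBundle.continuousLinearMapAt_trivializationAt (𝕜 := ℝ) (I := 𝓡 n) hq.1) (v q)
  refine Eq.trans ?_ h5
  have hb : q ∈ (trivializationAt (Vec n) (TangentSpace (𝓡 n) : F → Type _) p).baseSet := hq.1
  rw [Trivialization.continuousLinearMapAt_apply, Trivialization.linearMapAt_apply, if_pos hb]

/-- A compact lagrangian submanifold of an energy level is invariant under the hamiltonian flow. -/
theorem flow_mem_range [T2Space S] [CompactSpace F] {H : Cotangent n S → ℝ}
    (hH : ContMDiff (cotModel n) 𝓘(ℝ, ℝ) ∞ H) {φ : Flow ℝ (Cotangent n S)}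
    (hφ : IsHamiltonianFlow H φ) {ι : F → Cotangent n S} (hι : IsLagrangianEmbedding ι) {c : ℝ}
    (hc : ∀ p, H (ι p) = c) (p : F) (t : ℝ) : φ t (ι p) ∈ Set.range ι := by
  choose v hv using exists_mfderiv_eq_hamVectorField hH hι hc
  have hvs := contMDiff_of_mfderiv_eq_hamVectorField hH hι.isSmoothEmbedding hv
  have hXs := contMDiff_hamVectorField hH
  have hιs := hι.isSmoothEmbedding.contMDiff
  -- an integral curve in `F` is one in `T^*S`, hence a piece of an orbit
  have hlocal : ∀ q : F, ∀ᶠ s in 𝓝 (0 : ℝ), φ s (ι q) ∈ Set.range ι := by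
    intro q
    obtain ⟨γ, hγ0, hγ⟩ :=
      exists_isMIntegralCurveAt_of_contMDiffAt_boundaryless (t₀ := 0) (hvs q)
    have h1 : IsMIntegralCurveAt (ι ∘ γ) (hamVectorField H) 0 := by
      filter_upwards [hγ] with s hs
      have := HasMFDerivAt.comp s
        (hιs.mdifferentiableAt (x := γ s) (by norm_num)).hasMFDerivAt hs
      have e : (mfderiv (𝓡 n) (cotModel n) ι (γ s)).comp
          ((1 : ℝ →L[ℝ] ℝ).smulRight (v (γ s))) =
          (1 : ℝ →L[ℝ] ℝ).smulRight (hamVectorField H (ι (γ s))) := by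
        rw [← hv]; ext; simp
      exact this.congr_mfderiv e
    have h2 := isMIntegralCurveAt_eventuallyEq_of_contMDiffAt_boundaryless (hXs _) h1
      ((hφ (ι q)).isMIntegralCurveAt 0) (by simp [hγ0])
    filter_upwards [h2] with s hs
    exact ⟨γ s, hs⟩
  let A : Set ℝ := {t | φ t (ι p) ∈ Set.range ι}
  have hcl : IsClosed A :=
    (isCompact_range hιs.continuous).isClosed.preimage (φ.continuous continuous_id continuous_const)
  have hop : IsOpen A := by
    rw [isOpen_iff_mem_nhds]
    rintro t ⟨q, hq⟩
    have htend : Filter.Tendsto (fun s : ℝ => s - t) (𝓝 t) (𝓝 0) := by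
      have : ContinuousAt (fun s : ℝ => s - t) t := by fun_prop
      simpa [ContinuousAt] using this
    filter_upwards [htend.eventually (hlocal q)] with s hs
    change φ s (ι p) ∈ Set.range ι
    rwa [hq, ← φ.map_add, sub_add_cancel] at hs
  have huniv : A = Set.univ :=
    IsClopen.eq_univ ⟨hcl, hop⟩ ⟨0, p, by simp⟩
  have ht : t ∈ A := huniv ▸ Set.mem_univ t
  exact ht

/-- A piece of an orbit of the flow, run with speed `l`, is differentiable in charts. -/
theorem hasDerivAt_chart_of_flow {H : Cotangent n S → ℝ}
    (hH : ContMDiff (cotModel n) 𝓘(ℝ, ℝ) ∞ H) {φ : Flow ℝ (Cotangent n S)}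
    (hφ : IsHamiltonianFlow H φ) {ι : F → Cotangent n S} (hι : IsLagrangianEmbedding ι) {c : ℝ}
    (hc : ∀ p, H (ι p) = c) {γ : ℝ → F} {t₀ l : ℝ} (hγ : ContinuousAt γ t₀)
    (hfl : ∀ᶠ t in 𝓝 t₀, ι (γ t) = φ (l * (t - t₀)) (ι (γ t₀))) :
    ∃ a : Vec n,
      fderiv ℝ (chartMap ι (γ t₀)) (extChartAt (𝓡 n) (γ t₀) (γ t₀)) a =
        coordGrad (fderiv ℝ (chartFun H (ι (γ t₀)))
          (extChartAt (cotModel n) (ι (γ t₀)) (ι (γ t₀)))) ∧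
      HasDerivAt (fun t => extChartAt (𝓡 n) (γ t₀) (γ t)) (l • a) t₀ := by
  have hsm := hι.isSmoothEmbedding.contMDiff
  generalize hpe : γ t₀ = p at *
  have hp := mem_chart_source (Vec n) p
  have hp' := mem_chart_source (ModelProd (Vec n) (Covec n)) (ι p)
  obtain ⟨w, hw⟩ := exists_mfderiv_eq_hamVectorField hH hι hc p
  set a : Vec n := mfderiv (𝓡 n) 𝓘(ℝ, Vec n) (extChartAt (𝓡 n) p) p w with ha
  have hX := chartDeriv_hamVectorField hH hp'
  have hDa : fderiv ℝ (chartMap ι p) (extChartAt (𝓡 n) p p) a =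
      chartDeriv (ι p) (ι p) (hamVectorField H (ι p)) := by
    rw [ha, ← chartDeriv_mfderiv hsm hp hp', hw]
  refine ⟨a, hDa.trans hX, ?_⟩
  obtain ⟨ρ, hρ, hρι⟩ := exists_chartMap_left_inverse hι.isSmoothEmbedding p
  have hρa := fderiv_comp_of_left_inverse
    ((contDiffAt_chartMap hsm hp hp').differentiableAt (by norm_num))
    (hρ.differentiableAt (by norm_num)) hρι a
  rw [hDa] at hρa
  have h0 : φ (l * (t₀ - t₀)) (ι p) = ι p := by simp
  -- the orbit in the canonical chart
  have horb : HasDerivAt (fun t : ℝ => extChartAt (cotModel n) (ι p) (φ (l * (t - t₀)) (ι p)))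
      (l • chartDeriv (ι p) (ι p) (hamVectorField H (ι p))) t₀ := by
    have h1 : HasMFDerivAt 𝓘(ℝ, ℝ) 𝓘(ℝ, Vec n × Covec n)
        (extChartAt (cotModel n) (ι p) ∘ fun s : ℝ => φ s (ι p)) 0
        ((chartDeriv (ι p) (ι p)).comp
          ((1 : ℝ →L[ℝ] ℝ).smulRight (hamVectorField H (ι p)))) := by
      have h2 := hφ (ι p) 0
      beta_reduce at h2
      have e0 : φ 0 (ι p) = ι p := by simp
      have h3 : HasMFDerivAt (cotModel n) 𝓘(ℝ, Vec n × Covec n) (extChartAt (cotModel n) (ι p))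
          (φ 0 (ι p)) (chartDeriv (ι p) (φ 0 (ι p))) :=
        (mdifferentiableAt_extChartAt (by rw [e0]; exact hp')).hasMFDerivAt
      have h4 := HasMFDerivAt.comp (0 : ℝ) h3 h2
      rw [e0] at h4
      exact h4
    have h2 : HasDerivAt (fun s : ℝ => extChartAt (cotModel n) (ι p) (φ s (ι p)))
        (chartDeriv (ι p) (ι p) (hamVectorField H (ι p))) (l * (t₀ - t₀)) := by
      rw [sub_self, mul_zero]
      have h1' : HasFDerivAt (fun s : ℝ => extChartAt (cotModel n) (ι p) (φ s (ι p)))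
        ((1 : ℝ →L[ℝ] ℝ).smulRight (chartDeriv (ι p) (ι p) (hamVectorField H (ι p)))) 0 := by
        refine (hasMFDerivAt_iff_hasFDerivAt.1 h1).congr_fderiv ?_
        exact ContinuousLinearMap.ext fun r => (chartDeriv (ι p) (ι p)).map_smul r _
      have h1'' := h1'.hasDerivAt
      rwa [ContinuousLinearMap.smulRight_apply, one_apply_eq_self, one_smul] at h1''
    have h3 : HasDerivAt (fun t : ℝ => l * (t - t₀)) l t₀ := by
      simpa using ((hasDerivAt_id t₀).sub_const t₀).const_mul l
    exact h2.scomp t₀ h3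
  have h5 : HasDerivAt (fun t : ℝ => ρ (extChartAt (cotModel n) (ι p) (φ (l * (t - t₀)) (ι p))))
      (l • a) t₀ := by
    have hρ' : HasFDerivAt ρ (fderiv ℝ ρ (chartMap ι p (extChartAt (𝓡 n) p p)))
        (extChartAt (cotModel n) (ι p) (φ (l * (t₀ - t₀)) (ι p))) := by
      rw [h0, ← chartMap_self]
      exact (hρ.differentiableAt (by norm_num)).hasFDerivAt
    have h6 := hρ'.comp_hasDerivAt t₀ horb
    rw [map_smul, hρa] at h6
    exact h6
  refine h5.congr_of_eventuallyEq ?_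
  have hγ' : Filter.Tendsto γ (𝓝 t₀) (𝓝 p) := by rw [← hpe]; exact hγ
  have hc : ContinuousAt (extChartAt (𝓡 n) p) p := continuousAt_extChartAt p
  filter_upwards [hfl, hγ'.eventually (eventually_mem_charts hsm.continuous p),
    hγ'.eventually (hc.eventually hρι)] with t h1 h2 h3
  rw [← h1, ← chartMap_extChartAt ι h2.1, h3]

end

/-! ### Transversality near a positive tangency -/

open Filter in
theorem tendsto_clm_apply {X C E : Type*} [NormedAddCommGroup C] [NormedSpace ℝ C]
    [NormedAddCommGroup E] [NormedSpace ℝ E] {l : Filter X} {f : X → C →L[ℝ] E} {L : C →L[ℝ] E}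
    {g : X → C} {v : C} (hf : Tendsto f l (𝓝 L)) (hg : Tendsto g l (𝓝 v)) :
    Tendsto (fun j => f j (g j)) l (𝓝 (L v)) :=
  ((isBoundedBilinearMap_apply (𝕜 := ℝ) (E := C) (F := E)).continuous.tendsto (L, v)).comp
    (hf.prodMk_nhds hg)

open Filter in
/-- Let the planes `range (D t)` and `V`, seen in `C` through the isomorphisms `Φ t`, be lagrangian,
and suppose that the velocity of `range (D t)` at `t₀` is positive on `range (D t₀) ∩ V`. If the
second plane is rotated by the angle `-α`, then the two planes are transverse for all
`(t, α) ≠ (t₀, 0)` near `(t₀, 0)` such that `t - t₀` and `α` do not have the same sign. -/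
theorem eventually_transverse_of_velocity_pos {A C E : Type*}
    [NormedAddCommGroup A] [NormedSpace ℝ A] [FiniteDimensional ℝ A]
    [NormedAddCommGroup C] [NormedSpace ℂ C] [FiniteDimensional ℂ C]
    [NormedAddCommGroup E] [NormedSpace ℝ E] [FiniteDimensional ℝ E]
    {B : E → E → ℝ} (hB : IsBoundedBilinearMap ℝ fun p : E × E => B p.1 p.2)
    {D : ℝ → A →L[ℝ] E} {D' : A →L[ℝ] E} {t₀ : ℝ} (hD : HasDerivAt D D' t₀)
    (hDi : Function.Injective (D t₀)) {Φ : ℝ → C →L[ℝ] E} (hΦ : ContinuousAt Φ t₀)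
    (hΦi : Function.Injective (Φ t₀)) (V : Submodule ℝ E)
    (hV : ∀ v ∈ V, ∀ w ∈ V, B v w = 0) (hiso : ∀ a b, B (D t₀ a) (D t₀ b) = 0)
    (hpos : ∀ a, a ≠ 0 → D t₀ a ∈ V → 0 < B (D t₀ a) (D' a))
    (hneg : ∀ x, x ≠ 0 → B (Φ t₀ x) (Φ t₀ (Complex.I • x)) < 0) :
    ∀ᶠ p : ℝ × ℝ in 𝓝 (t₀, 0), p ≠ (t₀, 0) →
      (p.1 ≤ t₀ ∧ 0 ≤ p.2 ∨ t₀ ≤ p.1 ∧ p.2 ≤ 0) →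
      ∀ x a, D p.1 a = Φ p.1 x → Φ p.1 (Complex.exp (p.2 * Complex.I) • x) ∈ V → x = 0 := by
  -- take a limit `ξ` of unit vectors `x j` that violate the claim along a sequence `p j → (t₀, 0)`
  by_contra hcon
  have hfreq := Filter.not_eventually.1 hcon
  obtain ⟨p, hp, hpP⟩ := Filter.exists_seq_forall_of_frequently hfreq
  have hex : ∀ j, p j ≠ (t₀, 0) ∧ ((p j).1 ≤ t₀ ∧ 0 ≤ (p j).2 ∨ t₀ ≤ (p j).1 ∧ (p j).2 ≤ 0) ∧
      ∃ (x : C) (a : A), ‖x‖ = 1 ∧ D (p j).1 a = Φ (p j).1 x ∧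
        Φ (p j).1 (Complex.exp ((p j).2 * Complex.I) • x) ∈ V := by
    intro j
    have := hpP j
    push Not at this
    obtain ⟨h1, h2, x, a, h3, h4, h5⟩ := this
    refine ⟨h1, h2, ‖x‖⁻¹ • x, ‖x‖⁻¹ • a, ?_, ?_, ?_⟩
    · rw [norm_smul, norm_inv, norm_norm, inv_mul_cancel₀ (norm_ne_zero_iff.2 h5)]
    · rw [map_smul, map_smul, h3]
    · rw [smul_comm, map_smul]
      exact V.smul_mem _ h4
  choose hne hsgn x a hx hDa hVa using hex
  have ht : Tendsto (fun j => (p j).1) atTop (𝓝 t₀) := (continuous_fst.tendsto _).comp hp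
  have hα : Tendsto (fun j => (p j).2) atTop (𝓝 0) := (continuous_snd.tendsto (t₀, (0 : ℝ))).comp hp
  have hDt : Tendsto (fun j => D (p j).1) atTop (𝓝 (D t₀)) := hD.continuousAt.tendsto.comp ht
  have hΦt : Tendsto (fun j => Φ (p j).1) atTop (𝓝 (Φ t₀)) := hΦ.tendsto.comp ht
  -- the preimages `a j` stay bounded
  obtain ⟨K, hK0, hK⟩ := (D t₀).toLinearMap.exists_antilipschitzWith (LinearMap.ker_eq_bot.2 hDi)
  have hKb : ∀ b, ‖b‖ ≤ K * ‖D t₀ b‖ := fun b => by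
    simpa using hK.le_mul_dist b 0
  have hab : ∀ᶠ j in atTop, a j ∈ Metric.closedBall (0 : A) (2 * (K * (‖Φ t₀‖ + 1))) := by
    have h1 : ∀ᶠ j in atTop, ‖D (p j).1 - D t₀‖ < 1 / (2 * K) := by
      have := (tendsto_iff_norm_sub_tendsto_zero.1 hDt)
      exact this.eventually_lt_const (by positivity)
    have h2 : ∀ᶠ j in atTop, ‖Φ (p j).1‖ < ‖Φ t₀‖ + 1 :=
      hΦt.norm.eventually_lt_const (by linarith)
    filter_upwards [h1, h2] with j h1 h2
    rw [mem_closedBall_zero_iff]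
    have e1 : ‖D t₀ (a j)‖ ≤ ‖Φ t₀‖ + 1 + 1 / (2 * K) * ‖a j‖ := by
      have e2 : D t₀ (a j) = Φ (p j).1 (x j) - (D (p j).1 - D t₀) (a j) := by
        rw [← hDa j]; simp
      rw [e2]
      have e3 := (Φ (p j).1).le_opNorm (x j)
      rw [hx j, mul_one] at e3
      have e4 := (D (p j).1 - D t₀).le_opNorm (a j)
      have e5 := mul_le_mul_of_nonneg_right h1.le (norm_nonneg (a j))
      exact (norm_sub_le _ _).trans (by linarith)
    have e6 := hKb (a j)
    have hKpos : (0 : ℝ) < K := hK0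
    have e7 : (K : ℝ) * ‖D t₀ (a j)‖ ≤ K * (‖Φ t₀‖ + 1) + 1 / 2 * ‖a j‖ := by
      calc (K : ℝ) * ‖D t₀ (a j)‖ ≤ K * (‖Φ t₀‖ + 1 + 1 / (2 * K) * ‖a j‖) := by gcongr
        _ = _ := by field_simp
    linarith
  have hprC : ProperSpace C := FiniteDimensional.proper ℂ C
  have hprA : ProperSpace A := FiniteDimensional.proper ℝ A
  obtain ⟨⟨ξ, e⟩, hξe, ψ, hψ, hlim⟩ := ((isCompact_sphere (0 : C) 1).prod
    (isCompact_closedBall (0 : A) (2 * (K * (‖Φ t₀‖ + 1))))).tendsto_subseq'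
    (x := fun j => (x j, a j)) (Eventually.frequently (by
      filter_upwards [hab] with j hj
      exact ⟨by simp [hx j], hj⟩))
  have hξ1 : ‖ξ‖ = 1 := by simpa using hξe.1
  have hξ0 : ξ ≠ 0 := by rintro rfl; simp at hξ1
  have hxl : Tendsto (fun j => x (ψ j)) atTop (𝓝 ξ) := (continuous_fst.tendsto (ξ, e)).comp hlim
  have hal : Tendsto (fun j => a (ψ j)) atTop (𝓝 e) := (continuous_snd.tendsto (ξ, e)).comp hlim
  have hψt := hψ.tendsto_atTop
  have ht' := ht.comp hψt
  have hα' := hα.comp hψt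
  have hD1 : Tendsto (fun j => D (p (ψ j)).1 (a (ψ j))) atTop (𝓝 (D t₀ e)) :=
    tendsto_clm_apply (hDt.comp hψt) hal
  have hΦ1 : Tendsto (fun j => Φ (p (ψ j)).1 (x (ψ j))) atTop (𝓝 (Φ t₀ ξ)) :=
    tendsto_clm_apply (hΦt.comp hψt) hxl
  have hk : D t₀ e = Φ t₀ ξ := by
    refine tendsto_nhds_unique hD1 (hΦ1.congr fun j => (hDa _).symm)
  have hexp : Tendsto (fun j => Complex.exp ((p (ψ j)).2 * Complex.I)) atTop (𝓝 1) := by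
    have : Continuous fun α : ℝ => Complex.exp (α * Complex.I) := by fun_prop
    have h := (this.tendsto 0).comp hα'
    simpa using! h
  have hkV : D t₀ e ∈ V := by
    rw [hk]
    have h1 : Tendsto (fun j => Φ (p (ψ j)).1 (Complex.exp ((p (ψ j)).2 * Complex.I) • x (ψ j)))
        atTop (𝓝 (Φ t₀ ((1 : ℂ) • ξ))) := tendsto_clm_apply (hΦt.comp hψt) (hexp.smul hxl)
    rw [one_smul] at h1
    exact V.closed_of_finiteDimensional.mem_of_tendsto h1 (Eventually.of_forall fun j => hVa _)
  have he0 : e ≠ 0 := by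
    rintro rfl
    rw [map_zero] at hk
    exact hξ0 (hΦi (hk.symm.trans (map_zero _).symm))
  -- the two terms of the expansion of `B (D t₀ e) (Φ t (exp (α i) x)) = 0`
  have hβ : Tendsto (fun j => B (D t₀ e) (dslope D t₀ (p (ψ j)).1 (a (ψ j)))) atTop
      (𝓝 (B (D t₀ e) (D' e))) := by
    have h1 : Tendsto (fun j => dslope D t₀ (p (ψ j)).1) atTop (𝓝 D') := by
      have := (continuousAt_dslope_same.2 hD.differentiableAt).tendsto.comp ht'
      rwa [dslope_same, hD.deriv] at this
    exact (hB.continuous.tendsto (D t₀ e, D' e)).comp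
      (tendsto_const_nhds.prodMk_nhds (tendsto_clm_apply h1 hal))
  have hδ : Tendsto (fun j => B (D t₀ e) (Φ (p (ψ j)).1 (Complex.I • x (ψ j)))) atTop
      (𝓝 (B (Φ t₀ ξ) (Φ t₀ (Complex.I • ξ)))) := by
    rw [hk]
    exact (hB.continuous.tendsto (Φ t₀ ξ, Φ t₀ (Complex.I • ξ))).comp
      (tendsto_const_nhds.prodMk_nhds (tendsto_clm_apply (hΦt.comp hψt) (hxl.const_smul _)))
  have hcos : Tendsto (fun j => Real.cos (p (ψ j)).2) atTop (𝓝 1) := by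
    simpa using! (Real.continuous_cos.tendsto 0).comp hα'
  have hBs : ∀ (r : ℝ) v w, B v (r • w) = r * B v w := fun r v w => hB.smul_right r v w
  have hBa : ∀ v w w', B v (w + w') = B v w + B v w' := fun v w w' => hB.add_right v w w'
  have hzero : ∀ j, ((p (ψ j)).1 - t₀) * (Real.cos (p (ψ j)).2 *
      B (D t₀ e) (dslope D t₀ (p (ψ j)).1 (a (ψ j)))) +
      Real.sin (p (ψ j)).2 * B (D t₀ e) (Φ (p (ψ j)).1 (Complex.I • x (ψ j))) = 0 := by
    intro j
    have h1 := hV _ hkV _ (hVa (ψ j))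
    have h2 : Complex.exp ((p (ψ j)).2 * Complex.I) • x (ψ j) =
        Real.cos (p (ψ j)).2 • x (ψ j) + Real.sin (p (ψ j)).2 • (Complex.I • x (ψ j)) := by
      rw [Complex.exp_mul_I, add_smul, mul_smul, ← Complex.ofReal_cos, ← Complex.ofReal_sin,
        Complex.coe_smul, Complex.coe_smul]
    rw [h2, map_add, map_smul, map_smul, hBa, hBs, hBs, ← hDa] at h1
    have h3 : D (p (ψ j)).1 (a (ψ j)) = D t₀ (a (ψ j)) +
        ((p (ψ j)).1 - t₀) • dslope D t₀ (p (ψ j)).1 (a (ψ j)) := by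
      have := sub_smul_dslope D t₀ (p (ψ j)).1
      rw [← _root_.smul_apply, this]; simp
    rw [h3, hBa, hiso, hBs] at h1
    linarith
  have hβpos := hpos e he0 hkV
  have hδneg := hneg ξ hξ0
  obtain ⟨j, hj1, hj2, hj3, hj4, hj5⟩ := ((hβ.eventually_const_lt hβpos).and
    ((hδ.eventually_lt_const hδneg).and ((hcos.eventually_const_lt one_pos).and
    ((hα'.eventually_lt_const Real.pi_pos).and
      (hα'.eventually_const_lt (neg_lt_zero.2 Real.pi_pos)))))).exists
  -- in the two sectors, both terms of `hzero` have the same sign, so that both of them vanish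
  have h0 := hzero j
  have hcb := mul_pos hj3 hj1
  simp only [Function.comp_apply] at hj4 hj5
  refine hne (ψ j) ?_
  rcases hsgn (ψ j) with ⟨h1, h2⟩ | ⟨h1, h2⟩
  · have hs := Real.sin_nonneg_of_nonneg_of_le_pi h2 hj4.le
    have hτ : (p (ψ j)).1 = t₀ := by
      by_contra hne'
      have : (p (ψ j)).1 - t₀ < 0 := sub_neg.2 (lt_of_le_of_ne h1 hne')
      nlinarith [mul_neg_of_neg_of_pos this hcb, mul_nonneg hs (neg_nonneg.2 hj2.le)]
    have hα0 : (p (ψ j)).2 = 0 := by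
      by_contra hne'
      have := Real.sin_pos_of_pos_of_lt_pi (lt_of_le_of_ne h2 (Ne.symm hne')) hj4
      nlinarith [mul_nonneg (sub_nonneg.2 h1) hcb.le, mul_pos this (neg_pos.2 hj2)]
    exact Prod.ext hτ hα0
  · have hs := Real.sin_nonpos_of_nonpos_of_neg_pi_le h2 hj5.le
    have hτ : (p (ψ j)).1 = t₀ := by
      by_contra hne'
      have : 0 < (p (ψ j)).1 - t₀ := sub_pos.2 (lt_of_le_of_ne h1 (Ne.symm hne'))
      nlinarith [mul_pos this hcb, mul_nonneg (neg_nonneg.2 hs) (neg_nonneg.2 hj2.le)]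
    have hα0 : (p (ψ j)).2 = 0 := by
      by_contra hne'
      have := Real.sin_neg_of_neg_of_neg_pi_lt (lt_of_le_of_ne h2 hne') hj5
      nlinarith [mul_nonneg (sub_nonneg.2 h1) hcb.le, mul_pos (neg_pos.2 this) (neg_pos.2 hj2)]
    exact Prod.ext hτ hα0

/-! ### Lagrangian planes and unitary matrices -/

section
open Matrix

theorem mem_colSpan_iff_exists {n : ℕ} (u : Matrix (Fin n) (Fin n) ℂ) (z : Fin n → ℂ) :
    z ∈ colSpan u ↔ ∃ r : Fin n → ℝ, z = u *ᵥ fun i => (r i : ℂ) := by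
  rw [colSpan, Submodule.mem_span_range_iff_exists_fun]
  refine exists_congr fun r => ?_
  have : ∑ i, r i • u.col i = u *ᵥ fun i => (r i : ℂ) := by
    ext j
    simp [Matrix.mulVec, dotProduct, Finset.sum_apply, Matrix.col_apply, mul_comm]
  rw [this, eq_comm]

theorem conjTranspose_mul_self_of_mem {n : ℕ} {u : Matrix (Fin n) (Fin n) ℂ}
    (hu : u ∈ unitaryGroup (Fin n) ℂ) : uᴴ * u = 1 :=
  mem_unitaryGroup_iff'.1 hu

theorem mul_conjTranspose_self_of_mem {n : ℕ} {u : Matrix (Fin n) (Fin n) ℂ}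
    (hu : u ∈ unitaryGroup (Fin n) ℂ) : u * uᴴ = 1 :=
  mem_unitaryGroup_iff.1 hu

theorem transpose_mul_map_star_of_mem {n : ℕ} {u : Matrix (Fin n) (Fin n) ℂ}
    (hu : u ∈ unitaryGroup (Fin n) ℂ) : uᵀ * u.map star = 1 := by
  have h := congrArg transpose (conjTranspose_mul_self_of_mem hu)
  rwa [transpose_mul, transpose_one, conjTranspose, transpose_map, transpose_transpose] at h

theorem star_mulVec_map {n : ℕ} (M : Matrix (Fin n) (Fin n) ℂ) (z : Fin n → ℂ) :
    star (M *ᵥ z) = M.map star *ᵥ star z := by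
  ext i
  simp [mulVec, dotProduct]

/-- The lagrangian plane spanned by the columns of a unitary matrix `u` is the fixed space of the
antilinear involution `z ↦ u uᵀ z̄`. -/
theorem mem_colSpan_iff {n : ℕ} {u : Matrix (Fin n) (Fin n) ℂ}
    (hu : u ∈ unitaryGroup (Fin n) ℂ) (z : Fin n → ℂ) :
    z ∈ colSpan u ↔ (u * uᵀ) *ᵥ star z = z := by
  rw [mem_colSpan_iff_exists]
  constructor
  · rintro ⟨r, rfl⟩
    rw [star_mulVec_map, mulVec_mulVec, Matrix.mul_assoc, transpose_mul_map_star_of_mem hu,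
      Matrix.mul_one]
    congr 1
    ext i
    simp
  · intro h
    have h1 : uᴴ *ᵥ z = uᵀ *ᵥ star z := by
      conv_lhs => rw [← h]
      rw [mulVec_mulVec, ← Matrix.mul_assoc, conjTranspose_mul_self_of_mem hu, Matrix.one_mul]
    have h2 : star (uᴴ *ᵥ z) = uᴴ *ᵥ z := by
      conv_rhs => rw [h1]
      rw [star_mulVec_map]
      congr 1
      ext i j
      simp
    refine ⟨fun i => ((uᴴ *ᵥ z) i).re, ?_⟩
    have h3 : (fun i => ((((uᴴ *ᵥ z) i).re : ℝ) : ℂ)) = uᴴ *ᵥ z := by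
      ext i
      exact Complex.conj_eq_iff_re.1 (congrFun h2 i)
    rw [h3, mulVec_mulVec, mul_conjTranspose_self_of_mem hu, one_mulVec]

/-- For two lagrangian planes `colSpan u` and `colSpan v`, the unitary matrix
`v vᵀ (u uᵀ)⁻¹`: its eigenvalues `exp (2 i α)` are given by the angles `α` between the planes. -/
def relUnitary {n : ℕ} (u v : Matrix (Fin n) (Fin n) ℂ) : Matrix (Fin n) (Fin n) ℂ :=
  v * vᵀ * (u * uᵀ)ᴴ

theorem mul_transpose_mem {n : ℕ} {u : Matrix (Fin n) (Fin n) ℂ}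
    (hu : u ∈ unitaryGroup (Fin n) ℂ) : u * uᵀ ∈ unitaryGroup (Fin n) ℂ := by
  refine mul_mem hu ?_
  rw [mem_unitaryGroup_iff]
  have h := congrArg transpose (conjTranspose_mul_self_of_mem hu)
  rw [transpose_mul, transpose_one] at h
  exact h

theorem relUnitary_mem {n : ℕ} {u v : Matrix (Fin n) (Fin n) ℂ}
    (hu : u ∈ unitaryGroup (Fin n) ℂ) (hv : v ∈ unitaryGroup (Fin n) ℂ) :
    relUnitary u v ∈ unitaryGroup (Fin n) ℂ :=
  mul_mem (mul_transpose_mem hv) (Unitary.star_mem (mul_transpose_mem hu))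

theorem det_relUnitary {n : ℕ} (u v : Matrix (Fin n) (Fin n) ℂ) :
    (relUnitary u v).det = v.det ^ 2 * star (u.det ^ 2) := by
  simp only [relUnitary, det_mul, det_transpose, det_conjTranspose]
  ring_nf

theorem mulVec_conjTranspose_eq_star {n : ℕ} {u : Matrix (Fin n) (Fin n) ℂ}
    (z : Fin n → ℂ) : (u * uᵀ)ᴴ *ᵥ z = star ((u * uᵀ) *ᵥ star z) := by
  rw [star_mulVec_map, star_star]
  congr 1
  ext i j
  simp [Matrix.mul_apply, mul_comm]

/-- If `exp (2 i α)` is an eigenvalue of `relUnitary u v`, then rotation by the angle `α` carries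
some vector of the first plane into the second one. -/
theorem exists_mem_colSpan_of_det_eq_zero {n : ℕ} {u v : Matrix (Fin n) (Fin n) ℂ}
    (hu : u ∈ unitaryGroup (Fin n) ℂ) (hv : v ∈ unitaryGroup (Fin n) ℂ) (α : ℝ)
    (h : (relUnitary u v - Complex.exp (2 * α * Complex.I) • (1 : Matrix (Fin n) (Fin n) ℂ)).det
      = 0) :
    ∃ x, x ≠ 0 ∧ x ∈ colSpan u ∧ Complex.exp (α * Complex.I) • x ∈ colSpan v := by
  set e := Complex.exp (2 * α * Complex.I) with he
  obtain ⟨y, hy0, hy⟩ := exists_mulVec_eq_zero_iff.2 h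
  set P := u * uᵀ with hP
  set Q := v * vᵀ with hQ
  have hPu : Pᴴ * P = 1 := conjTranspose_mul_self_of_mem (mul_transpose_mem hu)
  have hPu' : P * Pᴴ = 1 := mul_conjTranspose_self_of_mem (mul_transpose_mem hu)
  have hQu' : Q * Qᴴ = 1 := mul_conjTranspose_self_of_mem (mul_transpose_mem hv)
  have hPc : ∀ z, Pᴴ *ᵥ z = star (P *ᵥ star z) := mulVec_conjTranspose_eq_star
  have hQc : ∀ z, Qᴴ *ᵥ z = star (Q *ᵥ star z) := mulVec_conjTranspose_eq_star
  have hee : star e * e = 1 := by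
    have h1 : star e = Complex.exp (-(2 * α * Complex.I)) := by
      rw [he, Complex.star_def, ← Complex.exp_conj]
      congr 1
      simp only [map_mul, Complex.conj_I, Complex.conj_ofReal, map_ofNat, mul_neg]
    rw [h1, he, ← Complex.exp_add]
    simp
  -- the kernel of `Q - e P` is invariant under the antilinear involution `ζ ↦ star (P ζ)`, so it
  -- contains a fixed vector of the involution
  have hinv : ∀ ζ, Q *ᵥ ζ = e • P *ᵥ ζ → Q *ᵥ star (P *ᵥ ζ) = e • P *ᵥ star (P *ᵥ ζ) := by
    intro ζ hζ
    have h1 : star (P *ᵥ ζ) = e • star (Q *ᵥ ζ) := by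
      rw [hζ, star_smul, smul_smul, mul_comm, hee, one_smul]
    have h2 : P *ᵥ star (P *ᵥ ζ) = star ζ := by
      have := hPc (star ζ)
      rw [star_star] at this
      rw [← this, mulVec_mulVec, hPu', one_mulVec]
    have h3 : Q *ᵥ star (Q *ᵥ ζ) = star ζ := by
      have := hQc (star ζ)
      rw [star_star] at this
      rw [← this, mulVec_mulVec, hQu', one_mulVec]
    rw [h2, h1, mulVec_smul, h3]
  have hτ : ∀ ζ, star (P *ᵥ star (P *ᵥ ζ)) = ζ := by
    intro ζ
    rw [← hPc, mulVec_mulVec, hPu, one_mulVec]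
  obtain ⟨ζ, hζ0, hζ, hfix⟩ : ∃ ζ, ζ ≠ 0 ∧ Q *ᵥ ζ = e • P *ᵥ ζ ∧ star (P *ᵥ ζ) = ζ := by
    have hζ : Q *ᵥ (Pᴴ *ᵥ y) = e • P *ᵥ (Pᴴ *ᵥ y) := by
      rw [sub_mulVec, smul_mulVec, one_mulVec, sub_eq_zero] at hy
      rw [mulVec_mulVec, mulVec_mulVec, hPu', one_mulVec]
      exact hy
    have hζ0 : Pᴴ *ᵥ y ≠ 0 := by
      intro h0
      apply hy0
      have := congrArg (P *ᵥ ·) h0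
      simpa [mulVec_mulVec, hPu'] using this
    set ζ := Pᴴ *ᵥ y
    by_cases hs : ζ + star (P *ᵥ ζ) = 0
    · refine ⟨Complex.I • ζ, ?_, ?_, ?_⟩
      · simpa using hζ0
      · rw [mulVec_smul, mulVec_smul, hζ, smul_comm]
      · rw [mulVec_smul, star_smul, eq_neg_of_add_eq_zero_right hs]
        simp
    · refine ⟨ζ + star (P *ᵥ ζ), hs, ?_, ?_⟩
      · rw [mulVec_add, mulVec_add, smul_add, hζ, hinv ζ hζ]
      · rw [mulVec_add, star_add, hτ, add_comm]
  refine ⟨star ζ, by simpa using hζ0, ?_, ?_⟩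
  · rw [mem_colSpan_iff hu, star_star]
    exact (star_eq_iff_star_eq.1 hfix).symm
  · rw [mem_colSpan_iff hv, star_smul, star_star, mulVec_smul, hζ, smul_smul,
      (star_eq_iff_star_eq.1 hfix).symm]
    congr 1
    rw [he, Complex.star_def, ← Complex.exp_conj, ← Complex.exp_add]
    congr 1
    simp
    ring

/-- If two lagrangian planes meet, then `1` is an eigenvalue of `relUnitary u v`. -/
theorem det_relUnitary_sub_one_eq_zero {n : ℕ} {u v : Matrix (Fin n) (Fin n) ℂ}
    (hu : u ∈ unitaryGroup (Fin n) ℂ) (hv : v ∈ unitaryGroup (Fin n) ℂ) {x : Fin n → ℂ}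
    (hx : x ≠ 0) (hxu : x ∈ colSpan u) (hxv : x ∈ colSpan v) :
    (relUnitary u v - 1).det = 0 := by
  rw [← exists_mulVec_eq_zero_iff]
  refine ⟨x, hx, ?_⟩
  rw [mem_colSpan_iff hu] at hxu
  rw [mem_colSpan_iff hv] at hxv
  rw [sub_mulVec, one_mulVec, relUnitary, ← mulVec_mulVec, mulVec_conjTranspose_eq_star, hxu, hxv,
    sub_self]

/-- `u uᵀ` depends continuously on the plane `colSpan u`, that is, it is continuous when the plane
has a continuous frame (the unitary matrices `u` themselves need not be continuous). -/
theorem continuousAt_mul_transpose {n : ℕ} {X : Type*} [TopologicalSpace X]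
    {u : X → Matrix (Fin n) (Fin n) ℂ}
    (hu : ∀ t, u t ∈ unitaryGroup (Fin n) ℂ) {t₀ : X} (f : X → Fin n → Fin n → ℂ)
    (hf : ContinuousAt f t₀) (hfu : ∀ᶠ t in 𝓝 t₀, ∀ i, f t i ∈ colSpan (u t))
    (hli : LinearIndependent ℝ (f t₀)) :
    ContinuousAt (fun t => u t * (u t)ᵀ) t₀ := by
  set Y : X → Matrix (Fin n) (Fin n) ℂ := fun t => (of (f t))ᵀ with hY
  have hYc : ContinuousAt Y t₀ := by
    have : Continuous fun g : Fin n → Fin n → ℂ => (of g)ᵀ := by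
      refine continuous_matrix fun i j => ?_
      simp only [transpose_apply, of_apply]
      fun_prop
    exact this.continuousAt.comp hf
  have hrel : ∀ t, (∀ i, f t i ∈ colSpan (u t)) → u t * (u t)ᵀ * (Y t).map star = Y t := by
    intro t ht
    ext i j
    have := congrFun ((mem_colSpan_iff (hu t) (f t j)).1 (ht j)) i
    rw [mul_apply]
    exact this
  -- a lagrangian plane is totally real: a real basis of it is a complex basis of `ℂⁿ`
  have hdet : (Y t₀).det ≠ 0 := by
    have h0 : ∀ r : Fin n → ℝ, Y t₀ *ᵥ (fun i => (r i : ℂ)) = 0 → r = 0 := by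
      intro r hr
      have h1 := Fintype.linearIndependent_iff.1 hli r (by
        rw [← hr]
        ext j
        simp [hY, mulVec, dotProduct, mul_comm])
      exact funext h1
    intro hd
    obtain ⟨y, hy0, hy⟩ := exists_mulVec_eq_zero_iff.2 hd
    have hrt := hrel t₀ hfu.self_of_nhds
    have hreal : ∀ r : Fin n → ℝ, (u t₀ * (u t₀)ᵀ) *ᵥ star (Y t₀ *ᵥ fun i => (r i : ℂ)) =
        Y t₀ *ᵥ fun i => (r i : ℂ) := by
      intro r
      rw [star_mulVec_map, mulVec_mulVec, hrt]
      congr 1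
      ext i
      simp
    set a : Fin n → ℂ := Y t₀ *ᵥ fun i => ((y i).re : ℂ) with ha
    set b : Fin n → ℂ := Y t₀ *ᵥ fun i => ((y i).im : ℂ) with hb
    have hab : a = -(Complex.I • b) := by
      rw [eq_neg_iff_add_eq_zero, ha, hb, ← mulVec_smul, ← mulVec_add, ← hy]
      congr 1
      ext i
      simp [mul_comm Complex.I]
    have hra := hreal fun i => (y i).re
    have hrb := hreal fun i => (y i).im
    rw [← ha] at hra
    rw [← hb] at hrb
    have haa : a = -a := by
      conv_lhs => rw [← hra, hab]
      rw [star_neg, star_smul, mulVec_neg, mulVec_smul, hrb, hab]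
      simp
    have ha0 : a = 0 := self_eq_neg.1 haa
    have hb0 : b = 0 := by
      rw [ha0, zero_eq_neg] at hab
      simpa using hab
    apply hy0
    have h1 := h0 _ ha0
    have h2 := h0 _ hb0
    ext i
    exact Complex.ext (congrFun h1 i) (congrFun h2 i)
  have hdc : ((Y t₀).map star).det ≠ 0 := by
    have : ((Y t₀).map star).det = star (Y t₀).det := by
      rw [← det_conjTranspose, ← det_transpose]
      rfl
    rw [this]
    simpa using hdet
  have hZ : ContinuousAt (fun t => (Y t).map star) t₀ :=
    (continuous_id.matrix_map continuous_star).continuousAt.comp hYc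
  have hdZ : ContinuousAt (fun t => ((Y t).map star).det) t₀ :=
    (continuous_id.matrix_det).continuousAt.comp hZ
  have hadj : ContinuousAt (fun t => ((Y t).map star).adjugate) t₀ :=
    (continuous_id.matrix_adjugate).continuousAt.comp hZ
  have hmain : ContinuousAt
      (fun t => ((Y t).map star).det⁻¹ • (Y t * ((Y t).map star).adjugate)) t₀ := by
    refine (hdZ.inv₀ hdc).smul ?_
    have hmul : Continuous fun p : Matrix (Fin n) (Fin n) ℂ × Matrix (Fin n) (Fin n) ℂ =>
        p.1 * p.2 := continuous_fst.matrix_mul continuous_snd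
    exact ContinuousAt.comp (f := fun t => (Y t, ((Y t).map star).adjugate))
      hmul.continuousAt (hYc.prodMk hadj)
  refine hmain.congr ?_
  filter_upwards [hfu, hdZ.eventually_ne hdc] with t ht htd
  have h1 := congrArg (· * ((Y t).map star).adjugate) (hrel t ht)
  simp only [Matrix.mul_assoc _ ((Y t).map star), mul_adjugate] at h1
  rw [← h1, Matrix.mul_smul, Matrix.mul_one, smul_smul, inv_mul_cancel₀ htd, one_smul]
end

/-! ### Sums of eigenvalue angles of unitary matrices -/

section
open Matrix Filter

/-- The characteristic polynomial of a complex matrix splits, in homogeneous form. -/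
theorem exists_det_smul_one_add_smul_eq_prod {n : ℕ} (W : Matrix (Fin n) (Fin n) ℂ) :
    ∃ w : Fin n → ℂ, ∀ a b : ℂ, (a • (1 : Matrix (Fin n) (Fin n) ℂ) + b • W).det =
      ∏ i, (a + b * w i) := by
  have hsp := IsAlgClosed.splits W.charpoly
  have hcard : W.charpoly.roots.card = n := by
    rw [← hsp.natDegree_eq_card_roots, charpoly_natDegree_eq_dim, Fintype.card_fin]
  have hlen : W.charpoly.roots.toList.length = n := by rw [Multiset.length_toList, hcard]
  have hroots : ∃ w : Fin n → ℂ, W.charpoly.roots = Multiset.map w Finset.univ.val := by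
    obtain ⟨l, hl⟩ : ∃ l, l = W.charpoly.roots.toList := ⟨_, rfl⟩
    rw [← hl] at hlen
    subst hlen
    refine ⟨l.get, ?_⟩
    rw [← Multiset.coe_toList W.charpoly.roots, ← hl, Fin.univ_val_map, List.ofFn_get]
  obtain ⟨w, hw⟩ := hroots
  refine ⟨w, fun a b => ?_⟩
  have hev : ∀ t : ℂ, (t • (1 : Matrix (Fin n) (Fin n) ℂ) - W).det = ∏ i, (t - w i) := by
    intro t
    have h1 := eval_charpoly W t
    rw [hsp.eq_prod_roots_of_monic W.charpoly_monic, hw] at h1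
    rw [smul_one_eq_diagonal, ← scalar_apply, ← h1, Multiset.map_map, Polynomial.eval_multiset_prod,
      Multiset.map_map]
    simp only [Function.comp_apply, Polynomial.eval_sub, Polynomial.eval_X, Polynomial.eval_C]
    rfl
  rcases eq_or_ne b 0 with rfl | hb
  · simp
  · have h1 : a • (1 : Matrix (Fin n) (Fin n) ℂ) + b • W =
        (-b) • ((-(a / b)) • (1 : Matrix (Fin n) (Fin n) ℂ) - W) := by
      rw [smul_sub, smul_smul, neg_smul b W, sub_neg_eq_add]
      congr 2
      field_simp
    rw [h1, det_smul, hev, Fintype.card_fin]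
    have h2 : ∀ i, a + b * w i = (-b) * (-(a / b) - w i) := fun i => by field_simp; ring
    simp_rw [h2]
    rw [Finset.prod_mul_distrib]
    simp

/-- The determinant as a function on `Fin n → Fin n → ℂ`, which, unlike the type of matrices, is a
normed space. -/
def detFun (n : ℕ) (M : Fin n → Fin n → ℂ) : ℂ := (of M).det

theorem contDiff_detFun (n : ℕ) : ContDiff ℂ ∞ (detFun n) := by
  have : detFun n = fun M : Fin n → Fin n → ℂ =>
      ∑ σ : Equiv.Perm (Fin n), ((Equiv.Perm.sign σ : ℤ) : ℂ) * ∏ i, M (σ i) i := by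
    ext M
    simp [detFun, det_apply']
  rw [this]
  fun_prop

/-- The identity matrix, as an element of the same normed space. -/
def oneFun (n : ℕ) : Fin n → Fin n → ℂ := (1 : Matrix (Fin n) (Fin n) ℂ)

/-- The segment from the identity matrix to `Z`. -/
def segOne {n : ℕ} (Z : Fin n → Fin n → ℂ) (s : ℝ) : Fin n → Fin n → ℂ :=
  oneFun n + (s : ℂ) • (Z - oneFun n)

theorem continuous_segOne {n : ℕ} :
    Continuous fun p : (Fin n → Fin n → ℂ) × ℝ => segOne p.1 p.2 := by
  unfold segOne
  fun_prop

/-- The branch of `log det Z` that is obtained by continuation of `log det` from the identity to `Z`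
along a segment. Its continuity in `Z` is immediate, and needs no continuous choice of the
eigenvalues; it is meaningful if the determinant has no zero on the segment. -/
def logDet {n : ℕ} (Z : Fin n → Fin n → ℂ) : ℂ :=
  ∫ s in (0 : ℝ)..1, fderiv ℂ (detFun n) (segOne Z s) (Z - oneFun n) /
    detFun n (segOne Z s)

theorem continuousOn_logDet (n : ℕ) : ContinuousOn (logDet (n := n))
    {Z | ∀ s ∈ Set.Icc (0 : ℝ) 1, detFun n (segOne Z s) ≠ 0} := by
  rw [continuousOn_iff_continuous_domRestrict]
  set U := {Z : Fin n → Fin n → ℂ | ∀ s ∈ Set.Icc (0 : ℝ) 1, detFun n (segOne Z s) ≠ 0} with hU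
  have hc := (contDiff_detFun n).continuous
  have hf := (contDiff_detFun n).continuous_fderiv (by simp)
  have hseg : Continuous fun p : U × ℝ => segOne (p.1 : Fin n → Fin n → ℂ)
      (Set.projIcc (0 : ℝ) 1 zero_le_one p.2 : ℝ) :=
    continuous_segOne.comp (f := fun p : U × ℝ => ((p.1 : Fin n → Fin n → ℂ),
      (Set.projIcc (0 : ℝ) 1 zero_le_one p.2 : ℝ)))
      ((continuous_subtype_val.comp continuous_fst).prodMk
      (continuous_subtype_val.comp (continuous_projIcc.comp continuous_snd)))
  have hcont : Continuous (Function.uncurry fun (Z : U) (s : ℝ) =>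
      fderiv ℂ (detFun n) (segOne Z (Set.projIcc (0 : ℝ) 1 zero_le_one s : ℝ))
        (Z - oneFun n) /
      detFun n (segOne Z (Set.projIcc (0 : ℝ) 1 zero_le_one s : ℝ))) := by
    refine Continuous.div ?_ (hc.comp hseg) fun p => p.1.2 _ (Set.projIcc (0 : ℝ) 1 _ p.2).2
    exact (hf.comp hseg).clm_apply ((continuous_subtype_val.comp continuous_fst).sub
      continuous_const)
  refine (intervalIntegral.continuous_parametric_intervalIntegral_of_continuous'
    (μ := MeasureTheory.volume) hcont 0 1).congr fun Z => ?_
  refine intervalIntegral.integral_congr fun s hs => ?_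
  rw [Set.uIcc_of_le zero_le_one] at hs
  simp only [Set.projIcc_of_mem zero_le_one hs]

theorem one_add_mul_mem_slitPlane {z : ℂ} (hz : z ∈ Complex.slitPlane) {s : ℝ}
    (hs : s ∈ Set.Icc (0 : ℝ) 1) : 1 + s * (z - 1) ∈ Complex.slitPlane := by
  have := Complex.starConvex_one_slitPlane hz (sub_nonneg.2 hs.2) hs.1 (by ring)
  convert this using 1
  rw [Complex.real_smul, Complex.real_smul]
  push_cast
  ring

/-- `logDet` is the sum of the principal logarithms of the eigenvalues. -/
theorem logDet_eq_sum_log {n : ℕ} (Z : Fin n → Fin n → ℂ) (z : Fin n → ℂ)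
    (hz : ∀ i, z i ∈ Complex.slitPlane)
    (h : ∀ s : ℝ, detFun n (segOne Z s) = ∏ i, (1 + s * (z i - 1))) :
    logDet Z = ∑ i, Complex.log (z i) := by
  have hmem : ∀ s ∈ Set.uIcc (0 : ℝ) 1, ∀ i, 1 + s * (z i - 1) ∈ Complex.slitPlane := by
    intro s hs i
    rw [Set.uIcc_of_le zero_le_one] at hs
    exact one_add_mul_mem_slitPlane (hz i) hs
  have hlin : ∀ (i : Fin n) (s : ℝ),
      HasDerivAt (fun s : ℝ => 1 + (s : ℂ) * (z i - 1)) (z i - 1) s := by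
    intro i s
    simpa using! ((Complex.ofRealCLM.hasDerivAt (x := s)).mul_const (z i - 1)).const_add 1
  have hL : ∀ s ∈ Set.uIcc (0 : ℝ) 1, HasDerivAt
      (fun s : ℝ => ∑ i, Complex.log (1 + (s : ℂ) * (z i - 1)))
      (∑ i, (z i - 1) / (1 + (s : ℂ) * (z i - 1))) s := by
    intro s hs
    refine HasDerivAt.fun_sum fun i _ => ?_
    exact (hlin i s).clog_real (hmem s hs i)
  have hcont : ContinuousOn (fun s : ℝ => ∑ i, (z i - 1) / (1 + (s : ℂ) * (z i - 1)))
      (Set.uIcc 0 1) := by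
    refine continuousOn_finsetSum _ fun i _ => ?_
    refine ContinuousOn.div continuousOn_const (by fun_prop) fun s hs => ?_
    exact Complex.slitPlane_ne_zero (hmem s hs i)
  have hint := intervalIntegral.integral_eq_sub_of_hasDerivAt hL hcont.intervalIntegrable
  have hexp : ∀ s ∈ Set.uIcc (0 : ℝ) 1,
      Complex.exp (∑ i, Complex.log (1 + (s : ℂ) * (z i - 1))) = detFun n (segOne Z s) := by
    intro s hs
    rw [Complex.exp_sum, h]
    exact Finset.prod_congr rfl fun i _ =>
      Complex.exp_log (Complex.slitPlane_ne_zero (hmem s hs i))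
  have hd : ∀ s : ℝ, HasDerivAt (fun s : ℝ => detFun n (segOne Z s))
      (fderiv ℂ (detFun n) (segOne Z s) (Z - oneFun n)) s := by
    intro s
    have h1 : HasDerivAt (segOne Z) (Z - oneFun n) s := by
      unfold segOne
      simpa using! ((Complex.ofRealCLM.hasDerivAt (x := s)).smul_const
        (Z - oneFun n : Fin n → Fin n → ℂ)).const_add
        (oneFun n)
    have h2 : HasFDerivAt (detFun n) (fderiv ℂ (detFun n) (segOne Z s)) (segOne Z s) :=
      ((contDiff_detFun n).differentiable (by simp) _).hasFDerivAt
    have h3 := (h2.restrictScalars ℝ).comp_hasDerivAt s h1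
    exact h3
  have heq : ∀ s ∈ Set.uIcc (0 : ℝ) 1,
      fderiv ℂ (detFun n) (segOne Z s) (Z - oneFun n) /
        detFun n (segOne Z s) = ∑ i, (z i - 1) / (1 + (s : ℂ) * (z i - 1)) := by
    intro s hs
    have hne : detFun n (segOne Z s) ≠ 0 := by
      rw [← hexp s hs]
      exact Complex.exp_ne_zero _
    rw [div_eq_iff hne, mul_comm]
    have h1 : HasDerivAt (fun s : ℝ => ∏ i, (1 + (s : ℂ) * (z i - 1)))
        (detFun n (segOne Z s) * ∑ i, (z i - 1) / (1 + (s : ℂ) * (z i - 1))) s := by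
      have h2 := HasDerivAt.fun_finsetProd (u := Finset.univ) (x := s)
        (f := fun i (s : ℝ) => 1 + (s : ℂ) * (z i - 1)) (f' := fun i => z i - 1) fun i _ => hlin i s
      refine h2.congr_deriv (Eq.symm ?_)
      rw [h s, Finset.mul_sum]
      refine Finset.sum_congr rfl fun i hi => ?_
      rw [← Finset.mul_prod_erase _ _ hi, smul_eq_mul]
      have := Complex.slitPlane_ne_zero (hmem s hs i)
      field_simp
    exact (hd s).unique (h1.congr_of_eventuallyEq (Eventually.of_forall h))
  rw [logDet, intervalIntegral.integral_congr heq, hint]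
  simp

theorem segOne_smul {n : ℕ} (c : ℂ) (W : Matrix (Fin n) (Fin n) ℂ) (s : ℝ) :
    (segOne (c • W : Matrix (Fin n) (Fin n) ℂ) s : Matrix (Fin n) (Fin n) ℂ) =
      (1 - s : ℂ) • (1 : Matrix (Fin n) (Fin n) ℂ) + (s * c) • W := by
  have : (segOne (c • W : Matrix (Fin n) (Fin n) ℂ) s : Matrix (Fin n) (Fin n) ℂ) =
      (1 : Matrix (Fin n) (Fin n) ℂ) + (s : ℂ) • (c • W - (1 : Matrix (Fin n) (Fin n) ℂ)) := rfl
  rw [this, sub_smul, one_smul, smul_sub, smul_smul]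
  abel

open scoped ComplexOrder in
/-- The eigenvalues of a unitary matrix have norm `1`. -/
theorem norm_eq_one_of_det_eq_prod {n : ℕ} {W : Matrix (Fin n) (Fin n) ℂ}
    (hW : W ∈ unitaryGroup (Fin n) ℂ) {w : Fin n → ℂ}
    (hw : ∀ a b : ℂ, (a • (1 : Matrix (Fin n) (Fin n) ℂ) + b • W).det = ∏ i, (a + b * w i))
    (i : Fin n) : ‖w i‖ = 1 := by
  have h0 : (w i • (1 : Matrix (Fin n) (Fin n) ℂ) + (-1 : ℂ) • W).det = 0 := by
    rw [hw, Finset.prod_eq_zero (Finset.mem_univ i)]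
    ring
  obtain ⟨x, hx0, hx⟩ := exists_mulVec_eq_zero_iff.2 h0
  have hx' : W *ᵥ x = w i • x := by
    rw [add_mulVec, smul_mulVec, smul_mulVec, one_mulVec, neg_one_smul, ← sub_eq_add_neg,
      sub_eq_zero] at hx
    exact hx.symm
  have h1 : star (W *ᵥ x) ⬝ᵥ (W *ᵥ x) = star x ⬝ᵥ x := by
    rw [star_mulVec, ← dotProduct_mulVec, mulVec_mulVec, conjTranspose_mul_self_of_mem hW,
      one_mulVec]
  rw [hx', star_smul, smul_dotProduct, dotProduct_smul, smul_smul] at h1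
  have hxx : star x ⬝ᵥ x ≠ 0 := by
    rwa [Ne, dotProduct_star_self_eq_zero]
  have h2 : star (w i) * w i = 1 := by
    have := mul_right_cancel₀ hxx (h1.trans (one_mul _).symm)
    exact this
  have h3 : ‖w i‖ * ‖w i‖ = 1 := by
    have := congrArg norm h2
    rwa [norm_mul, norm_star, norm_one] at this
  nlinarith [norm_nonneg (w i)]

/-- The sum of the angles, measured from `-1` and taken in `(-π, π)`, of the eigenvalues of the
unitary matrix `exp (-2 i α) W`. It is used where `1` is not an eigenvalue of this matrix. -/
def angleSum {n : ℕ} (W : Matrix (Fin n) (Fin n) ℂ) (α : ℝ) : ℝ :=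
  (logDet (-Complex.exp (-(2 * α * Complex.I)) • W : Matrix (Fin n) (Fin n) ℂ)).im

/-- `exp (2 i α)` is not an eigenvalue of `W`. -/
def RegularAngle {n : ℕ} (W : Matrix (Fin n) (Fin n) ℂ) (α : ℝ) : Prop :=
  (W - Complex.exp (2 * α * Complex.I) • (1 : Matrix (Fin n) (Fin n) ℂ)).det ≠ 0

theorem mem_slitPlane_of_norm_eq_one {z : ℂ} (hz : ‖z‖ = 1) (h : z ≠ -1) :
    z ∈ Complex.slitPlane := by
  by_contra hcon
  rw [Complex.mem_slitPlane_iff_not_le_zero, not_not] at hcon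
  apply h
  obtain ⟨h1, h2⟩ := Complex.le_def.1 hcon
  simp only [Complex.zero_re, Complex.zero_im] at h1 h2
  have h3 : z = (z.re : ℂ) := Complex.ext (by simp) (by simp [h2])
  rw [h3, Complex.norm_real, Real.norm_eq_abs, abs_of_nonpos h1] at hz
  rw [h3, show z.re = -1 by linarith]
  simp

theorem regularAngle_iff {n : ℕ} {W : Matrix (Fin n) (Fin n) ℂ} {w : Fin n → ℂ}
    (hw : ∀ a b : ℂ, (a • (1 : Matrix (Fin n) (Fin n) ℂ) + b • W).det = ∏ i, (a + b * w i))
    (α : ℝ) : RegularAngle W α ↔ ∀ i, w i ≠ Complex.exp (2 * α * Complex.I) := by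
  have h1 : W - Complex.exp (2 * α * Complex.I) • (1 : Matrix (Fin n) (Fin n) ℂ) =
      (-Complex.exp (2 * α * Complex.I)) • (1 : Matrix (Fin n) (Fin n) ℂ) + (1 : ℂ) • W := by
    module
  rw [RegularAngle, h1, hw, Finset.prod_ne_zero_iff]
  refine forall_congr' fun i => ?_
  simp only [Finset.mem_univ, forall_const, one_mul]
  rw [Ne, neg_add_eq_zero, eq_comm]

theorem neg_exp_mul_mem_slitPlane {z : ℂ} (hz : ‖z‖ = 1) {α : ℝ}
    (h : z ≠ Complex.exp (2 * α * Complex.I)) :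
    -Complex.exp (-(2 * α * Complex.I)) * z ∈ Complex.slitPlane := by
  refine mem_slitPlane_of_norm_eq_one ?_ fun h1 => h ?_
  · have : -(2 * α * Complex.I) = ((-(2 * α) : ℝ) : ℂ) * Complex.I := by push_cast; ring
    rw [norm_mul, norm_neg, this, Complex.norm_exp_ofReal_mul_I, hz, one_mul]
  · rw [neg_mul, neg_inj] at h1
    rw [← mul_one (Complex.exp (2 * α * Complex.I)), ← h1, ← mul_assoc, ← Complex.exp_add]
    simp

theorem logDet_smul_eq_sum {n : ℕ} {W : Matrix (Fin n) (Fin n) ℂ} {w : Fin n → ℂ}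
    (hw : ∀ a b : ℂ, (a • (1 : Matrix (Fin n) (Fin n) ℂ) + b • W).det = ∏ i, (a + b * w i))
    (c : ℂ) (hc : ∀ i, c * w i ∈ Complex.slitPlane) :
    logDet (c • W : Matrix (Fin n) (Fin n) ℂ) = ∑ i, Complex.log (c * w i) := by
  refine logDet_eq_sum_log _ _ hc fun s => ?_
  have h1 : detFun n (segOne (c • W : Matrix (Fin n) (Fin n) ℂ) s) =
    ((1 - s : ℂ) • (1 : Matrix (Fin n) (Fin n) ℂ) + (s * c) • W).det := by
      rw [← segOne_smul]; rfl
  rw [h1, hw]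
  refine Finset.prod_congr rfl fun i _ => by ring

theorem angleSum_eq_sum {n : ℕ} {W : Matrix (Fin n) (Fin n) ℂ}
    (hW : W ∈ unitaryGroup (Fin n) ℂ) {w : Fin n → ℂ}
    (hw : ∀ a b : ℂ, (a • (1 : Matrix (Fin n) (Fin n) ℂ) + b • W).det = ∏ i, (a + b * w i))
    {α : ℝ} (h : RegularAngle W α) :
    angleSum W α = ∑ i, Complex.arg (-Complex.exp (-(2 * α * Complex.I)) * w i) := by
  rw [angleSum, logDet_smul_eq_sum hw _ fun i => neg_exp_mul_mem_slitPlane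
    (norm_eq_one_of_det_eq_prod hW hw i) ((regularAngle_iff hw α).1 h i), Complex.im_sum]
  simp_rw [Complex.log_im]

theorem exp_angleSum {n : ℕ} {W : Matrix (Fin n) (Fin n) ℂ}
    (hW : W ∈ unitaryGroup (Fin n) ℂ) {α : ℝ} (h : RegularAngle W α) :
    Complex.exp (angleSum W α * Complex.I) =
      (-Complex.exp (-(2 * α * Complex.I))) ^ n * W.det := by
  obtain ⟨w, hw⟩ := exists_det_smul_one_add_smul_eq_prod W
  have h1 := hw 0 (-Complex.exp (-(2 * α * Complex.I)))
  rw [zero_smul, zero_add, det_smul, Fintype.card_fin] at h1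
  rw [h1, angleSum_eq_sum hW hw h]
  push_cast
  rw [Finset.sum_mul, Complex.exp_sum]
  refine Finset.prod_congr rfl fun i _ => ?_
  rw [zero_add]
  set z := -Complex.exp (-(2 * α * Complex.I)) * w i with hz
  have hn : ‖z‖ = 1 := by
    have : -(2 * α * Complex.I) = ((-(2 * α) : ℝ) : ℂ) * Complex.I := by push_cast; ring
    rw [hz, norm_mul, norm_neg, this, Complex.norm_exp_ofReal_mul_I,
      norm_eq_one_of_det_eq_prod hW hw i, one_mul]
  have := Complex.norm_mul_exp_arg_mul_I z
  rwa [hn, Complex.ofReal_one, one_mul] at this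

theorem continuousOn_angleSum {n : ℕ} : ContinuousOn
    (fun p : Matrix (Fin n) (Fin n) ℂ × ℝ => angleSum p.1 p.2)
    {p | p.1 ∈ unitaryGroup (Fin n) ℂ ∧ RegularAngle p.1 p.2} := by
  refine Complex.continuous_im.comp_continuousOn ?_
  refine (continuousOn_logDet n).comp (t := {Z | ∀ s ∈ Set.Icc (0 : ℝ) 1,
    detFun n (segOne Z s) ≠ 0}) (f := fun p : Matrix (Fin n) (Fin n) ℂ × ℝ =>
      (-Complex.exp (-(2 * p.2 * Complex.I)) • p.1 : Matrix (Fin n) (Fin n) ℂ)) ?_ ?_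
  · have : Continuous fun p : Matrix (Fin n) (Fin n) ℂ × ℝ =>
      (-Complex.exp (-(2 * p.2 * Complex.I)) • p.1 : Matrix (Fin n) (Fin n) ℂ) := by fun_prop
    exact this.continuousOn
  · rintro ⟨W, α⟩ ⟨hW, hα⟩ s hs
    obtain ⟨w, hw⟩ := exists_det_smul_one_add_smul_eq_prod W
    have h1 : detFun n (segOne (-Complex.exp (-(2 * α * Complex.I)) • W :
        Matrix (Fin n) (Fin n) ℂ) s) = ((1 - s : ℂ) • (1 : Matrix (Fin n) (Fin n) ℂ) +
        (s * -Complex.exp (-(2 * α * Complex.I))) • W).det := by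
      rw [← segOne_smul]; rfl
    rw [h1, hw, Finset.prod_ne_zero_iff]
    intro i _
    have h2 := Complex.slitPlane_ne_zero (one_add_mul_mem_slitPlane (neg_exp_mul_mem_slitPlane
      (norm_eq_one_of_det_eq_prod hW hw i) ((regularAngle_iff hw α).1 hα i)) hs)
    intro h3
    apply h2
    rw [← h3]
    ring

/-- Each eigenvalue `1` makes the sum of the angles jump by `2 π` at the angle `0`, while the other
eigenvalues contribute continuously. -/
theorem eventually_pi_lt_angleSum_sub {n : ℕ} {W : Matrix (Fin n) (Fin n) ℂ}
    (hW : W ∈ unitaryGroup (Fin n) ℂ) (h0 : ¬ RegularAngle W 0)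
    (h : ∀ᶠ α in 𝓝[>] (0 : ℝ), RegularAngle W α ∧ RegularAngle W (-α)) :
    ∀ᶠ α in 𝓝[>] (0 : ℝ), Real.pi < angleSum W α - angleSum W (-α) := by
  obtain ⟨w, hw⟩ := exists_det_smul_one_add_smul_eq_prod W
  have hlim : ∀ i, Tendsto (fun α : ℝ =>
      Complex.arg (-Complex.exp (-(2 * α * Complex.I)) * w i) -
      Complex.arg (-Complex.exp (-(2 * (-α : ℝ) * Complex.I)) * w i)) (𝓝[>] 0)
      (𝓝 (if w i = 1 then 2 * Real.pi else 0)) := by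
    intro i
    split_ifs with hi
    · have h1 : ∀ᶠ α : ℝ in 𝓝[>] (0 : ℝ), 2 * Real.pi - 4 * α =
          Complex.arg (-Complex.exp (-(2 * α * Complex.I)) * w i) -
          Complex.arg (-Complex.exp (-(2 * (-α : ℝ) * Complex.I)) * w i) := by
        filter_upwards [Ioo_mem_nhdsGT Real.pi_pos] with α hα
        have e1 : -Complex.exp (-(2 * α * Complex.I)) * w i =
            Complex.exp ((Real.pi - 2 * α : ℝ) * Complex.I) := by
          rw [hi, mul_one, ← neg_one_mul, ← Complex.exp_pi_mul_I, ← Complex.exp_add]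
          congr 1
          push_cast
          ring
        have e2 : -Complex.exp (-(2 * (-α : ℝ) * Complex.I)) * w i =
            Complex.exp ((-Real.pi + 2 * α : ℝ) * Complex.I) := by
          rw [hi, mul_one, ← neg_one_mul, ← Complex.exp_neg_pi_mul_I, ← Complex.exp_add]
          congr 1
          push_cast
          ring
        rw [e1, e2, Complex.arg_exp_mul_I, Complex.arg_exp_mul_I,
          (toIocMod_eq_self _).2 ⟨by linarith [hα.2], by linarith [hα.1]⟩,
          (toIocMod_eq_self _).2 ⟨by linarith [hα.1], by linarith [hα.2]⟩]
        ring
      refine Tendsto.congr' h1 ?_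
      have : Continuous fun α : ℝ => 2 * Real.pi - 4 * α := by fun_prop
      simpa using! (this.tendsto 0).mono_left nhdsWithin_le_nhds
    · have h1 : -Complex.exp (-(2 * (0 : ℝ) * Complex.I)) * w i ∈ Complex.slitPlane :=
        neg_exp_mul_mem_slitPlane (norm_eq_one_of_det_eq_prod hW hw i) (by simpa using hi)
      have h2 : ContinuousAt (fun α : ℝ =>
          Complex.arg (-Complex.exp (-(2 * α * Complex.I)) * w i)) 0 := by
        refine ContinuousAt.comp (f := fun α : ℝ => -Complex.exp (-(2 * α * Complex.I)) * w i)
          (Complex.continuousAt_arg h1) ?_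
        fun_prop
      have h3 : ContinuousAt (fun α : ℝ =>
          Complex.arg (-Complex.exp (-(2 * (-α : ℝ) * Complex.I)) * w i)) 0 :=
        ContinuousAt.comp
          (g := fun α : ℝ => Complex.arg (-Complex.exp (-(2 * α * Complex.I)) * w i))
          (f := fun α : ℝ => -α) (by rwa [neg_zero]) (by fun_prop)
      have h4 := (h2.sub h3).tendsto.mono_left (nhdsWithin_le_nhds (s := Set.Ioi 0))
      simpa using! h4
  have hsum := tendsto_finsetSum Finset.univ fun i _ => hlim i
  have hbig : Real.pi < ∑ i, (if w i = 1 then 2 * Real.pi else 0) := by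
    rw [regularAngle_iff hw] at h0
    push Not at h0
    obtain ⟨i, hi⟩ := h0
    have hi1 : w i = 1 := by simpa using hi
    have := Finset.single_le_sum (f := fun i => if w i = 1 then 2 * Real.pi else 0)
      (fun j _ => by split_ifs <;> [exact Real.two_pi_pos.le; exact le_rfl]) (Finset.mem_univ i)
    simp only [hi1, if_true] at this
    linarith [Real.pi_pos]
  filter_upwards [h, hsum.eventually_const_lt hbig] with α hα hlt
  rw [angleSum_eq_sum hW hw hα.1, angleSum_eq_sum hW hw hα.2, ← Finset.sum_sub_distrib]
  exact hlt
end

/-! ### Loops of unitary matrices whose eigenvalues turn in one direction -/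

section
open Matrix Filter

/-- A function that is locally monotone at each point, on the left and on the right, is monotone. -/
theorem monotone_of_locally_monotone {f : ℝ → ℝ}
    (h : ∀ s, (∀ᶠ t in 𝓝[<] s, f t ≤ f s) ∧ ∀ᶠ t in 𝓝[>] s, f s ≤ f t) : Monotone f := by
  intro a b hab
  have hsub : Set.Icc a b ⊆ {t | ∀ t' ∈ Set.Icc a t, f a ≤ f t'} := by
    refine IsClosed.Icc_subset_of_forall_mem_nhdsWithin ?_ ?_ ?_
    · refine isClosed_of_closure_subset fun s hs => ?_
      have hsab : s ∈ Set.Icc a b :=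
        closure_minimal Set.inter_subset_right isClosed_Icc hs
      refine ⟨fun t' ht' => ?_, hsab⟩
      rcases ht'.2.lt_or_eq with hlt | rfl
      · obtain ⟨t, ht1, ht2⟩ := mem_closure_iff.1 hs _ isOpen_Ioi hlt
        exact ht2.1 t' ⟨ht'.1, le_of_lt ht1⟩
      · rcases hsab.1.eq_or_lt with rfl | has
        · exact le_rfl
        obtain ⟨l, hl, hl'⟩ := (mem_nhdsLT_iff_exists_Ioo_subset' has).1 (h t').1
        obtain ⟨t, ht1, ht2⟩ := mem_closure_iff.1 hs _ isOpen_Ioi (max_lt hl has)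
        rcases lt_or_ge t t' with h1 | h1
        · exact (ht2.1 t ⟨ht2.2.1, le_rfl⟩).trans
            (hl' ⟨(le_max_left _ _).trans_lt ht1, h1⟩)
        · exact ht2.1 t' ⟨has.le, h1⟩
    · intro t' ht'
      rw [le_antisymm ht'.2 ht'.1]
    · rintro x ⟨hx, hxab⟩
      obtain ⟨u, hu, hu'⟩ := mem_nhdsGT_iff_exists_Ioo_subset.1 (h x).2
      filter_upwards [Ioo_mem_nhdsGT hu] with t ht t' ht'
      rcases le_or_gt t' x with h1 | h1
      · exact hx t' ⟨ht'.1, h1⟩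
      · exact (hx x ⟨hxab.1, le_rfl⟩).trans (hu' ⟨h1, ht'.2.trans_lt ht.2⟩)
  exact hsub ⟨hab, le_rfl⟩ b ⟨hab, le_rfl⟩

/-- An integer valued continuous function is constant on preconnected sets. -/
theorem eq_of_isPreconnected_of_integer {X : Type*} [TopologicalSpace X] {f : X → ℝ} {K : Set X}
    (hK : IsPreconnected K) (hf : ContinuousOn f K) (hi : ∀ x ∈ K, ∃ k : ℤ, f x = k)
    {x y : X} (hx : x ∈ K) (hy : y ∈ K) : f x = f y := by
  have key : ∀ x ∈ K, ∀ y ∈ K, ¬ f x < f y := by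
    intro x hx y hy hlt
    obtain ⟨k, hk⟩ := hi x hx
    obtain ⟨l, hl⟩ := hi y hy
    have hkl : k + 1 ≤ l := by
      rw [hk, hl] at hlt
      exact_mod_cast hlt
    have hkl' : (k : ℝ) + 1 ≤ l := by exact_mod_cast hkl
    obtain ⟨z, hz, hzk⟩ := hK.intermediate_value hx hy hf
      (show (k : ℝ) + 1 / 2 ∈ Set.Icc (f x) (f y) from ⟨by linarith, by linarith⟩)
    obtain ⟨j, hj⟩ := hi z hz
    rw [hj] at hzk
    have h1 : ((2 * j : ℤ) : ℝ) = ((2 * k + 1 : ℤ) : ℝ) := by push_cast; linarith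
    have h2 : 2 * j = 2 * k + 1 := by exact_mod_cast h1
    omega
  exact le_antisymm (not_lt.1 (key y hy x hx)) (not_lt.1 (key x hx y hy))

/-- For a path of unitary matrices `W t` with `det (W t) = exp (2 π i g(t))`, a function of
`p = (t, α)` which is an integer where `exp (2 i α)` is not an eigenvalue of `W t`, and which
changes only when an eigenvalue passes through `exp (2 i α)`. -/
def crossingIndex {n : ℕ} (W : ℝ → Matrix (Fin n) (Fin n) ℂ) (g : ℝ → ℝ) (p : ℝ × ℝ) : ℝ :=
  g p.1 - p.2 * n / Real.pi + n / 2 - angleSum (W p.1) p.2 / (2 * Real.pi)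

theorem exists_crossingIndex_eq_int {n : ℕ} {W : ℝ → Matrix (Fin n) (Fin n) ℂ}
    (hWu : ∀ t, W t ∈ unitaryGroup (Fin n) ℂ) {g : ℝ → ℝ}
    (hdet : ∀ t, (W t).det = Complex.exp (2 * Real.pi * Complex.I * g t)) {p : ℝ × ℝ}
    (hp : RegularAngle (W p.1) p.2) : ∃ k : ℤ, crossingIndex W g p = k := by
  have h1 := exp_angleSum (hWu p.1) hp
  rw [hdet, ← neg_one_mul, ← Complex.exp_pi_mul_I, ← Complex.exp_add, ← Complex.exp_nat_mul,
    ← Complex.exp_add, Complex.exp_eq_exp_iff_exists_int] at h1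
  obtain ⟨k, hk⟩ := h1
  refine ⟨-k, ?_⟩
  have h2 := congrArg Complex.im hk
  have e1 : ((angleSum (W p.1) p.2 : ℂ) * Complex.I).im = angleSum (W p.1) p.2 := by simp
  have e2 : ((n : ℂ) * (Real.pi * Complex.I + -(2 * p.2 * Complex.I)) +
      2 * Real.pi * Complex.I * g p.1 + k * (2 * Real.pi * Complex.I)) =
      ((n * (Real.pi - 2 * p.2) + 2 * Real.pi * g p.1 + k * (2 * Real.pi) : ℝ) : ℂ) *
        Complex.I := by
    push_cast; ring
  rw [e1, e2, Complex.mul_I_im, Complex.ofReal_re] at h2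
  rw [crossingIndex, h2]
  have := Real.pi_ne_zero
  push_cast
  field_simp
  ring

theorem continuous_det_sub {n : ℕ} {W : ℝ → Matrix (Fin n) (Fin n) ℂ} (hWc : Continuous W) :
    Continuous fun p : ℝ × ℝ => (W p.1 - Complex.exp (2 * p.2 * Complex.I) •
      (1 : Matrix (Fin n) (Fin n) ℂ)).det := by
  refine Continuous.matrix_det ?_
  have : Continuous fun p : ℝ × ℝ => W p.1 := hWc.comp continuous_fst
  fun_prop

theorem continuousOn_crossingIndex {n : ℕ} {W : ℝ → Matrix (Fin n) (Fin n) ℂ}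
    (hWu : ∀ t, W t ∈ unitaryGroup (Fin n) ℂ) (hWc : Continuous W) {g : ℝ → ℝ}
    (hg : Continuous g) :
    ContinuousOn (crossingIndex W g) {p | RegularAngle (W p.1) p.2} := by
  have h1 : ContinuousOn (fun p : ℝ × ℝ => angleSum (W p.1) p.2)
      {p | RegularAngle (W p.1) p.2} := by
    refine ContinuousOn.comp (g := fun p : Matrix (Fin n) (Fin n) ℂ × ℝ => angleSum p.1 p.2)
      (f := fun p : ℝ × ℝ => (W p.1, p.2)) continuousOn_angleSum ?_ fun p hp => ⟨hWu _, hp⟩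
    exact ((hWc.comp continuous_fst).prodMk continuous_snd).continuousOn
  unfold crossingIndex
  refine ContinuousOn.sub ?_ (h1.div_const _)
  have : Continuous fun p : ℝ × ℝ => g p.1 := hg.comp continuous_fst
  exact Continuous.continuousOn (by fun_prop)

/-- Consider a loop of unitary matrices whose determinant has degree `0`. If each eigenvalue that
reaches `1` passes through `1` in the positive direction, then `1` is never an eigenvalue. -/
theorem regularAngle_zero_of_loop {n : ℕ} {W : ℝ → Matrix (Fin n) (Fin n) ℂ}
    (hWu : ∀ t, W t ∈ unitaryGroup (Fin n) ℂ) (hWc : Continuous W) (hWp : ∀ t, W (t + 1) = W t)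
    {g : ℝ → ℝ} (hg : Continuous g) (hgp : ∀ t, g (t + 1) = g t)
    (hdet : ∀ t, (W t).det = Complex.exp (2 * Real.pi * Complex.I * g t))
    (hsec : ∀ t₀, ¬ RegularAngle (W t₀) 0 → ∀ᶠ p : ℝ × ℝ in 𝓝 (t₀, 0), p ≠ (t₀, 0) →
      (p.1 ≤ t₀ ∧ 0 ≤ p.2 ∨ t₀ ≤ p.1 ∧ p.2 ≤ 0) → RegularAngle (W p.1) p.2) (t : ℝ) :
    RegularAngle (W t) 0 := by
  -- the integer `m` is locally constant on `R`, the set where it is defined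
  set R := {p : ℝ × ℝ | RegularAngle (W p.1) p.2} with hR
  have hRo : IsOpen R := isOpen_ne_fun (continuous_det_sub hWc) continuous_const
  set m := crossingIndex W g with hm
  have hconst : ∀ K ⊆ R, IsPreconnected K → ∀ x ∈ K, ∀ y ∈ K, m x = m y :=
    fun K hK hKc x hx y hy => eq_of_isPreconnected_of_integer hKc
      ((continuousOn_crossingIndex hWu hWc hg).mono hK)
      (fun z hz => exists_crossingIndex_eq_int hWu hdet (hK hz)) hx hy
  have hvert : ∀ t a b, (∀ α ∈ Set.uIcc a b, (t, α) ∈ R) → m (t, a) = m (t, b) := by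
    intro t a b h
    refine hconst ((fun α => (t, α)) '' Set.uIcc a b) ?_
      (isPreconnected_uIcc.image _ (by fun_prop)) _ ⟨a, Set.left_mem_uIcc, rfl⟩ _
      ⟨b, Set.right_mem_uIcc, rfl⟩
    rintro _ ⟨α, hα, rfl⟩
    exact h α hα
  have hhor : ∀ s t α, (∀ τ ∈ Set.uIcc s t, (τ, α) ∈ R) → m (s, α) = m (t, α) := by
    intro s t α h
    refine hconst ((fun τ => (τ, α)) '' Set.uIcc s t) ?_
      (isPreconnected_uIcc.image _ (by fun_prop)) _ ⟨s, Set.left_mem_uIcc, rfl⟩ _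
      ⟨t, Set.right_mem_uIcc, rfl⟩
    rintro _ ⟨τ, hτ, rfl⟩
    exact h τ hτ
  have hbox : ∀ t₀, ∃ δ > 0, ∀ τ α, |τ - t₀| < δ → |α| < δ → (τ, α) ≠ (t₀, 0) →
      (τ ≤ t₀ ∧ 0 ≤ α ∨ t₀ ≤ τ ∧ α ≤ 0) → (τ, α) ∈ R := by
    intro t₀
    have h1 : ∀ᶠ p : ℝ × ℝ in 𝓝 (t₀, 0), p ≠ (t₀, 0) →
        (p.1 ≤ t₀ ∧ 0 ≤ p.2 ∨ t₀ ≤ p.1 ∧ p.2 ≤ 0) → p ∈ R := by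
      by_cases h0 : RegularAngle (W t₀) 0
      · filter_upwards [hRo.mem_nhds (show (t₀, (0 : ℝ)) ∈ R from h0)] with p hp _ _ using hp
      · exact hsec t₀ h0
    obtain ⟨δ, hδ, hball⟩ := Metric.eventually_nhds_iff.1 h1
    refine ⟨δ, hδ, fun τ α h2 h3 => hball ?_⟩
    rw [Prod.dist_eq, Real.dist_eq, Real.dist_eq, sub_zero]
    exact max_lt h2 h3
  choose δ hδ hδR using hbox
  -- the value of the index at angles slightly above `0`
  obtain ⟨N, hN⟩ : ∃ N : ℝ → ℝ, ∀ t₀, ∀ a, 0 < a → a < δ t₀ → m (t₀, a) = N t₀ := by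
    refine ⟨fun t₀ => m (t₀, δ t₀ / 2), fun t₀ a ha0 ha => hvert _ _ _ fun α hα => ?_⟩
    have hα0 : 0 < α := (lt_min ha0 (half_pos (hδ t₀))).trans_le hα.1
    have hα1 : α < δ t₀ := hα.2.trans_lt (max_lt ha (half_lt_self (hδ t₀)))
    refine hδR t₀ _ _ (by simpa using hδ t₀) (by rwa [abs_of_pos hα0]) ?_ (Or.inl ⟨le_rfl, hα0.le⟩)
    simp [hα0.ne']
  have hN0 : ∀ t₀, (t₀, (0 : ℝ)) ∈ R → N t₀ = m (t₀, 0) := by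
    intro t₀ h0
    rw [← hN t₀ (δ t₀ / 2) (half_pos (hδ t₀)) (half_lt_self (hδ t₀))]
    refine hvert _ _ _ fun α hα => ?_
    rw [Set.uIcc_of_ge (half_pos (hδ t₀)).le] at hα
    rcases hα.1.eq_or_lt with rfl | hα0
    · exact h0
    refine hδR t₀ _ _ (by simpa using hδ t₀) ?_ (by simp [hα0.ne']) (Or.inl ⟨le_rfl, hα.1⟩)
    rw [abs_of_pos hα0]
    exact hα.2.trans_lt (half_lt_self (hδ t₀))
  -- before `t₀`, the index is transported through the sector `τ ≤ t₀, 0 ≤ α`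
  have hleft : ∀ t₀ t, t < t₀ → t₀ - t < δ t₀ → N t = N t₀ := by
    intro t₀ t ht htδ
    have ha : 0 < δ t₀ / 2 := half_pos (hδ t₀)
    have ha' := half_lt_self (hδ t₀)
    have hmem : ∀ τ α, t ≤ τ → τ ≤ t₀ → 0 ≤ α → α ≤ δ t₀ / 2 → (τ, α) ≠ (t₀, 0) →
        (τ, α) ∈ R := fun τ α h1 h2 h3 h4 h5 =>
      hδR t₀ τ α (by rw [abs_of_nonpos (by linarith)]; linarith)
        (by rw [abs_of_nonneg h3]; linarith) h5 (Or.inl ⟨h2, h3⟩)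
    rw [hN0 t (hmem t 0 le_rfl ht.le le_rfl ha.le (by simp [ht.ne])), ← hN t₀ _ ha ha',
      hvert t 0 (δ t₀ / 2) fun α hα => ?_, hhor t t₀ _ fun τ hτ => ?_]
    · rw [Set.uIcc_of_le ht.le] at hτ
      exact hmem τ _ hτ.1 hτ.2 ha.le le_rfl (by simp [(hδ t₀).ne'])
    · rw [Set.uIcc_of_le ha.le] at hα
      exact hmem t α le_rfl ht.le hα.1 hα.2 (by simp [ht.ne])
  -- after `t₀`, it is transported through the sector `t₀ ≤ τ, α ≤ 0`
  have hright : ∀ t₀ t, t₀ < t → t - t₀ < δ t₀ → ∀ a, 0 < a → a < δ t₀ →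
      N t = m (t₀, -a) := by
    intro t₀ t ht htδ a ha ha'
    have hmem : ∀ τ α, t₀ ≤ τ → τ ≤ t → α ≤ 0 → -a ≤ α → (τ, α) ≠ (t₀, 0) →
        (τ, α) ∈ R := fun τ α h1 h2 h3 h4 h5 =>
      hδR t₀ τ α (by rw [abs_of_nonneg (by linarith)]; linarith)
        (by rw [abs_of_nonpos h3]; linarith) h5 (Or.inr ⟨h1, h3⟩)
    rw [hN0 t (hmem t 0 ht.le le_rfl le_rfl (by linarith) (by simp [ht.ne'])),
      hvert t 0 (-a) fun α hα => ?_, hhor t t₀ _ fun τ hτ => ?_]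
    · rw [Set.uIcc_of_ge ht.le] at hτ
      exact hmem τ _ hτ.1 hτ.2 (by linarith) le_rfl (by simp [ha.ne'])
    · rw [Set.uIcc_of_ge (by linarith)] at hα
      exact hmem t α ht.le le_rfl hα.2 hα.1 (by simp [ht.ne'])
  -- at time `t₀`, the values at the angles `a` and `-a` differ by the multiplicity of the
  -- eigenvalue `1`
  have hjump : ∀ t₀ t, t₀ < t → t - t₀ < δ t₀ →
      N t₀ ≤ N t ∧ (¬ RegularAngle (W t₀) 0 → N t₀ < N t) := by
    intro t₀ t ht htδ
    by_cases h0 : RegularAngle (W t₀) 0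
    · have h1 : N t = N t₀ := by
        rw [hright t₀ t ht htδ (δ t₀ / 2) (half_pos (hδ t₀)) (half_lt_self (hδ t₀)), hN0 t₀ h0]
        refine hvert _ _ _ fun α hα => ?_
        rw [Set.uIcc_of_le (by linarith [hδ t₀])] at hα
        rcases hα.2.eq_or_lt with rfl | hα0
        · exact h0
        refine hδR t₀ _ _ (by simpa using hδ t₀) ?_ (by simp [hα0.ne]) (Or.inr ⟨le_rfl, hα.2⟩)
        rw [abs_of_neg hα0]
        linarith [hα.1, hδ t₀]
      exact ⟨h1.ge, fun h => absurd h0 h⟩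
    · have hev : ∀ᶠ α in 𝓝[>] (0 : ℝ), 0 < α ∧ α < δ t₀ :=
        Ioo_mem_nhdsGT (hδ t₀)
      have hreg : ∀ᶠ α in 𝓝[>] (0 : ℝ), RegularAngle (W t₀) α ∧ RegularAngle (W t₀) (-α) := by
        filter_upwards [hev] with α hα
        refine ⟨hδR t₀ t₀ α (by simpa using hδ t₀) (by rw [abs_of_pos hα.1]; exact hα.2)
          (by simp [hα.1.ne']) (Or.inl ⟨le_rfl, hα.1.le⟩), hδR t₀ t₀ (-α) (by simpa using hδ t₀)
          (by rw [abs_neg, abs_of_pos hα.1]; exact hα.2) (by simp [hα.1.ne'])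
          (Or.inr ⟨le_rfl, by linarith [hα.1]⟩)⟩
      obtain ⟨a, ⟨ha0, ha⟩, hlt⟩ :=
        (hev.and (eventually_pi_lt_angleSum_sub (hWu t₀) h0 hreg)).exists
      have h1 : N t₀ < N t := by
        rw [hright t₀ t ht htδ a ha0 ha, ← hN t₀ a ha0 ha, hm]
        simp only [crossingIndex]
        have e1 : 0 < a * n / Real.pi + a * n / Real.pi +
            (angleSum (W t₀) a - angleSum (W t₀) (-a)) / (2 * Real.pi) := by
          have : 0 < (angleSum (W t₀) a - angleSum (W t₀) (-a)) / (2 * Real.pi) :=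
            div_pos (Real.pi_pos.trans hlt) Real.two_pi_pos
          positivity
        rw [sub_div] at e1
        rw [neg_mul, neg_div]
        linarith
      exact ⟨h1.le, fun _ => h1⟩
  have hmono : Monotone N := by
    refine monotone_of_locally_monotone fun s => ⟨?_, ?_⟩
    · filter_upwards [Ioo_mem_nhdsLT (show s - δ s < s by linarith [hδ s])] with t ht
      exact (hleft s t ht.2 (by linarith [ht.1])).le
    · filter_upwards [Ioo_mem_nhdsGT (show s < s + δ s by linarith [hδ s])] with t ht
      exact (hjump s t ht.1 (by linarith [ht.2])).1
  -- a periodic monotone function does not increase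
  by_contra h0
  have hper : N (t + 1) = N t := by
    have ha : 0 < min (δ t) (δ (t + 1)) / 2 := half_pos (lt_min (hδ _) (hδ _))
    have ha' : min (δ t) (δ (t + 1)) / 2 < min (δ t) (δ (t + 1)) :=
      half_lt_self (lt_min (hδ _) (hδ _))
    rw [← hN t _ ha (ha'.trans_le (min_le_left _ _)),
      ← hN (t + 1) _ ha (ha'.trans_le (min_le_right _ _)), hm]
    simp only [crossingIndex, hWp, hgp]
  have hd : 0 < min (δ t) 1 / 2 := half_pos (lt_min (hδ t) one_pos)
  have h1 := (hjump t (t + min (δ t) 1 / 2) (by linarith)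
    (by linarith [min_le_left (δ t) 1])).2 h0
  have h2 := hmono (show t + min (δ t) 1 / 2 ≤ t + 1 by linarith [min_le_right (δ t) 1])
  linarith
end

/-! ### Tangent planes along the flow -/

section
open Matrix Filter

/-- `continuousAt_mul_transpose` for planes which are described through isomorphisms `Φ t` as the
ranges of linear maps `D t`. -/
theorem continuousAt_mul_transpose_of_range {n : ℕ} {A E : Type*}
    [NormedAddCommGroup A] [NormedSpace ℝ A] [NormedAddCommGroup E] [NormedSpace ℝ E]
    [FiniteDimensional ℝ E] {X : Type*} [TopologicalSpace X]
    (b : Module.Basis (Fin n) ℝ A) {u : X → Matrix (Fin n) (Fin n) ℂ}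
    (hu : ∀ t, u t ∈ unitaryGroup (Fin n) ℂ) {t₀ : X} {Φ : X → (Fin n → ℂ) →L[ℝ] E}
    (hΦ : ContinuousAt Φ t₀) (hΦb : Function.Bijective (Φ t₀)) {D : X → A →L[ℝ] E}
    (hD : ContinuousAt D t₀) (hDi : Function.Injective (D t₀))
    (h : ∀ᶠ t in 𝓝 t₀, ∀ a z, D t a = Φ t z → z ∈ colSpan (u t)) :
    ContinuousAt (fun t => u t * (u t)ᵀ) t₀ := by
  have hcE : CompleteSpace E := FiniteDimensional.complete ℝ E
  let e : (Fin n → ℂ) ≃L[ℝ] E :=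
    (LinearEquiv.ofBijective (Φ t₀).toLinearMap hΦb).toContinuousLinearEquiv
  have he : (e : (Fin n → ℂ) →L[ℝ] E) = Φ t₀ := by ext x; rfl
  have hinv : ContinuousAt (fun t => (Φ t).inverse) t₀ := by
    have h1 : ContinuousAt ContinuousLinearMap.inverse (Φ t₀) := by
      rw [← he]
      exact (contDiffAt_map_inverse (n := 1) e).continuousAt
    exact ContinuousAt.comp (f := Φ) h1 hΦ
  have hev : ∀ᶠ t in 𝓝 t₀, Φ t ∈ Set.range ((↑) : ((Fin n → ℂ) ≃L[ℝ] E) → _) := by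
    have := ContinuousLinearEquiv.nhds e
    rw [he] at this
    exact hΦ.eventually_mem this
  refine continuousAt_mul_transpose hu (fun t i => (Φ t).inverse (D t (b i))) ?_ ?_ ?_
  · rw [continuousAt_pi]
    intro i
    exact tendsto_clm_apply hinv (tendsto_clm_apply hD tendsto_const_nhds)
  · filter_upwards [h, hev] with t ht ⟨e', he'⟩ i
    refine ht (b i) _ ?_
    rw [← he', ContinuousLinearMap.inverse_equiv]
    simp
  · have h1 : LinearIndependent ℝ (D t₀ ∘ b) :=
      b.linearIndependent.map' (D t₀).toLinearMap (LinearMap.ker_eq_bot.2 hDi)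
    have h2 := h1.map' (e.symm : E →L[ℝ] (Fin n → ℂ)).toLinearMap
      (LinearMap.ker_eq_bot.2 e.symm.injective)
    rw [← he, ContinuousLinearMap.inverse_equiv]
    exact h2

theorem stdForm_I_smul_neg {n : ℕ} {x : Fin n → ℂ} (hx : x ≠ 0) :
    stdForm x (Complex.I • x) < 0 := by
  have h1 : stdForm x (Complex.I • x) = -∑ i, ‖x i‖ ^ 2 := by
    rw [stdForm, Complex.im_sum, ← Finset.sum_neg_distrib]
    refine Finset.sum_congr rfl fun i _ => ?_
    rw [← Complex.normSq_eq_norm_sq, Complex.normSq_apply]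
    simp
  rw [h1, neg_lt_zero]
  obtain ⟨i, hi⟩ := Function.ne_iff.1 hx
  exact Finset.sum_pos' (fun j _ => by positivity)
    ⟨i, Finset.mem_univ i, by have := norm_pos_iff.2 hi; positivity⟩

/-- The standard isomorphism between `ℂⁿ` and `ℝⁿ × (ℝⁿ)*`. -/
def stdIso (n : ℕ) : (Fin n → ℂ) →ₗ[ℝ] Vec n × Covec n where
  toFun z := (∑ i, (z i).re • EuclideanSpace.single i (1 : ℝ),
    ∑ i, (z i).im • (EuclideanSpace.proj i : Vec n →L[ℝ] ℝ))
  map_add' z w := by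
    simp only [Pi.add_apply, Complex.add_re, Complex.add_im, add_smul, Finset.sum_add_distrib]
    rfl
  map_smul' r z := by
    simp only [Pi.smul_apply, Complex.smul_re, Complex.smul_im, smul_assoc, RingHom.id_apply,
      ← Finset.smul_sum]
    rfl

theorem coordForm_stdIso {n : ℕ} (z w : Fin n → ℂ) :
    coordForm (stdIso n z) (stdIso n w) = stdForm z w := by
  simp [coordForm_apply, stdIso, stdForm, ← Finset.sum_sub_distrib]
  refine Finset.sum_congr rfl fun i _ => by ring

/-- The real dimension of `ℂⁿ` is that of `ℝⁿ × (ℝⁿ)*`. -/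
theorem finrank_model (n : ℕ) :
    Module.finrank ℝ (Fin n → ℂ) = Module.finrank ℝ (Vec n × Covec n) := by
  rw [Module.finrank_prod, finrank_covec, Module.finrank_pi_fintype]
  simp [mul_two]

theorem bijective_of_coordForm_eq_stdForm {n : ℕ} {Φ : (Fin n → ℂ) →ₗ[ℝ] Vec n × Covec n}
    (h : ∀ z w, coordForm (Φ z) (Φ w) = stdForm z w) : Function.Bijective Φ := by
  have hi : Function.Injective Φ := by
    rw [injective_iff_map_eq_zero]
    intro x hx
    by_contra hx0
    have h1 := stdForm_I_smul_neg hx0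
    rw [← h, coordForm_swap, hx, map_zero, neg_zero] at h1
    exact lt_irrefl _ h1
  exact ⟨hi, (LinearMap.injective_iff_surjective_of_finrank_eq_finrank (finrank_model n)).1 hi⟩

end

section
open Filter
variable {n : ℕ} {S : Type*} [TopologicalSpace S] [ChartedSpace (Vec n) S]
  [IsManifold (𝓡 n) ∞ S]
  {F : Type*} [TopologicalSpace F] [ChartedSpace (Vec n) F] [IsManifold (𝓡 n) ∞ F]

/-- The derivative of `ι`, written in the charts at `p`, at the point `q`. -/
def tangentFrame (ι : F → Cotangent n S) (p q : F) : Vec n →L[ℝ] Vec n × Covec n :=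
  fderiv ℝ (chartMap ι p) (extChartAt (𝓡 n) p q)

theorem continuousAt_tangentFrame {ι : F → Cotangent n S}
    (hι : ContMDiff (𝓡 n) (cotModel n) ∞ ι) (p : F) : ContinuousAt (tangentFrame ι p) p := by
  have h1 := (contDiffAt_chartMap hι (mem_chart_source _ p)
    (mem_chart_source _ (ι p))).fderiv_right (m := 1) (by norm_cast)
  exact ContinuousAt.comp (f := extChartAt (𝓡 n) p) h1.continuousAt (continuousAt_extChartAt p)

theorem hasDerivAt_fderiv_comp {A E : Type*} [NormedAddCommGroup A] [NormedSpace ℝ A]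
    [NormedAddCommGroup E] [NormedSpace ℝ E] {f : A → E} {x : ℝ → A} {a : A} {t₀ : ℝ}
    (hf : ContDiffAt ℝ 2 f (x t₀)) (hx : HasDerivAt x a t₀) :
    HasDerivAt (fun t => fderiv ℝ f (x t)) (fderiv ℝ (fderiv ℝ f) (x t₀) a) t₀ := by
  have hdf : HasFDerivAt (fderiv ℝ f) (fderiv ℝ (fderiv ℝ f) (x t₀)) (x t₀) :=
    ((hf.fderiv_right (m := 1) (by norm_num)).differentiableAt (by norm_num)).hasFDerivAt
  have := hdf.comp_hasDerivAt t₀ hx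
  exact this

theorem fderiv_fderiv_smul_apply {A E : Type*} [NormedAddCommGroup A] [NormedSpace ℝ A]
    [NormedAddCommGroup E] [NormedSpace ℝ E] (f : A → E) (x a e : A) (l : ℝ) :
    fderiv ℝ (fderiv ℝ f) x (l • a) e = l • fderiv ℝ (fderiv ℝ f) x a e := by
  rw [map_smul, _root_.smul_apply]

/-- Along the flow of a convex hamiltonian, the tangent planes of the lagrangian submanifold move
in the positive direction on the vertical vectors they contain. -/
theorem exists_hasDerivAt_tangentFrame {H : Cotangent n S → ℝ} (hH : IsConvexHamiltonian H)
    {φ : Flow ℝ (Cotangent n S)} (hφ : IsHamiltonianFlow H φ) {ι : F → Cotangent n S}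
    (hι : IsLagrangianEmbedding ι) {c : ℝ} (hc : ∀ p, H (ι p) = c) {γ : ℝ → F} {t₀ l : ℝ}
    (hl : 0 < l) (hγ : ContinuousAt γ t₀)
    (hfl : ∀ᶠ t in 𝓝 t₀, ι (γ t) = φ (l * (t - t₀)) (ι (γ t₀))) :
    ∃ D' : Vec n →L[ℝ] Vec n × Covec n,
      HasDerivAt (fun t => tangentFrame ι (γ t₀) (γ t)) D' t₀ ∧
      ∀ e, e ≠ 0 → (tangentFrame ι (γ t₀) (γ t₀) e).1 = 0 →
        0 < coordForm (tangentFrame ι (γ t₀) (γ t₀) e) (D' e) := by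
  have hsm := hι.isSmoothEmbedding.contMDiff
  set p := γ t₀ with hp
  have hps := mem_chart_source (Vec n) p
  have hps' := mem_chart_source (ModelProd (Vec n) (Covec n)) (ι p)
  obtain ⟨a, ha, hda⟩ := hasDerivAt_chart_of_flow hH.contMDiff hφ hι hc hγ hfl
  have hf : ContDiffAt ℝ 2 (chartMap ι p) (extChartAt (𝓡 n) p p) :=
    (contDiffAt_chartMap hsm hps hps').of_le (by norm_cast)
  have hh : ContDiffAt ℝ 2 (chartFun H (ι p)) (chartMap ι p (extChartAt (𝓡 n) p p)) := by
    rw [chartMap_self]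
    exact (contDiffAt_chartFun hH.contMDiff hps').of_le (by norm_cast)
  refine ⟨_, hasDerivAt_fderiv_comp (x := fun t => extChartAt (𝓡 n) p (γ t)) hf hda, ?_⟩
  intro e he hev
  have hev1 := eventually_mem_charts hsm.continuous p
  have hpair := secondDeriv_pairing isBoundedBilinearMap_coordForm coordForm_swap hf hh (c := c)
    (eventually_chart_of_eventually ?_) (eventually_chart_of_eventually ?_) (Y := a) ?_ e
  · change 0 < coordForm (tangentFrame ι p p e)
      (fderiv ℝ (fderiv ℝ (chartMap ι p)) (extChartAt (𝓡 n) p p) (l • a) e)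
    rw [fderiv_fderiv_smul_apply, map_smul]
    change 0 < l * coordForm (fderiv ℝ (chartMap ι p) (extChartAt (𝓡 n) p p) e)
      (fderiv ℝ (fderiv ℝ (chartMap ι p)) (extChartAt (𝓡 n) p p) a e)
    rw [hpair, chartMap_self]
    refine mul_pos hl (hH.fderiv_fderiv_pos _ ?_ hev)
    intro h0
    exact he (fderiv_chartMap_injective hι.isSmoothEmbedding p (h0.trans (map_zero _).symm))
  · filter_upwards [hev1] with q hq
    rw [chartMap_extChartAt ι hq.1, chartFun, Function.comp_apply,
      (extChartAt (cotModel n) (ι p)).left_inv (by rw [extChartAt_source]; exact hq.2), hc]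
  · filter_upwards [hev1] with q hq
    exact coordForm_fderiv_chartMap hι hq.1 hq.2
  · intro w
    rw [ha, coordForm_coordGrad, chartMap_self]

/-- The vertical subspace in canonical coordinates. -/
def verticalModel (n : ℕ) : Submodule ℝ (Vec n × Covec n) :=
  LinearMap.ker (LinearMap.fst ℝ (Vec n) (Covec n))

theorem mem_verticalModel {z : Vec n × Covec n} : z ∈ verticalModel n ↔ z.1 = 0 := Iff.rfl

/-- The conclusion of `eventually_transverse_of_velocity_pos` for the tangent planes along the flow
and the vertical planes. -/
theorem eventually_transverse_of_flow {H : Cotangent n S → ℝ} (hH : IsConvexHamiltonian H)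
    {φ : Flow ℝ (Cotangent n S)} (hφ : IsHamiltonianFlow H φ) {ι : F → Cotangent n S}
    (hι : IsLagrangianEmbedding ι) {c : ℝ} (hc : ∀ p, H (ι p) = c) {γ : ℝ → F} {t₀ l : ℝ}
    (hl : 0 < l) (hγ : ContinuousAt γ t₀)
    (hfl : ∀ᶠ t in 𝓝 t₀, ι (γ t) = φ (l * (t - t₀)) (ι (γ t₀)))
    {Φ : ℝ → (Fin n → ℂ) →L[ℝ] Vec n × Covec n} (hΦ : ContinuousAt Φ t₀)
    (hΦs : ∀ z w, coordForm (Φ t₀ z) (Φ t₀ w) = stdForm z w) :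
    ∀ᶠ p : ℝ × ℝ in 𝓝 (t₀, 0), p ≠ (t₀, 0) →
      (p.1 ≤ t₀ ∧ 0 ≤ p.2 ∨ t₀ ≤ p.1 ∧ p.2 ≤ 0) →
      ∀ x a, tangentFrame ι (γ t₀) (γ p.1) a = Φ p.1 x →
        Φ p.1 (Complex.exp (p.2 * Complex.I) • x) ∈ verticalModel n → x = 0 := by
  obtain ⟨D', hD', hpos⟩ := exists_hasDerivAt_tangentFrame hH hφ hι hc hl hγ hfl
  refine eventually_transverse_of_velocity_pos (B := fun z w => coordForm z w)
    isBoundedBilinearMap_coordForm hD' ?_ hΦ ?_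
    (verticalModel n) ?_ ?_ ?_ ?_
  · exact fderiv_chartMap_injective hι.isSmoothEmbedding _
  · exact (bijective_of_coordForm_eq_stdForm (Φ := (Φ t₀).toLinearMap) hΦs).1
  · intro v hv w hw
    rw [mem_verticalModel] at hv hw
    rw [coordForm_apply, hv, hw, map_zero, map_zero, sub_zero]
  · exact coordForm_fderiv_chartMap hι (mem_chart_source _ _) (mem_chart_source _ _)
  · exact hpos
  · intro x hx
    rw [hΦs]
    exact stdForm_I_smul_neg hx

end

/-! ### Loops with vanishing Maslov index -/

section
open Filter
variable {n : ℕ} {S : Type*} [TopologicalSpace S] [ChartedSpace (Vec n) S]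
  [IsManifold (𝓡 n) ∞ S]
  {F : Type*} [TopologicalSpace F] [ChartedSpace (Vec n) F] [IsManifold (𝓡 n) ∞ F]

/-- The tangent plane of the lagrangian submanifold at `p` is transverse to the vertical. -/
def IsTransverseAt (ι : F → Cotangent n S) (p : F) : Prop :=
  ∀ v ∈ tangentPlane ι p, v ∈ verticalSpace (ι p) → v = 0

/-- A symplectic trivialization over a loop, written in the canonical chart at `θ₀`. -/
def SymplecticTrivialization.inChart {c : UnitAddCircle → Cotangent n S}
    (Φ : SymplecticTrivialization c) (θ₀ : Cotangent n S) (t : ℝ) :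
    (Fin n → ℂ) →L[ℝ] Vec n × Covec n :=
  LinearMap.toContinuousLinearMap ((chartDeriv θ₀ (c t)).toLinearMap ∘ₗ Φ.toLin t)

theorem SymplecticTrivialization.inChart_apply {c : UnitAddCircle → Cotangent n S}
    (Φ : SymplecticTrivialization c) (θ₀ : Cotangent n S) (t : ℝ) (z : Fin n → ℂ) :
    Φ.inChart θ₀ t z = chartDeriv θ₀ (c t) (Φ.toLin t z) := rfl

theorem SymplecticTrivialization.coordForm_inChart {c : UnitAddCircle → Cotangent n S}
    (Φ : SymplecticTrivialization c) {θ₀ : Cotangent n S} {t : ℝ}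
    (h : c t ∈ (chartAt (ModelProd (Vec n) (Covec n)) θ₀).source) (z w : Fin n → ℂ) :
    coordForm (Φ.inChart θ₀ t z) (Φ.inChart θ₀ t w) = stdForm z w := by
  rw [inChart_apply, inChart_apply, coordForm_chartDeriv h, Φ.symplectic]

theorem SymplecticTrivialization.continuousAt_inChart {c : UnitAddCircle → Cotangent n S}
    (Φ : SymplecticTrivialization c) {θ₀ : Cotangent n S} {t : ℝ}
    (h : c t ∈ (chartAt (ModelProd (Vec n) (Covec n)) θ₀).source) :
    ContinuousAt (Φ.inChart θ₀) t := by
  rw [continuousAt_clm_apply]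
  intro z
  have h1 : Continuous fun s : ℝ => (s : UnitAddCircle) := AddCircle.continuous_mk' 1
  exact continuousAt_chartDeriv (c := fun s : ℝ => c s) (v := fun s : ℝ => Φ.toLin s z)
    ((Φ.continuous_toLin z).comp h1).continuousAt h

theorem SymplecticTrivialization.toLin_bijective {c : UnitAddCircle → Cotangent n S}
    (Φ : SymplecticTrivialization c) (t : UnitAddCircle) : Function.Bijective (Φ.toLin t) := by
  have h := mem_chart_source (ModelProd (Vec n) (Covec n)) (c t)
  have h1 := bijective_of_coordForm_eq_stdForm
    (Φ := (chartDeriv (c t) (c t)).toLinearMap ∘ₗ Φ.toLin t) fun z w => by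
      have := coordForm_chartDeriv h (Φ.toLin t z) (Φ.toLin t w)
      exact this.trans (Φ.symplectic t z w)
  exact (Function.Bijective.of_comp_iff' (chartDeriv_bijective h) _).1 h1

/-- Unitary frames of a loop of lagrangian planes, and a lift of the loop `det²`. The frames need
not be continuous. -/
theorem exists_unitary_lift {c : UnitAddCircle → Cotangent n S} {Φ : SymplecticTrivialization c}
    {L : ∀ t, Submodule ℝ (TangentSpace (cotModel n) (c t))} {k : ℤ} (h : Φ.HasDegree L k) :
    ∃ (u : UnitAddCircle → Matrix (Fin n) (Fin n) ℂ) (g : ℝ → ℝ),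
      (∀ t, u t ∈ Matrix.unitaryGroup (Fin n) ℂ) ∧
      (∀ t z, z ∈ colSpan (u t) ↔ Φ.toLin t z ∈ L t) ∧ Continuous g ∧
      (∀ t : ℝ, (u t).det ^ 2 = Complex.exp (2 * Real.pi * Complex.I * g t)) ∧
      ∀ t, g (t + 1) = g t + k := by
  obtain ⟨f, hf, g, hg, hfg, hgk⟩ := h
  choose u hu hcol hdet using hf
  refine ⟨u, g, hu, fun t z => ?_, hg, fun t => by rw [← hdet, hfg], hgk⟩
  rw [hcol]
  rfl

/-- Let the Maslov index of a loop in the lagrangian submanifold be `0`, and let the loop follow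
the flow of the convex hamiltonian, in positive time, near all its points where the submanifold
is not transverse to the vertical. Then the loop does not have such points. -/
theorem isTransverseAt_of_loop {H : Cotangent n S → ℝ} (hH : IsConvexHamiltonian H)
    {φ : Flow ℝ (Cotangent n S)} (hφ : IsHamiltonianFlow H φ) {ι : F → Cotangent n S}
    (hι : IsLagrangianEmbedding ι) {c : ℝ} (hc : ∀ p, H (ι p) = c) (γ : C(UnitAddCircle, F))
    (hγ : HasMaslovIndex ι γ 0)
    (hfl : ∀ t₀ : ℝ, ¬ IsTransverseAt ι (γ t₀) → ∃ l > 0, ∀ᶠ t : ℝ in 𝓝 t₀,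
      ι (γ t) = φ (l * (t - t₀)) (ι (γ t₀))) (t : ℝ) :
    IsTransverseAt ι (γ t) := by
  obtain ⟨Φ, a, b, hr, hs, hab⟩ := hγ
  obtain ⟨u, gu, huU, huL, hgu, hudet, huk⟩ := exists_unitary_lift hr
  obtain ⟨v, gv, hvU, hvL, hgv, hvdet, hvk⟩ := exists_unitary_lift hs
  have hsm := hι.isSmoothEmbedding.contMDiff
  have hmk : Continuous fun s : ℝ => (s : UnitAddCircle) := AddCircle.continuous_mk' 1
  have hγc : Continuous fun s : ℝ => γ s := γ.continuous.comp hmk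
  set W : ℝ → Matrix (Fin n) (Fin n) ℂ := fun t => relUnitary (u t) (v t) with hW
  have hWU : ∀ t, W t ∈ Matrix.unitaryGroup (Fin n) ℂ := fun t => relUnitary_mem (huU t) (hvU t)
  -- in the chart at `γ t₀`
  have hnear : ∀ t₀ : ℝ, ∀ᶠ t : ℝ in 𝓝 t₀, γ t ∈ (chartAt (Vec n) (γ t₀)).source ∧
      ι (γ t) ∈ (chartAt (ModelProd (Vec n) (Covec n)) (ι (γ t₀))).source := fun t₀ =>
    hγc.continuousAt.eventually (eventually_mem_charts hsm.continuous (γ t₀))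
  have hL : ∀ t₀ : ℝ, ∀ᶠ t : ℝ in 𝓝 t₀, ∀ z, z ∈ colSpan (u t) ↔
      ∃ e, tangentFrame ι (γ t₀) (γ t) e = Φ.inChart (ι (γ t₀)) t z := by
    intro t₀
    filter_upwards [hnear t₀] with t ht z
    rw [huL, mem_tangentPlane_iff hsm ht.1 ht.2]
    rfl
  have hV : ∀ t₀ : ℝ, ∀ᶠ t : ℝ in 𝓝 t₀, ∀ z, z ∈ colSpan (v t) ↔
      Φ.inChart (ι (γ t₀)) t z ∈ verticalModel n := by
    intro t₀
    filter_upwards [hnear t₀] with t ht z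
    rw [hvL, mem_verticalSpace_iff ht.2]
    rfl
  have hΦc : ∀ t₀ : ℝ, ContinuousAt (Φ.inChart (ι (γ t₀))) t₀ := fun t₀ =>
    Φ.continuousAt_inChart (mem_chart_source _ _)
  have hΦs : ∀ (t₀ : ℝ) z w, coordForm (Φ.inChart (ι (γ t₀)) t₀ z) (Φ.inChart (ι (γ t₀)) t₀ w) =
      stdForm z w := fun t₀ => Φ.coordForm_inChart (mem_chart_source _ _)
  have hΦb : ∀ t₀ : ℝ, Function.Bijective (Φ.inChart (ι (γ t₀)) t₀) := fun t₀ =>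
    bijective_of_coordForm_eq_stdForm (Φ := (Φ.inChart (ι (γ t₀)) t₀).toLinearMap) (hΦs t₀)
  have hWc : Continuous W := by
    rw [continuous_iff_continuousAt]
    intro t₀
    have h1 : ContinuousAt (fun t : ℝ => u t * (u t).transpose) t₀ := by
      refine continuousAt_mul_transpose_of_range (u := fun t : ℝ => u t)
        (EuclideanSpace.basisFun (Fin n) ℝ).toBasis (fun t => huU t)
        (hΦc t₀) (hΦb t₀) (D := fun t => tangentFrame ι (γ t₀) (γ t)) ?_
        (fderiv_chartMap_injective hι.isSmoothEmbedding _) ?_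
      · exact ContinuousAt.comp (f := fun t : ℝ => γ t) (continuousAt_tangentFrame hsm _)
          hγc.continuousAt
      · filter_upwards [hL t₀] with t ht e z hz
        exact (ht z).2 ⟨e, hz⟩
    have h2 : ContinuousAt (fun t : ℝ => v t * (v t).transpose) t₀ := by
      refine continuousAt_mul_transpose_of_range (u := fun t : ℝ => v t)
        (Module.finBasisOfFinrankEq ℝ (Covec n) (finrank_covec n)) (fun t => hvU t)
        (hΦc t₀) (hΦb t₀) (D := fun _ => ContinuousLinearMap.inr ℝ (Vec n) (Covec n))
        continuousAt_const (fun x y hxy => (Prod.ext_iff.1 hxy).2) ?_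
      filter_upwards [hV t₀] with t ht e z hz
      rw [ht, ← hz]
      rfl
    have h3 : ContinuousAt (fun t : ℝ => (u t * (u t).transpose).conjTranspose) t₀ :=
      ContinuousAt.comp (f := fun t : ℝ => u t * (u t).transpose)
        (continuous_id.matrix_conjTranspose).continuousAt h1
    have hmul : Continuous fun p : Matrix (Fin n) (Fin n) ℂ × Matrix (Fin n) (Fin n) ℂ =>
        p.1 * p.2 := continuous_fst.matrix_mul continuous_snd
    exact ContinuousAt.comp (f := fun t : ℝ => (v t * (v t).transpose,
      (u t * (u t).transpose).conjTranspose)) hmul.continuousAt (h2.prodMk h3)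
  -- the lifts `gu` and `gv` have the same degree, so their difference is a periodic logarithm of
  -- the determinant of `W`
  have hreg : RegularAngle (W t) 0 := by
    refine regularAngle_zero_of_loop hWU hWc (fun t => ?_) (hgv.sub hgu) (fun t => ?_)
      (fun t => ?_) (fun t₀ ht₀ => ?_) t
    · simp only [hW, AddCircle.coe_add_period]
    · have : (a : ℝ) = b := by
        have : a = b := by omega
        rw [this]
      simp only [Pi.sub_apply, huk, hvk, this]
      ring
    · rw [hW, det_relUnitary, hudet, hvdet, Complex.star_def, ← Complex.exp_conj,
        ← Complex.exp_add]
      congr 1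
      simp only [map_mul, Complex.conj_I, Complex.conj_ofReal, map_ofNat, Pi.sub_apply,
        Complex.ofReal_sub]
      ring
    · have hnt : ¬ IsTransverseAt ι (γ t₀) := by
        intro htr
        obtain ⟨x, hx0, hxu, hxv⟩ :=
          exists_mem_colSpan_of_det_eq_zero (huU t₀) (hvU t₀) 0 (not_not.1 ht₀)
        simp only [Complex.ofReal_zero, zero_mul, Complex.exp_zero, one_smul] at hxv
        apply hx0
        apply (Φ.toLin_bijective t₀).1
        rw [map_zero]
        exact htr _ ((huL _ _).1 hxu) ((hvL _ _).1 hxv)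
      obtain ⟨l, hl, hflow⟩ := hfl t₀ hnt
      have hev := eventually_transverse_of_flow hH hφ hι hc hl (γ := fun t : ℝ => γ t)
        hγc.continuousAt hflow (hΦc t₀) (hΦs t₀)
      have hfst : Tendsto (fun p : ℝ × ℝ => p.1) (𝓝 (t₀, 0)) (𝓝 t₀) :=
        continuous_fst.tendsto (t₀, (0 : ℝ))
      filter_upwards [hev, hfst.eventually (hL t₀), hfst.eventually (hV t₀)]
        with p hp hpL hpV hne hsgn hdet
      obtain ⟨x, hx0, hxu, hxv⟩ :=
        exists_mem_colSpan_of_det_eq_zero (huU p.1) (hvU p.1) p.2 hdet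
      obtain ⟨e, he⟩ := (hpL x).1 hxu
      exact hx0 (hp hne hsgn x e he ((hpV _).1 hxv))
  intro w hw1 hw2
  obtain ⟨x, rfl⟩ := (Φ.toLin_bijective t).2 w
  by_contra hne
  refine hreg ?_
  have hx0 : x ≠ 0 := fun h => hne (by rw [h, map_zero])
  have := det_relUnitary_sub_one_eq_zero (huU t) (hvU t) hx0 ((huL _ _).2 hw1) ((hvL _ _).2 hw2)
  simpa [hW] using this
end

/-! ### Recurrence and transversality -/

section
open Filter
variable {n : ℕ} {S : Type*} [TopologicalSpace S] [ChartedSpace (Vec n) S]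
  [IsManifold (𝓡 n) ∞ S]
  {F : Type*} [TopologicalSpace F] [ChartedSpace (Vec n) F] [IsManifold (𝓡 n) ∞ F]

theorem tangentFrame_injective {ι : F → Cotangent n S}
    (hι : IsSmoothEmbedding (𝓡 n) (cotModel n) ∞ ι) {p q : F}
    (hq : q ∈ (chartAt (Vec n) p).source)
    (hq' : ι q ∈ (chartAt (ModelProd (Vec n) (Covec n)) (ι p)).source) :
    Function.Injective (tangentFrame ι p q) := by
  intro a b hab
  obtain ⟨v, rfl⟩ := (mfderiv_extChartAt_bijective hq).2 a
  obtain ⟨w, rfl⟩ := (mfderiv_extChartAt_bijective hq).2 b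
  have h := (chartDeriv_mfderiv hι.contMDiff hq hq' v).trans
    (hab.trans (chartDeriv_mfderiv hι.contMDiff hq hq' w).symm)
  rw [mfderiv_injective hι q ((chartDeriv_bijective hq').1 h)]

/-- In charts, transversality means that the derivative of the base coordinates is injective. -/
theorem isTransverseAt_iff {ι : F → Cotangent n S} (hι : IsSmoothEmbedding (𝓡 n) (cotModel n) ∞ ι)
    {p q : F} (hq : q ∈ (chartAt (Vec n) p).source)
    (hq' : ι q ∈ (chartAt (ModelProd (Vec n) (Covec n)) (ι p)).source) :
    IsTransverseAt ι q ↔ Function.Injective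
      ((ContinuousLinearMap.fst ℝ (Vec n) (Covec n)).comp (tangentFrame ι p q)) := by
  rw [injective_iff_map_eq_zero]
  constructor
  · intro h a ha
    obtain ⟨w, rfl⟩ := (mfderiv_extChartAt_bijective hq).2 a
    have h1 := chartDeriv_mfderiv hι.contMDiff hq hq' w
    have h2 := h (mfderiv (𝓡 n) (cotModel n) ι q w) ⟨w, rfl⟩ (by
      rw [mem_verticalSpace_iff hq', h1]
      exact ha)
    have h3 : w = 0 := mfderiv_injective hι q (h2.trans (ContinuousLinearMap.map_zero _).symm)
    rw [h3, ContinuousLinearMap.map_zero]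
    rfl
  · rintro h _ ⟨w, rfl⟩ hv
    have h1 := chartDeriv_mfderiv hι.contMDiff hq hq' w
    rw [mem_verticalSpace_iff hq'] at hv
    have h2 := h _ ((congrArg Prod.fst h1).symm.trans hv)
    have h3 : w = 0 := (mfderiv_extChartAt_bijective hq).1
      (h2.trans (ContinuousLinearMap.map_zero _).symm)
    rw [h3]
    exact ContinuousLinearMap.map_zero _

theorem isOpen_setOf_isTransverseAt {ι : F → Cotangent n S}
    (hι : IsSmoothEmbedding (𝓡 n) (cotModel n) ∞ ι) : IsOpen {p | IsTransverseAt ι p} := by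
  rw [isOpen_iff_mem_nhds]
  intro p hp
  have h1 : ContinuousAt (fun q => (ContinuousLinearMap.fst ℝ (Vec n) (Covec n)).comp
      (tangentFrame ι p q)) p :=
    continuousAt_const.clm_comp (continuousAt_tangentFrame hι.contMDiff p)
  have h2 := h1.preimage_mem_nhds (ContinuousLinearMap.isOpen_injective.mem_nhds
    ((isTransverseAt_iff hι (mem_chart_source _ p) (mem_chart_source _ _)).1 hp))
  filter_upwards [eventually_mem_charts hι.contMDiff.continuous p, h2] with q hq hq2
  exact (isTransverseAt_iff hι hq.1 hq.2).2 hq2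

/-- The flow of `H` restricts to the lagrangian submanifold. -/
theorem exists_flow_restrict [T2Space S] [CompactSpace F] {H : Cotangent n S → ℝ}
    (hH : ContMDiff (cotModel n) 𝓘(ℝ, ℝ) ∞ H) {φ : Flow ℝ (Cotangent n S)}
    (hφ : IsHamiltonianFlow H φ) {ι : F → Cotangent n S} (hι : IsLagrangianEmbedding ι) {c : ℝ}
    (hc : ∀ p, H (ι p) = c) : ∃ ψ : Flow ℝ F, ∀ t p, ι (ψ t p) = φ t (ι p) := by
  have hemb := hι.isSmoothEmbedding.isEmbedding
  choose ψ hψ using fun p t => flow_mem_range hH hφ hι hc p t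
  refine ⟨⟨fun t p => ψ p t, ?_, ?_, ?_⟩, fun t p => hψ p t⟩
  · rw [hemb.continuous_iff]
    refine (φ.continuous continuous_fst (hemb.continuous.comp continuous_snd)).congr fun x => ?_
    exact (hψ x.2 x.1).symm
  · intro t₁ t₂ p
    apply hemb.injective
    rw [hψ, hψ, hψ, φ.map_add]
  · intro p
    apply hemb.injective
    rw [hψ, φ.map_zero_apply]

/-- On each orbit, the points of tangency with the vertical are isolated. -/
theorem eventually_isTransverseAt_flow {H : Cotangent n S → ℝ} (hH : IsConvexHamiltonian H)
    {φ : Flow ℝ (Cotangent n S)} (hφ : IsHamiltonianFlow H φ) {ι : F → Cotangent n S}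
    (hι : IsLagrangianEmbedding ι) {c : ℝ} (hc : ∀ p, H (ι p) = c) {ψ : Flow ℝ F}
    (hψ : ∀ t p, ι (ψ t p) = φ t (ι p)) (p : F) :
    ∀ᶠ t in 𝓝 (0 : ℝ), t ≠ 0 → IsTransverseAt ι (ψ t p) := by
  have hγ : Continuous fun t : ℝ => ψ t p := ψ.continuous continuous_id continuous_const
  have hsm := hι.isSmoothEmbedding.contMDiff
  -- rotations play no role here, so any symplectic identification with `ℂⁿ` will do
  have hev := eventually_transverse_of_flow hH hφ hι hc one_pos (γ := fun t : ℝ => ψ t p)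
    (t₀ := 0) hγ.continuousAt (Eventually.of_forall fun t => by
      rw [hψ, hψ, φ.map_zero_apply, sub_zero, one_mul])
    (Φ := fun _ => LinearMap.toContinuousLinearMap (stdIso n)) continuousAt_const coordForm_stdIso
  have h0 : Tendsto (fun t : ℝ => (t, (0 : ℝ))) (𝓝 0) (𝓝 (0, 0)) :=
    Continuous.tendsto' (by fun_prop) _ _ rfl
  filter_upwards [h0.eventually hev, hγ.continuousAt.eventually
    (eventually_mem_charts hsm.continuous (ψ 0 p))] with t ht hch ht0
  rw [isTransverseAt_iff hι.isSmoothEmbedding hch.1 hch.2, injective_iff_map_eq_zero]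
  intro a ha
  have hbij := bijective_of_coordForm_eq_stdForm (Φ := stdIso n) coordForm_stdIso
  obtain ⟨x, hx⟩ := hbij.2 (tangentFrame ι (ψ 0 p) (ψ t p) a)
  have hx0 : x = 0 := by
    refine ht (by simpa using ht0) ?_ x a hx.symm ?_
    · rcases le_total t 0 with h | h
      · exact Or.inl ⟨h, le_rfl⟩
      · exact Or.inr ⟨h, le_rfl⟩
    · simp only [Complex.ofReal_zero, zero_mul, Complex.exp_zero, one_smul]
      change stdIso n x ∈ verticalModel n
      rw [hx]
      exact ha
  apply tangentFrame_injective hι.isSmoothEmbedding hch.1 hch.2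
  rw [← hx, hx0, map_zero, ContinuousLinearMap.map_zero]

end

section
open Filter
variable {n : ℕ} {S : Type*} [TopologicalSpace S] [ChartedSpace (Vec n) S]
  [IsManifold (𝓡 n) ∞ S] {F : Type*} [TopologicalSpace F] [ChartedSpace (Vec n) F]

/-- A path in the lagrangian submanifold that follows the flow, in positive time, near all the
times at which the submanifold is not transverse to the vertical. -/
def FollowsFlow (ι : F → Cotangent n S) (ψ : Flow ℝ F) {x y : F} (P : Path x y) : Prop :=
  ∀ s ∈ Set.Ioo (0 : ℝ) 1, ¬ IsTransverseAt ι (P.extend s) →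
    ∃ l > 0, ∀ᶠ t in 𝓝 s, P.extend t = ψ (l * (t - s)) (P.extend s)

theorem FollowsFlow.trans {ι : F → Cotangent n S} {ψ : Flow ℝ F} {x y z : F} {P : Path x y}
    {Q : Path y z} (hP : FollowsFlow ι ψ P) (hQ : FollowsFlow ι ψ Q) (hy : IsTransverseAt ι y) :
    FollowsFlow ι ψ (P.trans Q) := by
  intro s hs hns
  rcases lt_trichotomy s (1 / 2) with h | rfl | h
  · rw [Path.extend_trans_of_le_half _ _ h.le] at hns ⊢
    obtain ⟨l, hl, hev⟩ := hP (2 * s) ⟨by linarith [hs.1], by linarith⟩ hns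
    have h2 : Tendsto (fun t : ℝ => 2 * t) (𝓝 s) (𝓝 (2 * s)) :=
      Continuous.tendsto' (by fun_prop) _ _ rfl
    refine ⟨l * 2, by positivity, ?_⟩
    filter_upwards [h2.eventually hev, Iio_mem_nhds h] with t ht hts
    rw [Path.extend_trans_of_le_half _ _ (le_of_lt hts), ht]
    congr 1
    ring
  · exfalso
    apply hns
    rw [Path.extend_trans_of_le_half _ _ le_rfl]
    simpa using hy
  · rw [Path.extend_trans_of_half_le _ _ h.le] at hns ⊢
    obtain ⟨l, hl, hev⟩ := hQ (2 * s - 1) ⟨by linarith, by linarith [hs.2]⟩ hns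
    have h2 : Tendsto (fun t : ℝ => 2 * t - 1) (𝓝 s) (𝓝 (2 * s - 1)) :=
      Continuous.tendsto' (by fun_prop) _ _ rfl
    refine ⟨l * 2, by positivity, ?_⟩
    filter_upwards [h2.eventually hev, Ioi_mem_nhds h] with t ht hts
    rw [Path.extend_trans_of_half_le _ _ (le_of_lt hts), ht]
    congr 1
    ring

theorem followsFlow_of_isTransverseAt {ι : F → Cotangent n S} {ψ : Flow ℝ F} {x y : F}
    {P : Path x y} (h : ∀ t, IsTransverseAt ι (P t)) : FollowsFlow ι ψ P := by
  intro s hs hns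
  rw [P.extend_apply ⟨hs.1.le, hs.2.le⟩] at hns
  exact absurd (h _) hns

/-- The orbit of `x` from time `0` to time `T`, as a path. -/
def orbitPath {X : Type*} [TopologicalSpace X] (ψ : Flow ℝ X) (x : X) (T : ℝ) :
    Path x (ψ T x) where
  toFun s := ψ (T * s) x
  continuous_toFun := ψ.continuous (by fun_prop) continuous_const
  source' := by simp
  target' := by simp

theorem followsFlow_orbitPath {ι : F → Cotangent n S} {ψ : Flow ℝ F} (x : F) {T : ℝ} (hT : 0 < T) :
    FollowsFlow ι ψ (orbitPath ψ x T) := by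
  intro s hs _
  refine ⟨T, hT, ?_⟩
  have h : ∀ t ∈ Set.Ioo (0 : ℝ) 1, (orbitPath ψ x T).extend t = ψ (T * t) x := fun t ht => by
    rw [Path.extend_apply _ ⟨ht.1.le, ht.2.le⟩]; rfl
  filter_upwards [isOpen_Ioo.mem_nhds hs] with t ht
  rw [h t ht, h s hs, ← ψ.map_add]
  congr 1
  ring

variable [IsManifold (𝓡 n) ∞ F]

/-- `isTransverseAt_of_loop` for loops that are given as paths with a transverse end point. -/
theorem isTransverseAt_of_followsFlow {H : Cotangent n S → ℝ} (hH : IsConvexHamiltonian H)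
    {φ : Flow ℝ (Cotangent n S)} (hφ : IsHamiltonianFlow H φ) {ι : F → Cotangent n S}
    (hι : IsLagrangianEmbedding ι) {c : ℝ} (hc : ∀ p, H (ι p) = c) {ψ : Flow ℝ F}
    (hψ : ∀ t p, ι (ψ t p) = φ t (ι p)) (hM : MaslovCocycleVanishes ι) {x : F}
    (hx : IsTransverseAt ι x) {P : Path x x} (hP : FollowsFlow ι ψ P) {y : F}
    (hy : y ∈ Set.range P) : IsTransverseAt ι y := by
  let γ : C(UnitAddCircle, F) := ⟨AddCircle.liftIco 1 0 P.extend,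
    AddCircle.liftIco_zero_continuous (by simp) P.continuous_extend.continuousOn⟩
  have hγ : ∀ s ∈ Set.Ico (0 : ℝ) 1, γ s = P.extend s := fun s hs =>
    AddCircle.liftIco_zero_coe_apply (f := P.extend) hs
  have hper : ∀ (s : ℝ) (k : ℤ), ((s - k : ℝ) : UnitAddCircle) = s := by
    intro s k
    have : ((k : ℝ) : UnitAddCircle) = 0 := by
      rw [AddCircle.coe_eq_zero_iff]
      exact ⟨k, by simp⟩
    rw [AddCircle.coe_sub, this, sub_zero]
  have key := isTransverseAt_of_loop hH hφ hι hc γ (hM γ) ?_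
  · obtain ⟨s, rfl⟩ := hy
    rcases eq_or_lt_of_le s.2.2 with h1 | h1
    · have : s = 1 := Subtype.ext h1
      rw [this, P.target]
      exact hx
    · have h2 := key s
      rwa [hγ s ⟨s.2.1, h1⟩, P.extend_apply s.2] at h2
  · intro t₀ ht₀
    have h0 : γ t₀ = P.extend (Int.fract t₀) := by
      rw [← hγ _ ⟨Int.fract_nonneg _, Int.fract_lt_one _⟩, Int.fract, hper]
    have hpos : 0 < Int.fract t₀ := by
      refine lt_of_le_of_ne (Int.fract_nonneg _) fun h => ht₀ ?_
      rw [h0, ← h, P.extend_zero]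
      exact hx
    have hmem : Int.fract t₀ ∈ Set.Ioo (0 : ℝ) 1 := ⟨hpos, Int.fract_lt_one _⟩
    rw [h0] at ht₀ ⊢
    obtain ⟨l, hl, hev⟩ := hP _ hmem ht₀
    have h2 : Tendsto (fun t : ℝ => t - ⌊t₀⌋) (𝓝 t₀) (𝓝 (Int.fract t₀)) :=
      Continuous.tendsto' (by fun_prop) _ _ rfl
    refine ⟨l, hl, ?_⟩
    filter_upwards [h2.eventually hev, h2.eventually (isOpen_Ioo.mem_nhds hmem)] with t ht htm
    rw [← hper t ⌊t₀⌋, hγ _ ⟨htm.1.le, htm.2⟩, ht, hψ]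
    congr 1
    rw [Int.fract]
    ring

/-- Recurrence closes up the orbit of a point of tangency to a loop which follows the flow; the
vanishing of the Maslov cocycle on this loop excludes the tangency. -/
theorem isTransverseAt_of_nonwandering {H : Cotangent n S → ℝ} (hH : IsConvexHamiltonian H)
    {φ : Flow ℝ (Cotangent n S)} (hφ : IsHamiltonianFlow H φ) {ι : F → Cotangent n S}
    (hι : IsLagrangianEmbedding ι) {c : ℝ} (hc : ∀ p, H (ι p) = c) {ψ : Flow ℝ F}
    (hψ : ∀ t p, ι (ψ t p) = φ t (ι p)) (hM : MaslovCocycleVanishes ι)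
    (hnw : nonwanderingSet φ (Set.range ι) = Set.range ι) (p : F) : IsTransverseAt ι p := by
  have hemb := hι.isSmoothEmbedding.isEmbedding
  have hlpc : LocallyPathConnectedSpace F := ChartedSpace.locallyPathConnectedSpace (Vec n) F
  obtain ⟨δ, hδ, hiso⟩ := Metric.eventually_nhds_iff.1
    (eventually_isTransverseAt_flow hH hφ hι hc hψ p)
  set ε := min (δ / 2) (1 / 2) with hε
  have hε0 : 0 < ε := lt_min (half_pos hδ) (by norm_num)
  have hεδ : ε < δ := (min_le_left _ _).trans_lt (half_lt_self hδ)
  have hε1 : 2 * ε ≤ 1 := by linarith [min_le_right (δ / 2) (1 / 2)]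
  have hxp : IsTransverseAt ι (ψ ε p) := hiso (by simpa [abs_of_pos hε0] using hεδ) hε0.ne'
  have hxm : IsTransverseAt ι (ψ (-ε) p) :=
    hiso (by simpa [abs_of_pos hε0] using hεδ) (neg_ne_zero.2 hε0.ne')
  set x := ψ (-ε) p with hx
  have hxε : ψ (2 * ε) x = ψ ε p := by
    rw [hx, ← ψ.map_add]; congr 1; ring
  -- near a transverse point, any two points are joined by a path of transverse points
  have hnhds : ∀ q, IsTransverseAt ι q → ∃ U ∈ 𝓝 q, ∀ y ∈ U, ∀ z ∈ U,
      ∃ P : Path y z, ∀ t, IsTransverseAt ι (P t) := by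
    intro q hq
    obtain ⟨U, ⟨hU, hUc⟩, hUs⟩ := (path_connected_basis q).mem_iff.1
      ((isOpen_setOf_isTransverseAt hι.isSmoothEmbedding).mem_nhds hq)
    refine ⟨U, hU, fun y hy z hz => ?_⟩
    obtain ⟨P, hP⟩ := hUc.joinedIn y hy z hz
    exact ⟨P, fun t => hUs (hP t)⟩
  obtain ⟨Um, hUm, hUmP⟩ := hnhds x hxm
  obtain ⟨Up, hUp, hUpP⟩ := hnhds _ hxp
  have hU : Um ∩ ψ (2 * ε) ⁻¹' Up ∈ 𝓝 x := by
    refine inter_mem hUm ?_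
    have hcont : Continuous (ψ (2 * ε)) := ψ.continuous continuous_const continuous_id
    refine hcont.continuousAt.preimage_mem_nhds ?_
    rwa [hxε]
  obtain ⟨V, hV, hVU⟩ := (hemb.nhds_eq_comap x ▸ hU : _ ∈ comap ι (𝓝 (ι x)))
  have hxnw : ι x ∈ nonwanderingSet φ (Set.range ι) := by rw [hnw]; exact ⟨x, rfl⟩
  -- the time `T > 1 ≥ 2 ε` of the return leaves room for the initial piece from `y` to `ψ (2 ε) y`
  obtain ⟨T, hT, θ, ⟨θ', ⟨hθV', y, rfl⟩, hθ⟩, hθV, z, rfl⟩ := hxnw.2 V hV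
  have hz : z = ψ T y := hemb.injective (by rw [← hθ, hψ])
  subst hz
  have hy := hVU (show y ∈ ι ⁻¹' V from hθV')
  have hTy := hVU (show ψ T y ∈ ι ⁻¹' V from hθV)
  -- the loop: from `x` through `p` to `ψ (2 ε) x`, to the nearby point `ψ (2 ε) y`, along the orbit
  -- to `ψ T y`, and back to the nearby point `x`
  obtain ⟨P₂, hP₂⟩ := hUpP (ψ (2 * ε) x) (by rw [hxε]; exact mem_of_mem_nhds hUp) _ hy.2
  obtain ⟨P₄, hP₄⟩ := hUmP _ hTy.1 x (mem_of_mem_nhds hUm)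
  have hT2 : ψ (T - 2 * ε) (ψ (2 * ε) y) = ψ T y := by
    rw [← ψ.map_add]; congr 1; ring
  set P₁ := orbitPath ψ x (2 * ε) with hP₁
  set P₃ := (orbitPath ψ (ψ (2 * ε) y) (T - 2 * ε)).cast rfl hT2.symm with hP₃
  have hf₃ : FollowsFlow ι ψ P₃ :=
    followsFlow_orbitPath (ψ (2 * ε) y) (show 0 < T - 2 * ε by linarith)
  have t1 : IsTransverseAt ι (ψ (2 * ε) x) := by rw [hxε]; exact hxp
  have t2 : IsTransverseAt ι (ψ (2 * ε) y) := by
    have := hP₂ 1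
    rwa [P₂.target] at this
  have t3 : IsTransverseAt ι (ψ T y) := by
    have := hP₄ 0
    rwa [P₄.source] at this
  have hall : FollowsFlow ι ψ (P₁.trans (P₂.trans (P₃.trans P₄))) :=
    (followsFlow_orbitPath x (by linarith)).trans ((followsFlow_of_isTransverseAt hP₂).trans
      (hf₃.trans (followsFlow_of_isTransverseAt hP₄) t3) t2) t1
  refine isTransverseAt_of_followsFlow hH hφ hι hc hψ hM hxm hall ?_
  rw [Path.trans_range]
  refine Or.inl ⟨⟨1 / 2, by norm_num, by norm_num⟩, ?_⟩
  change ψ (2 * ε * (1 / 2)) x = p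
  rw [hx, ← ψ.map_add]
  have : 2 * ε * (1 / 2) + -ε = 0 := by ring
  rw [this, ψ.map_zero_apply]
end

/-! ### The projection is a covering map -/

section
open Filter
variable {n : ℕ} {S : Type*} [TopologicalSpace S] [ChartedSpace (Vec n) S]
  [IsManifold (𝓡 n) ∞ S]
  {F : Type*} [TopologicalSpace F] [ChartedSpace (Vec n) F] [IsManifold (𝓡 n) ∞ F]

/-- The projection of a lagrangian submanifold that is transverse to the vertical is a local
diffeomorphism. -/
theorem isLocalDiffeomorph_proj_comp {ι : F → Cotangent n S}
    (hι : IsSmoothEmbedding (𝓡 n) (cotModel n) ∞ ι) (htr : ∀ p, IsTransverseAt ι p) :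
    IsLocalDiffeomorph (𝓡 n) (𝓡 n) ∞ fun p => (ι p).proj := by
  intro p
  have hsm := hι.contMDiff
  set f : F → S := fun p => (ι p).proj with hf
  have hfs : ContMDiff (𝓡 n) (𝓡 n) ∞ f :=
    (contMDiff_proj (fun x : S => CotangentSpace n x)).comp hsm
  set O := {q : F | q ∈ (chartAt (Vec n) p).source ∧
    ι q ∈ (chartAt (ModelProd (Vec n) (Covec n)) (ι p)).source} with hO
  have hOo : IsOpen O := (chartAt (Vec n) p).open_source.inter
    ((chartAt (ModelProd (Vec n) (Covec n)) (ι p)).open_source.preimage hsm.continuous)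
  have hpO : p ∈ O := ⟨mem_chart_source _ p, mem_chart_source _ _⟩
  set g : Vec n → Vec n := fun u => (chartMap ι p u).1 with hg
  have hgf : ∀ q ∈ O, g (extChartAt (𝓡 n) p q) = extChartAt (𝓡 n) (f p) (f q) := by
    intro q hq
    simp only [hg]
    rw [chartMap_extChartAt ι hq.1, canonicalChart_apply]
  have hgs : ∀ q ∈ O, ContDiffAt ℝ ∞ g (extChartAt (𝓡 n) p q) := fun q hq =>
    contDiffAt_fst.comp _ (contDiffAt_chartMap hsm hq.1 hq.2)
  have hgd : ∀ q ∈ O, ∃ e : Vec n ≃L[ℝ] Vec n,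
      HasFDerivAt g (e : Vec n →L[ℝ] Vec n) (extChartAt (𝓡 n) p q) := by
    intro q hq
    have hinj := (isTransverseAt_iff hι hq.1 hq.2).1 (htr q)
    refine ⟨(LinearEquiv.ofInjectiveEndo ((ContinuousLinearMap.fst ℝ (Vec n) (Covec n)).comp
      (tangentFrame ι p q)).toLinearMap hinj).toContinuousLinearEquiv, ?_⟩
    have h1 := ((contDiffAt_chartMap hsm hq.1 hq.2).differentiableAt (by norm_num)).hasFDerivAt
    have h2 := (ContinuousLinearMap.fst ℝ (Vec n) (Covec n)).hasFDerivAt.comp _ h1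
    exact h2
  -- the local inverse `A.symm` is smooth on all of its domain, not only at `f p`, since `g` has an
  -- invertible derivative at every point of `O`
  obtain ⟨e₀, he₀⟩ := hgd p hpO
  let G := (hgs p hpO).toOpenPartialHomeomorph g he₀ (by norm_num)
  have hGg : ∀ u, G u = g u := fun u => rfl
  let A := (((chartAt (Vec n) p).trans G).trans (chartAt (Vec n) (f p)).symm).restrOpen O hOo
  have hAsrc : ∀ q ∈ A.source, q ∈ O ∧ extChartAt (𝓡 n) p q ∈ G.source := by
    intro q hq
    exact ⟨hq.2, hq.1.1.2⟩
  have hfO : ∀ q ∈ O, f q ∈ (chartAt (Vec n) (f p)).source := fun q hq =>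
    mem_cotangent_chart_source.1 hq.2
  have hAf : ∀ q ∈ O, A q = f q := by
    intro q hq
    have h1 : A q = (chartAt (Vec n) (f p)).symm (g (extChartAt (𝓡 n) p q)) := rfl
    rw [h1, hgf q hq]
    exact (chartAt (Vec n) (f p)).left_inv (hfO q hq)
  have hpA : p ∈ A.source := by
    refine ⟨⟨⟨hpO.1, ?_⟩, ?_⟩, hpO⟩
    · exact (hgs p hpO).mem_toOpenPartialHomeomorph_source he₀ (by norm_num)
    · have h1 : g (extChartAt (𝓡 n) p p) ∈ (chartAt (Vec n) (f p)).target := by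
        rw [hgf p hpO]
        exact (chartAt (Vec n) (f p)).map_source (mem_chart_source _ _)
      exact h1
  refine ⟨⟨A.toPartialEquiv, A.open_source, A.open_target, ?_, ?_⟩, hpA,
    fun q hq => (hAf q (hAsrc q hq).1).symm⟩
  · exact hfs.contMDiffOn.congr fun q hq => hAf q (hAsrc q hq).1
  · intro y hy
    have hq := A.map_target hy
    set q := A.symm y with hqdef
    have hqO := (hAsrc q hq).1
    have hyq : y = f q := by rw [← hAf q hqO, hqdef, A.right_inv hy]
    refine ContMDiffAt.contMDiffWithinAt ?_
    have hz : extChartAt (𝓡 n) (f p) y = G (extChartAt (𝓡 n) p q) := by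
      rw [hGg, hgf q hqO, hyq]
    have hGs : G.symm (extChartAt (𝓡 n) (f p) y) = extChartAt (𝓡 n) p q := by
      rw [hz, G.left_inv (hAsrc q hq).2]
    obtain ⟨e, he⟩ := hgd q hqO
    have h1 : ContMDiffAt (𝓡 n) 𝓘(ℝ, Vec n) ∞ (extChartAt (𝓡 n) (f p)) y :=
      contMDiffAt_extChartAt' (hyq ▸ hfO q hqO)
    have h2 : ContDiffAt ℝ ∞ G.symm (extChartAt (𝓡 n) (f p) y) := by
      refine G.contDiffAt_symm (f₀' := e) ?_ ?_ ?_
      · rw [hz]; exact G.map_source (hAsrc q hq).2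
      · rw [hGs]; exact he
      · rw [hGs]; exact hgs q hqO
    have h3 : ContMDiffAt 𝓘(ℝ, Vec n) (𝓡 n) ∞ (extChartAt (𝓡 n) p).symm
        (G.symm (extChartAt (𝓡 n) (f p) y)) := by
      rw [hGs]
      refine (contMDiffOn_extChartAt_symm p).contMDiffAt
        ((isOpen_extChartAt_target p).mem_nhds ((extChartAt (𝓡 n) p).map_source ?_))
      rw [extChartAt_source]
      exact hqO.1
    exact ContMDiffAt.comp (g := (extChartAt (𝓡 n) p).symm)
      (f := G.symm ∘ extChartAt (𝓡 n) (f p)) y h3 (h2.contMDiffAt.comp y h1)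

theorem surjective_of_isLocalHomeomorph {X Y : Type*} [TopologicalSpace X] [TopologicalSpace Y]
    [CompactSpace X] [T2Space Y] [ConnectedSpace Y] [Nonempty X] {f : X → Y}
    (hf : IsLocalHomeomorph f) : Function.Surjective f := by
  have h1 : IsClopen (Set.range f) :=
    ⟨(isCompact_range hf.continuous).isClosed, hf.isOpenMap.isOpen_range⟩
  exact Set.range_eq_univ.1 (h1.eq_univ (Set.range_nonempty f))

theorem finite_preimage_of_isCoveringMap {X Y : Type*} [TopologicalSpace X] [TopologicalSpace Y]
    [CompactSpace X] [T1Space Y] {f : X → Y} (hf : IsCoveringMap f) (y : Y) :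
    (f ⁻¹' {y}).Finite := by
  have h1 : DiscreteTopology (f ⁻¹' {y}) := (hf y).1
  exact (isClosed_singleton.preimage hf.continuous).isCompact.finite ⟨h1⟩

end

end

theorem mainTheorem6 (n : ℕ)
    {S : Type*} [TopologicalSpace S] [ChartedSpace (Vec n) S] [IsManifold (𝓡 n) ∞ S]
    [T2Space S] [SecondCountableTopology S]
    {F : Type*} [TopologicalSpace F] [ChartedSpace (Vec n) F] [IsManifold (𝓡 n) ∞ F]
    [T2Space F] [CompactSpace F]
    (H : Cotangent n S → ℝ) (hH : IsConvexHamiltonian H)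
    (φ : Flow ℝ (Cotangent n S)) (hφ : IsHamiltonianFlow H φ)
    (ι : F → Cotangent n S) (hι : IsLagrangianEmbedding ι)
    (c : ℝ) (hc : ∀ p, H (ι p) = c)
    (hM : MaslovCocycleVanishes ι)
    (hnw : nonwanderingSet φ (Set.range ι) = Set.range ι) :
    (IsSmoothCoveringMap (𝓡 n) (𝓡 n) (fun p => (ι p).proj) ∧
      (ConnectedSpace S → Nonempty F → Function.Surjective fun p => (ι p).proj)) ∧
    (Nonempty (F ≃ₘ^∞⟮𝓡 n, torusModel n⟯ StdTorus n) →
      ∃ f : StdTorus n → S, IsSmoothCoveringMap (torusModel n) (𝓡 n) f ∧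
        (∀ x, (f ⁻¹' {x}).Finite) ∧ (ConnectedSpace S → Function.Surjective f)) := by
  obtain ⟨ψ, hψ⟩ := exists_flow_restrict hH.contMDiff hφ hι hc
  have hloc := isLocalDiffeomorph_proj_comp hι.isSmoothEmbedding
    (isTransverseAt_of_nonwandering hH hφ hι hc hψ hM hnw)
  refine ⟨⟨⟨isLocalHomeomorph_iff_isCoveringMap.1 hloc.isLocalHomeomorph, hloc⟩,
    fun _ _ => surjective_of_isLocalHomeomorph hloc.isLocalHomeomorph⟩, ?_⟩
  rintro ⟨d⟩
  have hloc' : IsLocalDiffeomorph (torusModel n) (𝓡 n) ∞ ((fun p => (ι p).proj) ∘ d.symm) :=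
    fun x => (d.symm.isLocalDiffeomorph x).comp (𝓡 n) S (hloc (d.symm x))
  have hcov := isLocalHomeomorph_iff_isCoveringMap.1 hloc'.isLocalHomeomorph
  exact ⟨_, ⟨hcov, hloc'⟩, finite_preimage_of_isCoveringMap hcov,
    fun _ => surjective_of_isLocalHomeomorph hloc'.isLocalHomeomorph⟩
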